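/- Let $n\ge 2$, let $\Omega\subset\mathbb R^n$ be a nonempty bounded open set with Lipschitz boundary, let $\beta\in L^\infty(\Omega)$ with $\operatorname{ess\,inf}_\Omega\beta>0$, and let $f:\mathbb R\to\mathbb R$ be continuous with $\lim_{t\to0}f(t)/t=0$, $\lim_{|t|\to\infty}f(t)/t=0$ and $\sup_{t\in\mathbb R}F(t)>0$, where $F(t)=\int_0^tf(z)\,dz$. Put $\mathcal C_\Omega=\Omega\times(0,\infty)$ and let $X_0^{1/2}(\mathcal C_\Omega)$ be the space of all $w\in H^1(\mathcal C_\Omega)$ that vanish on the lateral boundary $\partial\Omega\times[0,\infty)$ (i.e. the closure in $H^1(\mathcal C_\Omega)$ of the restrictions of functions in $C_c^\infty(\Omega\times\mathbb R)$), with trace $\operatorname{Tr}(w)=w(\cdot,0)$ on $\Omega$. Let $$\Phi(w)=\tfrac12\int_{\mathcal C_\Omega}|\nabla w|^2\,dx\,dy,\qquad \Psi(w)=\int_\Omega\beta(x)F(\operatorname{Tr}(w)(x))\,dx,\qquad \lambda^\star=\inf\Big\{\frac{\Phi(w)}{\Psi(w)}: w\in X_0^{1/2}(\mathcal C_\Omega),\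 \Psi(w)>0\Big\}.$$ Let $\lambda_1$ be the first Dirichlet eigenvalue of $-\Delta$ in $\Omega$ and $c_f=\max_{t\ne0}|f(t)|/|t|$. Let $H_0^{1/2}(\Omega)$ be the space of all $u=\sum_ja_j\varphi_j\in L^2(\Omega)$ with $\sum_ja_j^2\lambda_j^{1/2}<\infty$, where $(\varphi_j)$ is an orthonormal basis of $L^2(\Omega)$ of Dirichlet eigenfunctions of $-\Delta$ with eigenvalues $\lambda_j$. A weak solution of $$A_{1/2}u=\lambda\beta(x)f(u)\ \text{ in }\Omega,\qquad u=0\ \text{ on }\partial\Omega \tag{$P_\lambda$}$$ is a function $u\in H_0^{1/2}(\Omega)$ such that $u=\operatorname{Tr}(w)$ for some $w\in X_0^{1/2}(\mathcal C_\Omega)$ with $\int_{\mathcal C_\Omega}\nabla w\cdot\nabla v\,dx\,dy=\lambda\int_\Omega\beta f(\operatorname{Tr}(w))\operatorname{Tr}(v)\,dx$ for all $v\in X_0^{1/2}(\mathcal C_\Omega)$. Then $\lambda_1$ exists (as the least Dirichlet eigenvalue) and is positive, the maximum $c_f$ exists and is positive, the set over which the infimum $\lambda^\star$ is taken is nonempty,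 and $$\frac{\lambda_1^{1/2}}{c_f\,\|\beta\|_{L^\infty(\Omega)}}\le\lambda^\star .$$ Moreover, let $x_0\in\Omega$ and $\tau>0$ be such that $B(x_0,\tau)\subseteq\Omega$. For $t\in\mathbb R$ and $\sigma\in(0,1)$ put $$D(t,\sigma)=F(t)\,\sigma^n\operatorname*{ess\,inf}_\Omega\beta-(1-\sigma^n)\max_{|s|\le|t|}|F(s)|\,\|\beta\|_{L^\infty(\Omega)} .$$ Then there are $t_0\in\mathbb R$ and $\sigma_0\in(0,1)$ with $D(t_0,\sigma_0)>0$. For all such $t_0,\sigma_0$, let $$\lambda_0=\frac{t_0^2\left(\dfrac{\omega_n\tau^{n-2}(1-\sigma_0^n)}{(1-\sigma_0)^2}+\dfrac{|\Omega|}{4}\right)}{2\,\omega_n\tau^n\,D(t_0,\sigma_0)},\qquad \omega_n=\frac{\pi^{n/2}}{\Gamma(1+n/2)},$$ and let $w_0(x,y)=e^{-y/2}\omega(x)$, where $\omega(x)=t_0$ if $|x-x_0|<\sigma_0\tau$, $\omega(x)=\frac{t_0}{(1-\sigma_0)\tau}(\tau-|x-x_0|)$ if $\sigma_0\tau\le|x-x_0|<\tau$,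 and $\omega(x)=0$ otherwise. Then $w_0\in X_0^{1/2}(\mathcal C_\Omega)$, $\operatorname{Tr}(w_0)=\omega$, $\Psi(w_0)>0$ and $$\lambda^\star\le\frac{\Phi(w_0)}{\Psi(w_0)}\le\lambda_0 .$$ In particular $\lambda^\star\le\lambda_0$, and for every $\lambda>\lambda_0$ problem $(P_\lambda)$ has at least two distinct nontrivial weak solutions in $L^\infty(\Omega)\cap H_0^{1/2}(\Omega)$. -/

import Mathlib

open MeasureTheory Set Filter Topology
open scoped ENNReal ContDiff RealInnerProductSpace

noncomputable section

namespace HalfLaplacian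

/-- Euclidean space of dimension `n`. -/
abbrev Euc (n : ℕ) : Type := EuclideanSpace ℝ (Fin n)

/-! ### The domain -/

/-- `Ω` has Lipschitz boundary: near each boundary point, `Ω` is, for a suitable unit vector `ν`,
the set of points lying (in direction `ν`) strictly above the graph of a Lipschitz function of the
orthogonal projection `x - ⟪ν, x⟫ ν` of `x` to the hyperplane orthogonal to `ν`. -/
def HasLipschitzBoundary {n : ℕ} (Ω : Set (Euc n)) : Prop :=
  ∀ p ∈ frontier Ω, ∃ ν : Euc n, ‖ν‖ = 1 ∧ ∃ r : ℝ, 0 < r ∧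
    ∃ (K : NNReal) (g : Euc n → ℝ), LipschitzWith K g ∧
      ∀ x ∈ Metric.ball p r, x ∈ Ω ↔ g (x - ⟪ν, x⟫ • ν) < ⟪ν, x⟫

/-- The half-cylinder `Ω × (0, ∞)`. -/
def cylinder {n : ℕ} (Ω : Set (Euc n)) : Set (Euc n × ℝ) := Ω ×ˢ Ioi (0 : ℝ)

/-- Lebesgue measure on `Ω`. -/
def baseMeasure {n : ℕ} (Ω : Set (Euc n)) : Measure (Euc n) := volume.restrict Ω

/-- Lebesgue measure on the half-cylinder over `Ω`. -/
def cylMeasure {n : ℕ} (Ω : Set (Euc n)) : Measure (Euc n × ℝ) := volume.restrict (cylinder Ω)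

/-! ### Test functions and weak gradients -/

/-- `φ` is a smooth function with compact support contained in `U`. -/
def IsTest {V : Type*} [NormedAddCommGroup V] [NormedSpace ℝ V] (U : Set V) (φ : V → ℝ) : Prop :=
  ContDiff ℝ ∞ φ ∧ HasCompactSupport φ ∧ tsupport φ ⊆ U

/-- The gradient in the first variable of a function on the cylinder. -/
def gradX {n : ℕ} (φ : Euc n × ℝ → ℝ) (p : Euc n × ℝ) : Euc n :=
  gradient (fun x => φ (x, p.2)) p.1

/-- The partial derivative in the last variable of a function on the cylinder. -/
def derivY {n : ℕ} (φ : Euc n × ℝ → ℝ) (p : Euc n × ℝ) : ℝ :=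
  deriv (fun y => φ (p.1, y)) p.2

/-- `g` is the weak gradient of `u` on `Ω`. -/
def IsWeakGradient {n : ℕ} (Ω : Set (Euc n)) (u : Euc n → ℝ) (g : Euc n → Euc n) : Prop :=
  ∀ φ : Euc n → ℝ, IsTest Ω φ →
    ∫ x, u x • gradient φ x ∂(baseMeasure Ω) = -∫ x, φ x • g x ∂(baseMeasure Ω)

/-- `(gx, gy)` is the weak gradient of `w` on the half-cylinder over `Ω`. -/
def IsWeakGradientCyl {n : ℕ} (Ω : Set (Euc n)) (w : Euc n × ℝ → ℝ)
    (gx : Euc n × ℝ → Euc n) (gy : Euc n × ℝ → ℝ) : Prop :=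
  ∀ φ : Euc n × ℝ → ℝ, IsTest (cylinder Ω) φ →
    ∫ p, w p • gradX φ p ∂(cylMeasure Ω) = -∫ p, φ p • gx p ∂(cylMeasure Ω) ∧
    ∫ p, w p * derivY φ p ∂(cylMeasure Ω) = -∫ p, φ p * gy p ∂(cylMeasure Ω)

/-! ### The Dirichlet Laplacian on `Ω` -/

/-- `u` belongs to the Sobolev space `H^1_0(Ω)` and has weak gradient `g`: it is a function in
`H^1(Ω)` which is the limit in `H^1(Ω)` of smooth functions with compact support in `Ω`. -/
structure IsH01 {n : ℕ} (Ω : Set (Euc n)) (u : Euc n → ℝ) (g : Euc n → Euc n) : Prop where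
  memLp : MemLp u 2 (baseMeasure Ω)
  memLp_grad : MemLp g 2 (baseMeasure Ω)
  weakGradient : IsWeakGradient Ω u g
  approx : ∃ φ : ℕ → Euc n → ℝ, (∀ k, IsTest Ω (φ k)) ∧
    Tendsto (fun k => eLpNorm (fun x => φ k x - u x) 2 (baseMeasure Ω)) atTop (𝓝 0) ∧
    Tendsto (fun k => eLpNorm (fun x => gradient (φ k) x - g x) 2 (baseMeasure Ω)) atTop (𝓝 0)

/-- `u` is an eigenfunction, with eigenvalue `μ`, of `-Δ` on `Ω` with zero Dirichlet boundary
condition: `u ∈ H^1_0(Ω)` is nonzero and solves `-Δ u = μ u` weakly. -/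
def IsDirichletEigenfunction {n : ℕ} (Ω : Set (Euc n)) (μ : ℝ) (u : Euc n → ℝ) : Prop :=
  ¬ (u =ᵐ[baseMeasure Ω] 0) ∧
  ∃ g : Euc n → Euc n, IsH01 Ω u g ∧ ∀ φ : Euc n → ℝ, IsTest Ω φ →
    ∫ x, ⟪g x, gradient φ x⟫ ∂(baseMeasure Ω) = μ * ∫ x, u x * φ x ∂(baseMeasure Ω)

/-- The set of Dirichlet eigenvalues of `-Δ` on `Ω`. -/
def dirichletEigenvalues {n : ℕ} (Ω : Set (Euc n)) : Set ℝ :=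
  {μ | ∃ u, IsDirichletEigenfunction Ω μ u}

/-- The first Dirichlet eigenvalue `λ₁` of `-Δ` on `Ω`. -/
def firstEigenvalue {n : ℕ} (Ω : Set (Euc n)) : ℝ := sInf (dirichletEigenvalues Ω)

/-- The space `H_0^{1/2}(Ω)`, defined spectrally: `u ∈ L²(Ω)` and, for a complete orthonormal
system `e j` of `L²(Ω)` made of Dirichlet eigenfunctions of `-Δ` with eigenvalues `Λ j`, the
coefficients `a j = ∫ u e_j` satisfy `∑ a_j² Λ_j^{1/2} < ∞`. -/
def MemH0Half {n : ℕ} (Ω : Set (Euc n)) (u : Euc n → ℝ) : Prop :=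
  MemLp u 2 (baseMeasure Ω) ∧
  ∃ (e : ℕ → Euc n → ℝ) (Λ : ℕ → ℝ),
    (∀ j, IsDirichletEigenfunction Ω (Λ j) (e j)) ∧
    (∀ i j, ∫ x, e i x * e j x ∂(baseMeasure Ω) = if i = j then 1 else 0) ∧
    (∀ v : Euc n → ℝ, MemLp v 2 (baseMeasure Ω) →
      (∀ j, ∫ x, v x * e j x ∂(baseMeasure Ω) = 0) → v =ᵐ[baseMeasure Ω] 0) ∧
    Summable (fun j => (∫ x, u x * e j x ∂(baseMeasure Ω)) ^ 2 * √(Λ j))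

/-! ### The extension space -/

/-- An element of the space `X_0^{1/2}` of functions `w ∈ H^1(Ω × (0, ∞))` that vanish on the
lateral boundary `∂Ω × [0, ∞)`, together with its weak gradient `(gx, gy)` and its trace `tr` on
`Ω × {0}` (all of them determined by `w` up to null sets). Vanishing on the lateral boundary means
that `w` is the limit in `H^1(Ω × (0, ∞))` of (restrictions of) smooth functions with compact
support in `Ω × ℝ`; the trace map is the continuous extension to `X_0^{1/2}` of the map
`φ ↦ φ(·, 0)`, with values in `L²(Ω)`. -/
structure ExtSpace {n : ℕ} (Ω : Set (Euc n)) where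
  /-- the function `w` -/
  toFun : Euc n × ℝ → ℝ
  /-- its weak gradient in `x` -/
  gx : Euc n × ℝ → Euc n
  /-- its weak derivative in `y` -/
  gy : Euc n × ℝ → ℝ
  /-- its trace on `Ω × {0}` -/
  tr : Euc n → ℝ
  memLp : MemLp toFun 2 (cylMeasure Ω)
  memLp_gx : MemLp gx 2 (cylMeasure Ω)
  memLp_gy : MemLp gy 2 (cylMeasure Ω)
  memLp_tr : MemLp tr 2 (baseMeasure Ω)
  weakGradient : IsWeakGradientCyl Ω toFun gx gy
  approx : ∃ φ : ℕ → Euc n × ℝ → ℝ, (∀ k, IsTest (Ω ×ˢ (univ : Set ℝ)) (φ k)) ∧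
    Tendsto (fun k => eLpNorm (fun p => φ k p - toFun p) 2 (cylMeasure Ω)) atTop (𝓝 0) ∧
    Tendsto (fun k => eLpNorm (fun p => gradX (φ k) p - gx p) 2 (cylMeasure Ω)) atTop (𝓝 0) ∧
    Tendsto (fun k => eLpNorm (fun p => derivY (φ k) p - gy p) 2 (cylMeasure Ω)) atTop (𝓝 0) ∧
    Tendsto (fun k => eLpNorm (fun x => φ k (x, 0) - tr x) 2 (baseMeasure Ω)) atTop (𝓝 0)

/-- The Dirichlet form `∫ ⟨∇w, ∇v⟩ dx dy` on the half-cylinder. -/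
def ExtSpace.form {n : ℕ} {Ω : Set (Euc n)} (w v : ExtSpace Ω) : ℝ :=
  ∫ p, (⟪w.gx p, v.gx p⟫ + w.gy p * v.gy p) ∂(cylMeasure Ω)

/-! ### Weak solutions, energies and constants -/

/-- `F(t) = ∫_0^t f(z) dz`. -/
def primitive (f : ℝ → ℝ) (t : ℝ) : ℝ := ∫ z in (0 : ℝ)..t, f z

/-- `u` is a weak solution of `A_{1/2} u = lam β f(u)` in `Ω`, `u = 0` on `∂Ω`:
`u ∈ H_0^{1/2}(Ω)` is the trace of some `w ∈ X_0^{1/2}` that weakly solves the extended problem. -/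
def IsWeakSolution {n : ℕ} (Ω : Set (Euc n)) (β : Euc n → ℝ) (f : ℝ → ℝ) (lam : ℝ)
    (u : Euc n → ℝ) : Prop :=
  MemH0Half Ω u ∧
  ∃ w : ExtSpace Ω, w.tr =ᵐ[baseMeasure Ω] u ∧
    ∀ v : ExtSpace Ω, w.form v = lam * ∫ x, β x * f (w.tr x) * v.tr x ∂(baseMeasure Ω)

/-- `Φ(w) = ½ ∫ |∇w|²`. -/
def Phi {n : ℕ} {Ω : Set (Euc n)} (w : ExtSpace Ω) : ℝ := 1 / 2 * w.form w

/-- `Ψ(w) = ∫_Ω β F(Tr w)`. -/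
def Psi {n : ℕ} {Ω : Set (Euc n)} (β : Euc n → ℝ) (f : ℝ → ℝ) (w : ExtSpace Ω) : ℝ :=
  ∫ x, β x * primitive f (w.tr x) ∂(baseMeasure Ω)

/-- The set of quotients `Φ(w) / Ψ(w)` over all `w ∈ X_0^{1/2}` with `Ψ(w) > 0`. -/
def quotients {n : ℕ} (Ω : Set (Euc n)) (β : Euc n → ℝ) (f : ℝ → ℝ) : Set ℝ :=
  {q | ∃ w : ExtSpace Ω, 0 < Psi β f w ∧ q = Phi w / Psi β f w}

/-- The threshold `λ* = inf {Φ(w) / Ψ(w) : Ψ(w) > 0}`. -/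
def lambdaStar {n : ℕ} (Ω : Set (Euc n)) (β : Euc n → ℝ) (f : ℝ → ℝ) : ℝ :=
  sInf (quotients Ω β f)

/-- The set of all `|f(t)| / |t|`, `t ≠ 0`. -/
def slopes (f : ℝ → ℝ) : Set ℝ := {s | ∃ t : ℝ, t ≠ 0 ∧ s = |f t| / |t|}

/-- The constant `c_f`, the maximum of `|f(t)| / |t|` over `t ≠ 0`. -/
def slopeConst (f : ℝ → ℝ) : ℝ := sSup (slopes f)

/-- The norm of `β` in `L^∞(Ω)`. -/
def supNorm {n : ℕ} (Ω : Set (Euc n)) (β : Euc n → ℝ) : ℝ :=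
  (eLpNorm β ∞ (baseMeasure Ω)).toReal

/-- The measure `π^{n/2} / Γ(1 + n/2)` of the unit ball of dimension `n`. -/
def unitBallVolume (n : ℕ) : ℝ := Real.pi ^ ((n : ℝ) / 2) / Real.Gamma (1 + (n : ℝ) / 2)

/-- The maximum of `|F(s)|` over `|s| ≤ |t|`. -/
def maxPrimitive (f : ℝ → ℝ) (t : ℝ) : ℝ :=
  sSup ((fun s => |primitive f s|) '' Icc (-|t|) |t|)

/-- `F(t) σⁿ essinf β - (1 - σⁿ) max_{|s| ≤ |t|} |F(s)| ‖β‖_∞`. -/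
def gain {n : ℕ} (Ω : Set (Euc n)) (β : Euc n → ℝ) (f : ℝ → ℝ) (t σ : ℝ) : ℝ :=
  primitive f t * σ ^ n * essInf β (baseMeasure Ω)
    - (1 - σ ^ n) * maxPrimitive f t * supNorm Ω β

/-- The explicit constant `λ₀` (used only for `n ≥ 2`). -/
def lambdaZero {n : ℕ} (Ω : Set (Euc n)) (β : Euc n → ℝ) (f : ℝ → ℝ) (τ t σ : ℝ) : ℝ :=
  t ^ 2 * (unitBallVolume n * τ ^ (n - 2) * (1 - σ ^ n) / (1 - σ) ^ 2
      + (volume Ω).toReal / 4)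
    / (2 * unitBallVolume n * τ ^ n * gain Ω β f t σ)

open Classical in
/-- The truncated cone function: `t` on `B(x₀, σ τ)`, `0` off `B(x₀, τ)`, affine in `|x - x₀|`
in between. -/
def truncCone {n : ℕ} (x₀ : Euc n) (τ σ t : ℝ) (x : Euc n) : ℝ :=
  if x ∈ Metric.ball x₀ (σ * τ) then t
  else if x ∈ Metric.ball x₀ τ then t / ((1 - σ) * τ) * (τ - ‖x - x₀‖)
  else 0

end HalfLaplacian

end

open HalfLaplacian

noncomputable section

namespace HalfLaplacian

/-! An element of the extension space is represented by its gradient, and these gradients form a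
Hilbert space `energySpace Ω` whose squared norm is twice `Phi`. By Poincaré's inequality on
horizontal slices, the function and its trace are bounded operators of the gradient. The trace
operator T is moreover compact, because averages over small boxes, which have finite rank,
approximate it in operator norm (`exists_averageOp`). Traces of critical points of E(u) = ½‖u‖² - λ
∫ β F(T u) are weak solutions.

Sublinearity of f at infinity makes E coercive, and compactness of T gives the Palais–Smale
property. Since f(t) = o(t) at zero, E(u) ≥ ¼‖u‖² on a small ball. If E is negative somewhere, its
minimizer has negative energy, and the mountain pass theorem gives another critical point with
positive energy (`exists_two_critical_points`). The signs separate the two points from each other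
and from zero; the traces are then also distinct and nonzero, since a critical point is determined
by its trace.

The square root of the Laplacian enters through the one-dimensional inequality s c(0)² ≤ ∫ (s² c² +
c'²) on the half-line. With s = √Λ_j and c the coefficient of the horizontal slices along the
Dirichlet eigenfunction e_j, it gives ∑ √Λ_j ⟨e_j, Tr w⟩² ≤ ‖∇w‖² (`sum_sqrt_mul_inner_sq_le`).
Hence traces lie in H_0^{1/2}, and √λ₁ ‖Tr w‖² ≤ ‖∇w‖²; together with |F(t)| ≤ c_f t²/2 the latter
is the lower bound for λ*. The eigenbasis exists because the embedding of H^1_0 in L² factors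
through T and so is compact.

Solutions are bounded by comparison with multiples of an explicit positive superharmonic function
whose outward normal derivative on the bottom is positive (`ramp_inequality`, `exists_upper_bound`).
The upper bound for λ* is the computation of both functionals on e^{-y/2} times the truncated cone;
for λ > λ₀ the same function makes E negative. -/

/-! ### A deformation lemma and its consequences -/

section CriticalPoints

variable {H : Type*} [NormedAddCommGroup H] [InnerProductSpace ℝ H]

/-- The values and gradient `D` of a functional `E` on a Hilbert space such that: `D` is uniformly
continuous and bounded on bounded sets, sublevel sets are bounded and the Palais–Smale condition
holds. -/
structure IsTameFunctional (E : H → ℝ) (D : H → H) : Prop where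
  hasFDerivAt : ∀ u, HasFDerivAt E (innerSL ℝ (D u)) u
  unif : ∀ R : ℝ, ∀ ε > 0, ∃ δ > 0, ∀ u, ‖u‖ ≤ R → ∀ z, ‖z - u‖ ≤ δ → ‖D z - D u‖ ≤ ε
  bounded : ∀ R : ℝ, ∃ M : ℝ, ∀ u, ‖u‖ ≤ R → ‖D u‖ ≤ M
  sublevel : ∀ b : ℝ, ∃ R : ℝ, ∀ u, E u ≤ b → ‖u‖ ≤ R
  palaisSmale : ∀ (u : ℕ → H) (c : ℝ), Tendsto (fun k => E (u k)) atTop (𝓝 c) →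
    Tendsto (fun k => D (u k)) atTop (𝓝 0) → ∃ z, D z = 0 ∧ E z = c

lemma IsTameFunctional.continuous {E : H → ℝ} {D : H → H} (h : IsTameFunctional E D) :
    Continuous E :=
  continuous_iff_continuousAt.2 fun u => (h.hasFDerivAt u).continuousAt

lemma IsTameFunctional.continuous_grad {E : H → ℝ} {D : H → H} (h : IsTameFunctional E D) :
    Continuous D := by
  refine continuous_iff_continuousAt.2 fun u => Metric.continuousAt_iff.2 fun ε hε => ?_
  obtain ⟨δ, hδ, hD⟩ := h.unif ‖u‖ (ε / 2) (half_pos hε)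
  refine ⟨δ, hδ, fun {z} hz => ?_⟩
  rw [dist_eq_norm] at hz ⊢
  linarith [hD u le_rfl z hz.le]

/-- A descent step along the gradient. -/
lemma IsTameFunctional.descent {E : H → ℝ} {D : H → H} (h : IsTameFunctional E D) (b δ : ℝ)
    (hδ : 0 < δ) : ∃ s > 0, ∀ u, E u ≤ b → ∀ r, 0 ≤ r → r ≤ s →
      E (u - r • D u) ≤ E u - r * ‖D u‖ * (‖D u‖ - δ) := by
  obtain ⟨R, hR⟩ := h.sublevel b
  obtain ⟨M, hM⟩ := h.bounded R
  obtain ⟨ρ, hρ, hD⟩ := h.unif R δ hδ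
  -- With this step length the segment from u to u - r D u has length at most ρ, so D varies by at
  -- most δ along it. The mean value inequality for E minus its linearization at u then gives the
  -- claim.
  refine ⟨ρ / (|M| + 1), by positivity, fun u hu r hr hrs => ?_⟩
  have hDu : ‖D u‖ ≤ |M| + 1 := (hM u (hR u hu)).trans (by linarith [le_abs_self M])
  have hstep : ‖(u - r • D u) - u‖ = r * ‖D u‖ := by
    rw [sub_sub_cancel_left, norm_neg, norm_smul, Real.norm_of_nonneg hr]
  have hle : r * ‖D u‖ ≤ ρ := by
    rw [le_div_iff₀ (by positivity)] at hrs
    nlinarith [norm_nonneg (D u)]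
  have key := (convex_closedBall u ρ).norm_image_sub_le_of_norm_hasFDerivWithin_le'
    (f := E) (φ := innerSL ℝ (D u)) (C := δ) (x := u) (y := u - r • D u)
    (f' := fun z => innerSL ℝ (D z)) (fun z _ => (h.hasFDerivAt z).hasFDerivWithinAt)
    (fun z hz => by
      rw [← map_sub, innerSL_apply_norm]
      exact hD u (hR u hu) z (by simpa [dist_eq_norm] using hz))
    (Metric.mem_closedBall_self hρ.le)
    (by rw [Metric.mem_closedBall, dist_eq_norm, hstep]; exact hle)
  rw [hstep, sub_sub_cancel_left] at key
  have h2 : (innerSL ℝ (D u)) (-(r • D u)) = -(r * ‖D u‖ ^ 2) := by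
    simp [inner_smul_right]
  rw [h2] at key
  have := (abs_le.1 (Real.norm_eq_abs _ ▸ key)).2
  nlinarith

/-- Without a critical point at level c, the Palais–Smale property keeps the gradient away from zero
on a band of levels around c. A single gradient step replaces the usual flow: uniform continuity of
the gradient on bounded sets provides one step length for a whole sublevel set. The factor χ(E u)
switches the step off at low levels and keeps the map continuous. -/
lemma IsTameFunctional.exists_deformation {E : H → ℝ} {D : H → H} (h : IsTameFunctional E D)
    {c : ℝ} (hc : ¬ ∃ z, D z = 0 ∧ E z = c) {ρ : ℝ} (hρ : 0 < ρ) :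
    ∃ ε > 0, ∃ η : H → H, Continuous η ∧ (∀ u, E u ≤ c - ρ → η u = u) ∧
      ∀ u, E u < c + ε → E (η u) < c - ε := by
  obtain ⟨δ, hδ, hgrad⟩ : ∃ δ > 0, ∀ u, |E u - c| < δ → δ ≤ ‖D u‖ := by
    by_contra! hcon
    have hpos : ∀ k : ℕ, (0 : ℝ) < 1 / ((k : ℝ) + 1) := fun k => Nat.one_div_pos_of_nat
    choose u hu1 hu2 using fun k : ℕ => hcon (1 / ((k : ℝ) + 1)) (hpos k)
    refine hc (h.palaisSmale u c ?_ ?_)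
    · refine tendsto_iff_norm_sub_tendsto_zero.2 (squeeze_zero (fun _ => norm_nonneg _)
        (fun k => (hu1 k).le) tendsto_one_div_add_atTop_nhds_zero_nat)
    · exact squeeze_zero_norm (fun k => (hu2 k).le) tendsto_one_div_add_atTop_nhds_zero_nat
  set κ := min δ ρ / 2 with hκ
  have hκ0 : 0 < κ := by positivity
  have hκδ : 2 * κ ≤ δ := by rw [hκ]; linarith [min_le_left δ ρ]
  have hκρ : 2 * κ ≤ ρ := by rw [hκ]; linarith [min_le_right δ ρ]
  obtain ⟨s, hs, hdesc⟩ := h.descent (c + δ) (δ / 2) (by positivity)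
  set χ : ℝ → ℝ := fun t => max 0 (min 1 ((t - (c - 2 * κ)) / κ)) with hχ
  have hχ0 : ∀ t, 0 ≤ χ t := fun t => le_max_left _ _
  have hχ1 : ∀ t, χ t ≤ 1 := fun t => max_le zero_le_one (min_le_left _ _)
  have hχz : ∀ t, t ≤ c - 2 * κ → χ t = 0 := fun t ht => by
    refine max_eq_left ((min_le_right _ _).trans ?_)
    exact div_nonpos_of_nonpos_of_nonneg (by linarith) hκ0.le
  have hχo : ∀ t, c - κ ≤ t → χ t = 1 := fun t ht => by
    have : 1 ≤ (t - (c - 2 * κ)) / κ := by rw [le_div_iff₀ hκ0]; linarith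
    simp [hχ, min_eq_left this]
  have hχc : Continuous χ := by fun_prop
  -- The bound κ/2 serves levels below c - κ, where not increasing the energy is enough; δ/2 keeps
  -- the levels up to c + ε in the band where the gradient is large; s δ²/8 makes a full step, which
  -- gains at least s δ²/2, cross from c + ε to below c - ε.
  refine ⟨min (κ / 2) (min (δ / 2) (s * δ ^ 2 / 8)), by positivity,
    fun u => u - (s * χ (E u)) • D u, ?_, ?_, ?_⟩
  · exact continuous_id.sub ((continuous_const.mul (hχc.comp h.continuous)).smul h.continuous_grad)
  · intro u hu
    simp [hχz (E u) (by linarith)]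
  · intro u hu
    beta_reduce
    set ε := min (κ / 2) (min (δ / 2) (s * δ ^ 2 / 8))
    have hε1 : ε ≤ κ / 2 := min_le_left _ _
    have hε2 : ε ≤ δ / 2 := (min_le_right _ _).trans (min_le_left _ _)
    have hε3 : ε ≤ s * δ ^ 2 / 8 := (min_le_right _ _).trans (min_le_right _ _)
    rcases le_or_gt (E u) (c - 2 * κ) with h1 | h1
    · simp only [hχz (E u) h1, mul_zero, zero_smul, sub_zero]
      linarith
    have hg : δ ≤ ‖D u‖ := hgrad u (abs_lt.2 ⟨by linarith, by linarith⟩)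
    have hd := hdesc u (by linarith) (s * χ (E u)) (mul_nonneg hs.le (hχ0 _))
      (mul_le_of_le_one_right hs.le (hχ1 _))
    have hq : δ ^ 2 / 2 ≤ ‖D u‖ * (‖D u‖ - δ / 2) := by nlinarith
    rcases le_or_gt (c - κ) (E u) with h2 | h2
    · rw [hχo _ h2, mul_one] at hd ⊢
      have : s * (δ ^ 2 / 2) ≤ s * (‖D u‖ * (‖D u‖ - δ / 2)) := by gcongr
      have hsp : 0 < s * δ ^ 2 := by positivity
      nlinarith
    · have : 0 ≤ s * χ (E u) * (‖D u‖ * (‖D u‖ - δ / 2)) :=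
        mul_nonneg (mul_nonneg hs.le (hχ0 _)) (le_trans (by positivity) hq)
      nlinarith

/-- A tame functional that is bounded below attains its minimum, at a critical point. -/
lemma IsTameFunctional.exists_isMinimizer {E : H → ℝ} {D : H → H} (h : IsTameFunctional E D)
    (hb : BddBelow (range E)) : ∃ z, D z = 0 ∧ ∀ u, E z ≤ E u := by
  by_contra hcon
  have hc : ¬ ∃ z, D z = 0 ∧ E z = sInf (range E) := fun ⟨z, hz, hEz⟩ =>
    hcon ⟨z, hz, fun u => hEz ▸ csInf_le hb (mem_range_self u)⟩
  -- Nothing can be pushed below the infimum. The set fixed by the deformation plays no role here,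
  -- so ρ = 1 is arbitrary.
  obtain ⟨ε, hε, η, -, -, hη⟩ := h.exists_deformation hc one_pos
  obtain ⟨_, ⟨u, rfl⟩, hu⟩ := exists_lt_of_csInf_lt (range_nonempty E) (lt_add_of_pos_right _ hε)
  linarith [hη u hu, csInf_le hb (mem_range_self (η u))]

/-- The mountain pass theorem for tame functionals. -/
lemma IsTameFunctional.mountain_pass {E : H → ℝ} {D : H → H} (h : IsTameFunctional E D)
    {r α : ℝ} (hr : 0 < r) (hα : 0 < α) (hsphere : ∀ u, ‖u‖ = r → α ≤ E u)
    (h0 : E 0 ≤ 0) {e : H} (he : r < ‖e‖) (hEe : E e ≤ 0) : ∃ z, D z = 0 ∧ α ≤ E z := by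
  -- The minimax runs over preconnected sets containing both endpoints instead of paths. Continuous
  -- maps fixing the endpoints preserve this class, and each such set meets the sphere ‖u‖ = r by
  -- the intermediate value theorem for the norm.
  set S : Set ℝ := {b | ∃ C : Set H, IsPreconnected C ∧ (0 : H) ∈ C ∧ e ∈ C ∧ ∀ u ∈ C, E u < b}
  have hlow : ∀ b ∈ S, α ≤ b := by
    rintro b ⟨C, hC, h0C, heC, hb⟩
    obtain ⟨u, huC, hu⟩ := hC.intermediate_value h0C heC continuous_norm.continuousOn
      (show r ∈ Icc ‖(0 : H)‖ ‖e‖ from ⟨by simpa using hr.le, he.le⟩)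
    exact (hsphere u hu).trans (hb u huC).le
  have hne : S.Nonempty := by
    have hcomp : IsCompact (segment ℝ (0 : H) e) := by
      rw [segment_eq_image_lineMap]
      exact isCompact_Icc.image AffineMap.lineMap_continuous
    obtain ⟨M, hM⟩ := (hcomp.image h.continuous).bddAbove
    refine ⟨M + 1, _, (convex_segment 0 e).isPreconnected, left_mem_segment ℝ _ _,
      right_mem_segment ℝ _ _, fun u hu => ?_⟩
    linarith [hM (mem_image_of_mem E hu)]
  have hbdd : BddBelow S := ⟨α, hlow⟩
  have hcα : α ≤ sInf S := le_csInf hne hlow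
  by_contra hcon
  have hc : ¬ ∃ z, D z = 0 ∧ E z = sInf S := fun ⟨z, hz, hEz⟩ => hcon ⟨z, hz, hEz ▸ hcα⟩
  -- The choice ρ = α makes the deformation fix 0 and e, whose energies are at most 0 ≤ sInf S - α.
  obtain ⟨ε, hε, η, hηc, hfix, hη⟩ := h.exists_deformation hc hα
  obtain ⟨b, ⟨C, hC, h0C, heC, hb⟩, hbε⟩ := exists_lt_of_csInf_lt hne (lt_add_of_pos_right _ hε)
  have : sInf S - ε ∈ S := ⟨η '' C, hC.image η hηc.continuousOn,
    ⟨0, h0C, hfix 0 (by linarith)⟩, ⟨e, heC, hfix e (by linarith)⟩, by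
      rintro _ ⟨u, hu, rfl⟩
      exact hη u ((hb u hu).trans hbε)⟩
  linarith [csInf_le hbdd this]

end CriticalPoints

/-! ### Quadratic functionals perturbed through a compact operator -/

section CompactPerturbation

variable {H L : Type*} [NormedAddCommGroup H] [InnerProductSpace ℝ H] [CompleteSpace H]
  [NormedAddCommGroup L] [InnerProductSpace ℝ L] [CompleteSpace L]

/-- A functional `½‖u‖² - G (T u)` with `T` compact and `G` of subquadratic growth is tame. -/
lemma isTameFunctional_of_compact {T : H →L[ℝ] L} (hT : IsCompactOperator T) {G : L → ℝ}
    {g : L → L} (hG : ∀ v, HasFDerivAt G (innerSL ℝ (g v)) v)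
    (hunif : ∀ R : ℝ, ∀ ε > 0, ∃ δ > 0, ∀ u, ‖u‖ ≤ R → ∀ z, ‖z - u‖ ≤ δ → ‖g z - g u‖ ≤ ε)
    (hbd : ∀ R : ℝ, ∃ M : ℝ, ∀ u, ‖u‖ ≤ R → ‖g u‖ ≤ M)
    (hgrowth : ∀ ε > 0, ∃ C : ℝ, ∀ v, G v ≤ ε * ‖v‖ ^ 2 + C) :
    IsTameFunctional (fun u => 1 / 2 * ‖u‖ ^ 2 - G (T u)) (fun u => u - T.adjoint (g (T u))) := by
  have hTle : ∀ R u, ‖u‖ ≤ R → ‖T u‖ ≤ ‖T‖ * R := fun R u hu => T.le_opNorm_of_le hu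
  have hder : ∀ u, HasFDerivAt (fun u => 1 / 2 * ‖u‖ ^ 2 - G (T u))
      (innerSL ℝ (u - T.adjoint (g (T u)))) u := by
    intro u
    have h1 : HasFDerivAt (fun u : H => 1 / 2 * ‖u‖ ^ 2) (innerSL ℝ u) u := by
      have := ((hasStrictFDerivAt_norm_sq u).hasFDerivAt).const_mul (1 / 2 : ℝ)
      refine this.congr_fderiv ?_
      ext v
      simp
    refine (h1.sub ((hG (T u)).comp u T.hasFDerivAt)).congr_fderiv ?_
    ext v
    simp [ContinuousLinearMap.adjoint_inner_left]
  have hsub : ∀ b : ℝ, ∃ R : ℝ, ∀ u, 1 / 2 * ‖u‖ ^ 2 - G (T u) ≤ b → ‖u‖ ≤ R := by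
    intro b
    -- This coefficient yields G(T u) ≤ ¼‖u‖² + C, so that half of the quadratic part survives and
    -- the functional is coercive.
    obtain ⟨C, hC⟩ := hgrowth (1 / (4 * (‖T‖ ^ 2 + 1))) (by positivity)
    -- From x² ≤ A follows x ≤ A + 1, which avoids a square root.
    refine ⟨4 * (|b| + |C|) + 1, fun u hu => ?_⟩
    have h1 := hC (T u)
    have h2 : ‖T u‖ ^ 2 ≤ (‖T‖ ^ 2 + 1) * ‖u‖ ^ 2 := by
      have := pow_le_pow_left₀ (norm_nonneg _) (T.le_opNorm u) 2
      rw [mul_pow] at this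
      nlinarith [sq_nonneg ‖u‖]
    have h3 : 1 / (4 * (‖T‖ ^ 2 + 1)) * ‖T u‖ ^ 2 ≤ 1 / 4 * ‖u‖ ^ 2 := by
      calc _ ≤ 1 / (4 * (‖T‖ ^ 2 + 1)) * ((‖T‖ ^ 2 + 1) * ‖u‖ ^ 2) := by gcongr
        _ = 1 / 4 * ‖u‖ ^ 2 := by field_simp
    have h4 : ‖u‖ ^ 2 ≤ 4 * (|b| + |C|) := by linarith [le_abs_self b, le_abs_self C]
    nlinarith [norm_nonneg u, abs_nonneg b, abs_nonneg C]
  have hun : ∀ R : ℝ, ∀ ε > 0, ∃ δ > 0, ∀ u : H, ‖u‖ ≤ R → ∀ z, ‖z - u‖ ≤ δ →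
      ‖(z - T.adjoint (g (T z))) - (u - T.adjoint (g (T u)))‖ ≤ ε := by
    intro R ε hε
    obtain ⟨δ, hδ, hgδ⟩ := hunif (‖T‖ * R) (ε / 2 / (‖T.adjoint‖ + 1)) (by positivity)
    refine ⟨min (ε / 2) (δ / (‖T‖ + 1)), by positivity, fun u hu z hz => ?_⟩
    have h1 : ‖T z - T u‖ ≤ δ := by
      rw [← map_sub]
      calc ‖T (z - u)‖ ≤ ‖T‖ * (δ / (‖T‖ + 1)) :=
            T.le_opNorm_of_le (hz.trans (min_le_right _ _))
        _ ≤ (‖T‖ + 1) * (δ / (‖T‖ + 1)) := by gcongr; linarith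
        _ = δ := by field_simp
    have h2 := hgδ (T u) (hTle R u hu) (T z) h1
    have h3 : ‖T.adjoint (g (T z) - g (T u))‖ ≤ ε / 2 := by
      calc _ ≤ ‖T.adjoint‖ * (ε / 2 / (‖T.adjoint‖ + 1)) := T.adjoint.le_opNorm_of_le h2
        _ ≤ (‖T.adjoint‖ + 1) * (ε / 2 / (‖T.adjoint‖ + 1)) := by gcongr; linarith
        _ = ε / 2 := by field_simp
    have h4 : (z - T.adjoint (g (T z))) - (u - T.adjoint (g (T u)))
        = (z - u) - T.adjoint (g (T z) - g (T u)) := by rw [map_sub]; abel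
    rw [h4]
    linarith [norm_sub_le (z - u) (T.adjoint (g (T z) - g (T u))), hz.trans (min_le_left _ _)]
  have hgc : Continuous g := by
    refine continuous_iff_continuousAt.2 fun u => Metric.continuousAt_iff.2 fun ε hε => ?_
    obtain ⟨δ, hδ, hD⟩ := hunif ‖u‖ (ε / 2) (half_pos hε)
    refine ⟨δ, hδ, fun {z} hz => ?_⟩
    rw [dist_eq_norm] at hz ⊢
    linarith [hD u le_rfl z hz.le]
  refine ⟨hder, hun, fun R => ?_, hsub, fun u c huc hDu => ?_⟩
  · obtain ⟨M, hM⟩ := hbd (‖T‖ * R)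
    refine ⟨R + ‖T.adjoint‖ * M, fun u hu => (norm_sub_le _ _).trans ?_⟩
    exact add_le_add hu (T.adjoint.le_opNorm_of_le (hM _ (hTle R u hu)))
  · obtain ⟨b, hb⟩ := huc.bddAbove_range
    obtain ⟨R, hR⟩ := hsub b
    have huR : ∀ k, u k ∈ Metric.closedBall (0 : H) R := fun k => by
      simpa using hR (u k) (hb (mem_range_self k))
    obtain ⟨v, -, φ, hφ, hv⟩ := (hT.isCompact_closure_image_closedBall R).tendsto_subseq
      (fun k => subset_closure (mem_image_of_mem T (huR k)))
    -- Since u_k = D(u_k) + T* g(T u_k), with D(u_k) tending to zero and T u_k converging along the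
    -- subsequence, u_k itself converges.
    have hz : Tendsto (fun k => u (φ k)) atTop (𝓝 (T.adjoint (g v))) := by
      have := (hDu.comp hφ.tendsto_atTop).add
        (((T.adjoint.continuous.comp hgc).tendsto v).comp hv)
      simpa [Function.comp_def] using this
    have hcD : Continuous fun u => u - T.adjoint (g (T u)) :=
      continuous_id.sub (T.adjoint.continuous.comp (hgc.comp T.continuous))
    have hcE : Continuous fun u => 1 / 2 * ‖u‖ ^ 2 - G (T u) :=
      continuous_iff_continuousAt.2 fun u => (hder u).continuousAt
    exact ⟨_, tendsto_nhds_unique ((hcD.tendsto _).comp hz) (hDu.comp hφ.tendsto_atTop),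
      tendsto_nhds_unique ((hcE.tendsto _).comp hz) (huc.comp hφ.tendsto_atTop)⟩

/-- Two critical points, one with negative and one with positive energy. -/
theorem exists_two_critical_points {T : H →L[ℝ] L} (hT : IsCompactOperator T) {G : L → ℝ}
    {g : L → L} (hG : ∀ v, HasFDerivAt G (innerSL ℝ (g v)) v)
    (hunif : ∀ R : ℝ, ∀ ε > 0, ∃ δ > 0, ∀ u, ‖u‖ ≤ R → ∀ z, ‖z - u‖ ≤ δ → ‖g z - g u‖ ≤ ε)
    (hbd : ∀ R : ℝ, ∃ M : ℝ, ∀ u, ‖u‖ ≤ R → ‖g u‖ ≤ M)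
    (hgrowth : ∀ ε > 0, ∃ C : ℝ, ∀ v, G v ≤ ε * ‖v‖ ^ 2 + C) (hG0 : G 0 = 0)
    (hloc : ∃ r > 0, ∀ u, ‖u‖ ≤ r → G (T u) ≤ 1 / 4 * ‖u‖ ^ 2)
    (hneg : ∃ w, 1 / 2 * ‖w‖ ^ 2 < G (T w)) :
    ∃ z₁ z₂ : H, z₁ = T.adjoint (g (T z₁)) ∧ z₂ = T.adjoint (g (T z₂)) ∧
      1 / 2 * ‖z₁‖ ^ 2 < G (T z₁) ∧ G (T z₂) < 1 / 2 * ‖z₂‖ ^ 2 := by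
  have hE := isTameFunctional_of_compact hT hG hunif hbd hgrowth
  obtain ⟨w, hw⟩ := hneg
  obtain ⟨r, hr, hloc⟩ := hloc
  have hb : BddBelow (range fun u => 1 / 2 * ‖u‖ ^ 2 - G (T u)) := by
    obtain ⟨R, hR⟩ := hE.sublevel 0
    obtain ⟨C, hC⟩ := hgrowth 1 one_pos
    refine ⟨min 0 (-((‖T‖ * R) ^ 2 + C)), ?_⟩
    rintro _ ⟨u, rfl⟩
    rcases le_total (1 / 2 * ‖u‖ ^ 2 - G (T u)) 0 with h | h
    · refine (min_le_right _ _).trans ?_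
      have h1 : ‖T u‖ ^ 2 ≤ (‖T‖ * R) ^ 2 :=
        pow_le_pow_left₀ (norm_nonneg _) (T.le_opNorm_of_le (hR u h)) 2
      linarith [hC (T u), sq_nonneg ‖u‖]
    · exact (min_le_left _ _).trans h
  obtain ⟨z₁, hz₁, hmin⟩ := hE.exists_isMinimizer hb
  -- In the ball of radius r the energy is at least ¼‖u‖², so a point of negative energy lies
  -- outside.
  have hwr : r < ‖w‖ := by
    by_contra! h
    linarith [hloc w h, sq_nonneg ‖w‖]
  obtain ⟨z₂, hz₂, hpos⟩ := hE.mountain_pass hr (α := 1 / 4 * r ^ 2) (by positivity)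
    (fun u hu => by have := hloc u hu.le; rw [hu] at this ⊢; linarith) (by simp [hG0]) hwr
    (by linarith)
  refine ⟨z₁, z₂, sub_eq_zero.1 hz₁, sub_eq_zero.1 hz₂, ?_, ?_⟩
  · linarith [hmin w]
  · linarith [show 0 < 1 / 4 * r ^ 2 by positivity]

end CompactPerturbation

/-! ### The nonlinearity -/

section Nonlinearity

variable {f : ℝ → ℝ}

lemma abs_le_mul_abs_near_zero (hf : Continuous f) (hf0 : Tendsto (fun t => f t / t) (𝓝[≠] 0) (𝓝 0))
    {ε : ℝ} (hε : 0 < ε) : ∃ δ > 0, ∀ t, |t| ≤ δ → |f t| ≤ ε * |t| := by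
  have h1 : ∀ᶠ t in 𝓝[≠] (0 : ℝ), |f t| ≤ ε * |t| := by
    have := hf0.eventually (Metric.ball_mem_nhds 0 hε)
    filter_upwards [this, self_mem_nhdsWithin] with t ht ht0
    rw [dist_zero_right, norm_div, Real.norm_eq_abs, Real.norm_eq_abs,
      div_lt_iff₀ (abs_pos.2 ht0)] at ht
    exact ht.le
  -- The punctured limit says nothing at t = 0; continuity extends the inequality to that point,
  -- where it reads f(0) = 0.
  have h2 : |f 0| ≤ ε * |0| := by
    have hc : Tendsto (fun t => ε * |t| - |f t|) (𝓝[≠] 0) (𝓝 (ε * |0| - |f 0|)) :=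
      Tendsto.mono_left (Continuous.tendsto (by fun_prop) 0) nhdsWithin_le_nhds
    exact sub_nonneg.1 (ge_of_tendsto hc (h1.mono fun t ht => sub_nonneg.2 ht))
  have h3 : ∀ᶠ t in 𝓝 (0 : ℝ), |f t| ≤ ε * |t| := by
    rw [eventually_nhdsWithin_iff] at h1
    filter_upwards [h1] with t ht
    by_cases h : t = 0
    · exact h ▸ h2
    · exact ht h
  obtain ⟨δ, hδ, h⟩ := Metric.eventually_nhds_iff.1 h3
  exact ⟨δ / 2, half_pos hδ, fun t ht => h (by rw [dist_zero_right, Real.norm_eq_abs]; linarith)⟩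

lemma abs_le_mul_abs_near_infty (hfinf : Tendsto (fun t => f t / t) (Bornology.cobounded ℝ) (𝓝 0))
    {ε : ℝ} (hε : 0 < ε) : ∃ M > 0, ∀ t, M ≤ |t| → |f t| ≤ ε * |t| := by
  have h1 := hfinf.eventually (Metric.ball_mem_nhds 0 hε)
  rw [← comap_norm_atTop, eventually_comap] at h1
  obtain ⟨M, hM⟩ := eventually_atTop.1 h1
  refine ⟨max M 1, by positivity, fun t ht => ?_⟩
  have hh := hM |t| ((le_max_left _ _).trans ht) t rfl
  have ht0 : 0 < |t| := lt_of_lt_of_le one_pos ((le_max_right _ _).trans ht)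
  rw [dist_zero_right, norm_div, Real.norm_eq_abs, Real.norm_eq_abs,
    div_lt_iff₀ ht0] at hh
  exact hh.le

lemma apply_zero_of_tendsto (hf : Continuous f)
    (hf0 : Tendsto (fun t => f t / t) (𝓝[≠] 0) (𝓝 0)) : f 0 = 0 := by
  obtain ⟨δ, hδ, h⟩ := abs_le_mul_abs_near_zero hf hf0 one_pos
  simpa using h 0 (by simpa using hδ.le)

lemma hasDerivAt_primitive (hf : Continuous f) (t : ℝ) : HasDerivAt (primitive f) (f t) t :=
  intervalIntegral.integral_hasDerivAt_right (hf.intervalIntegrable _ _)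
    (hf.stronglyMeasurableAtFilter _ _) hf.continuousAt

lemma continuous_primitive (hf : Continuous f) : Continuous (primitive f) :=
  continuous_iff_continuousAt.2 fun t => (hasDerivAt_primitive hf t).continuousAt

@[simp] lemma primitive_zero : primitive f 0 = 0 := by simp [primitive]

/-- A bound for the primitive by the bound for the function on the segment. -/
lemma abs_primitive_sub_le (hf : Continuous f) {a b A C : ℝ}
    (h : ∀ t, |t - a| ≤ |b - a| → |f t - A| ≤ C) :
    |primitive f b - primitive f a - A * (b - a)| ≤ C * |b - a| := by
  have := (convex_uIcc a b).norm_image_sub_le_of_norm_hasDerivWithin_le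
    (f := fun t => primitive f t - A * t) (f' := fun t => f t - A) (C := C) (x := a) (y := b)
    (fun t _ => ((hasDerivAt_primitive hf t).sub
      ((hasDerivAt_id t).const_mul A |>.congr_deriv (by simp))).hasDerivWithinAt)
    (fun t ht => h t (abs_sub_left_of_mem_uIcc ht)) left_mem_uIcc right_mem_uIcc
  rw [Real.norm_eq_abs, Real.norm_eq_abs] at this
  convert this using 2
  ring

lemma exists_slope_pos (hf : Continuous f) (hF : ∃ t : ℝ, 0 < primitive f t)
    (hf0 : Tendsto (fun t => f t / t) (𝓝[≠] 0) (𝓝 0)) : ∃ t, t ≠ 0 ∧ 0 < |f t| / |t| := by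
  by_contra! h
  have hz : ∀ t, f t = 0 := fun t => by
    by_cases ht : t = 0
    · rw [ht, apply_zero_of_tendsto hf hf0]
    · have := h t ht
      have h2 : 0 < |t| := abs_pos.2 ht
      by_contra h3
      exact absurd this (not_le.2 (div_pos (abs_pos.2 h3) h2))
  obtain ⟨t, ht⟩ := hF
  simp [primitive, hz] at ht

/-- The slope tends to zero both at the origin and at infinity, so outside a compact annulus it
stays below one fixed positive value, taken at t₀. The annulus is enlarged to contain t₀, and the
maximum over it is the global one. -/
lemma isGreatest_slopeConst (hf : Continuous f)
    (hf0 : Tendsto (fun t => f t / t) (𝓝[≠] 0) (𝓝 0))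
    (hfinf : Tendsto (fun t => f t / t) (Bornology.cobounded ℝ) (𝓝 0))
    (hF : ∃ t : ℝ, 0 < primitive f t) : IsGreatest (slopes f) (slopeConst f) ∧ 0 < slopeConst f := by
  obtain ⟨t₀, ht₀, hpos⟩ := exists_slope_pos hf hF hf0
  obtain ⟨δ, hδ, h0⟩ := abs_le_mul_abs_near_zero hf hf0 hpos
  obtain ⟨M, hM, hi⟩ := abs_le_mul_abs_near_infty hfinf hpos
  set K : Set ℝ := Metric.closedBall 0 (max M |t₀|) \ Metric.ball 0 (min δ |t₀|) with hK
  have ht₀K : t₀ ∈ K := ⟨by simp, by simp⟩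
  have hKc : IsCompact K := (isCompact_closedBall _ _).diff Metric.isOpen_ball
  have hne : ∀ t ∈ K, t ≠ 0 := by
    rintro t ⟨-, h⟩ rfl
    exact h (Metric.mem_ball_self (by positivity))
  obtain ⟨t₁, ht₁, hmax⟩ := hKc.exists_isMaxOn ⟨t₀, ht₀K⟩ (f := fun t => |f t| / |t|)
    (ContinuousOn.div (by fun_prop) (by fun_prop) fun t ht => abs_ne_zero.2 (hne t ht))
  have hG : IsGreatest (slopes f) (|f t₁| / |t₁|) := by
    refine ⟨⟨t₁, hne t₁ ht₁, rfl⟩, ?_⟩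
    rintro _ ⟨t, ht, rfl⟩
    have ht' : 0 < |t| := abs_pos.2 ht
    by_cases htK : t ∈ K
    · exact hmax htK
    refine le_trans ?_ (hmax ht₀K)
    rw [div_le_iff₀ ht']
    by_cases h1 : |t| ≤ δ
    · exact h0 t h1
    · refine hi t ?_
      by_contra! h2
      refine htK ⟨?_, ?_⟩
      · simp [h2.le]
      · simpa using fun h => absurd h.le h1
  have he : slopeConst f = |f t₁| / |t₁| := hG.csSup_eq
  rw [he]
  exact ⟨hG, hpos.trans_le (hmax ht₀K)⟩

lemma abs_le_slopeConst_mul (hf : Continuous f)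
    (hf0 : Tendsto (fun t => f t / t) (𝓝[≠] 0) (𝓝 0)) (hG : IsGreatest (slopes f) (slopeConst f))
    (t : ℝ) : |f t| ≤ slopeConst f * |t| := by
  by_cases ht : t = 0
  · simp [ht, apply_zero_of_tendsto hf hf0]
  · rw [← div_le_iff₀ (abs_pos.2 ht)]
    exact hG.2 ⟨t, ht, rfl⟩

lemma abs_primitive_le {c : ℝ} (t : ℝ)
    (h : ∀ s, |s| ≤ |t| → |f s| ≤ c * |s|) : |primitive f t| ≤ c / 2 * t ^ 2 := by
  have key : ∀ s ∈ Set.uIoc 0 t, ‖f s‖ ≤ c * |s| := fun s hs => by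
    refine h s ?_
    have := abs_sub_left_of_mem_uIcc (uIoc_subset_uIcc hs)
    simpa using this
  have h1 := intervalIntegral.norm_integral_le_abs_of_norm_le (μ := volume) (a := 0) (b := t)
    (f := f) (g := fun s => c * |s|)
    ((ae_restrict_iff' measurableSet_uIoc).2 (ae_of_all _ key))
    ((by fun_prop : Continuous fun s : ℝ => c * |s|).intervalIntegrable _ _)
  have h2 : abs (∫ s in (0 : ℝ)..t, c * |s|) = |c| / 2 * t ^ 2 := by
    rw [intervalIntegral.integral_const_mul, abs_mul]
    rcases le_total 0 t with ht | ht
    · rw [intervalIntegral.integral_congr (g := fun s => s)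
        (fun s hs => abs_of_nonneg (by rw [uIcc_of_le ht] at hs; exact hs.1)), integral_id]
      rw [show (t ^ 2 - 0 ^ 2) / 2 = t ^ 2 / 2 by ring, abs_of_nonneg (a := t ^ 2 / 2) (by positivity)]
      ring
    · rw [intervalIntegral.integral_congr (g := fun s => -s)
        (fun s hs => abs_of_nonpos (by rw [uIcc_of_ge ht] at hs; exact hs.2)),
        intervalIntegral.integral_neg, integral_id, abs_neg,
        show (t ^ 2 - 0 ^ 2) / 2 = t ^ 2 / 2 by ring,
        abs_of_nonneg (a := t ^ 2 / 2) (by positivity)]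
      ring
  by_cases ht : t = 0
  · simp [ht]
  have hc : 0 ≤ c := by
    have := (abs_nonneg _).trans (h t le_rfl)
    exact nonneg_of_mul_nonneg_left this (abs_pos.2 ht)
  rw [h2, abs_of_nonneg hc] at h1
  exact h1

/-- This replaces uniform continuity, which f need not have on the line. Large arguments are
absorbed by the small slope at infinity; on a compact interval, nearby arguments fall under uniform
continuity and distant ones under boundedness. Every term on the right is linear in 1, |a|, |b|, |a
- b|, so the inequality passes directly to L² norms. -/
lemma exists_modulus (hf : Continuous f)
    (hfinf : Tendsto (fun t => f t / t) (Bornology.cobounded ℝ) (𝓝 0)) {ε : ℝ} (hε : 0 < ε) :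
    ∃ C, 0 ≤ C ∧ ∀ a b, |f a - f b| ≤ ε * (1 + |a| + |b|) + C * |a - b| := by
  obtain ⟨M, hM, hi⟩ := abs_le_mul_abs_near_infty hfinf hε
  obtain ⟨B, hB⟩ := (isCompact_closedBall (0 : ℝ) (M + 1)).exists_bound_of_continuousOn
    hf.continuousOn
  have hB' : ∀ t, |t| ≤ M + 1 → |f t| ≤ B := fun t ht => hB t (by simpa using ht)
  have hB0 : 0 ≤ B := (abs_nonneg _).trans (hB' 0 (by simp; positivity))
  have huc := (isCompact_closedBall (0 : ℝ) (M + 1)).uniformContinuousOn_of_continuous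
    hf.continuousOn
  obtain ⟨δ, hδ, hu⟩ := Metric.uniformContinuousOn_iff.1 huc ε hε
  refine ⟨2 * B / δ + B, by positivity, ?_⟩
  have main : ∀ a b, |b| ≤ |a| → |f a - f b| ≤ ε * (1 + |a| + |b|) + (2 * B / δ + B) * |a - b| := by
    intro a b hab
    have hab0 := abs_nonneg (a - b)
    have hεa : 0 ≤ ε * |a| := by positivity
    have hεb : 0 ≤ ε * |b| := by positivity
    have hd0 : 0 ≤ 2 * B / δ := by positivity
    have htri : |f a - f b| ≤ |f a| + |f b| := abs_sub _ _
    rcases le_or_gt |a| (M + 1) with ha | ha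
    · have hb : |b| ≤ M + 1 := hab.trans ha
      rcases lt_or_ge |a - b| δ with h | h
      · have := hu a (by simpa using ha) b (by simpa using hb) (by rwa [Real.dist_eq])
        rw [Real.dist_eq] at this
        nlinarith [mul_nonneg (add_nonneg hd0 hB0) hab0]
      · have h1 : 2 * B ≤ 2 * B / δ * |a - b| := by
          rw [div_mul_eq_mul_div, le_div_iff₀ hδ]
          gcongr
        nlinarith [hB' a ha, hB' b hb, mul_nonneg hB0 hab0]
    · have hfa := hi a (by linarith)
      rcases le_or_gt M |b| with hb | hb
      · have hfb := hi b hb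
        nlinarith [mul_nonneg (add_nonneg hd0 hB0) hab0]
      -- Here |a| > M + 1 and |b| < M, so the bounded value f b is paid for by B |a - b|.
      · have h1 : 1 ≤ |a - b| := by linarith [abs_sub_abs_le_abs_sub a b]
        have hfb := hB' b (by linarith)
        nlinarith [mul_nonneg hd0 hab0]
  intro a b
  rcases le_total |b| |a| with h | h
  · exact main a b h
  · have := main b a h
    rw [abs_sub_comm, abs_sub_comm a b]
    linarith

lemma abs_primitive_le_add (hf : Continuous f)
    (hfinf : Tendsto (fun t => f t / t) (Bornology.cobounded ℝ) (𝓝 0)) {ε : ℝ} (hε : 0 < ε) :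
    ∃ C, 0 ≤ C ∧ ∀ t, |primitive f t| ≤ ε * t ^ 2 + C := by
  obtain ⟨M, hM, hi⟩ := abs_le_mul_abs_near_infty hfinf (half_pos hε)
  obtain ⟨B, hB⟩ := (isCompact_closedBall (0 : ℝ) M).exists_bound_of_continuousOn
    hf.continuousOn
  have hB' : ∀ t, |t| ≤ M → |f t| ≤ B := fun t ht => hB t (by simpa using ht)
  have hB0 : 0 ≤ B := (abs_nonneg _).trans (hB' 0 (by simpa using hM.le))
  -- Young's inequality splits B|t| into this constant and ε t²/2; the other half of ε is taken by
  -- the slope ε/2 at infinity.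
  refine ⟨B ^ 2 / (2 * ε), by positivity, fun t => ?_⟩
  have h1 := abs_primitive_sub_le hf (a := 0) (b := t) (A := 0) (C := B + ε / 2 * |t|) (by
    intro s hs
    simp only [sub_zero] at hs ⊢
    rcases le_total |s| M with h | h
    · have := hB' s h
      have : 0 ≤ ε / 2 * |t| := by positivity
      linarith
    · have := hi s h
      have : ε / 2 * |s| ≤ ε / 2 * |t| := by gcongr
      linarith)
  simp only [primitive_zero, sub_zero, zero_mul] at h1
  refine h1.trans ?_
  have h2 : B * |t| ≤ B ^ 2 / (2 * ε) + ε / 2 * |t| ^ 2 := by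
    rw [← sub_nonneg]
    have : B ^ 2 / (2 * ε) + ε / 2 * |t| ^ 2 - B * |t| = (B - ε * |t|) ^ 2 / (2 * ε) := by
      field_simp
      ring
    rw [this]
    positivity
  have h3 : t ^ 2 = |t| ^ 2 := (sq_abs t).symm
  rw [h3]
  nlinarith

end Nonlinearity

/-! ### Calculus of test functions -/

section Test

variable {V : Type*} [NormedAddCommGroup V] [NormedSpace ℝ V] {U : Set V} {φ ψ : V → ℝ}

lemma IsTest.continuous (h : IsTest U φ) : Continuous φ := h.1.continuous

lemma IsTest.differentiable (h : IsTest U φ) : Differentiable ℝ φ :=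
  h.1.differentiable (by simp)

lemma IsTest.continuous_fderiv (h : IsTest U φ) : Continuous (fderiv ℝ φ) :=
  h.1.continuous_fderiv (by simp)

lemma IsTest.eq_zero (h : IsTest U φ) {x : V} (hx : x ∉ U) : φ x = 0 :=
  image_eq_zero_of_notMem_tsupport fun h' => hx (h.2.2 h')

lemma IsTest.fderiv_eq_zero (h : IsTest U φ) {x : V} (hx : x ∉ U) : fderiv ℝ φ x = 0 :=
  image_eq_zero_of_notMem_tsupport fun h' => hx (h.2.2 (tsupport_fderiv_subset ℝ h'))

lemma IsTest.zero : IsTest U (0 : V → ℝ) :=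
  ⟨contDiff_const, HasCompactSupport.zero, by simp⟩

lemma IsTest.add (h : IsTest U φ) (h' : IsTest U ψ) : IsTest U (φ + ψ) :=
  ⟨h.1.add h'.1, h.2.1.add h'.2.1, (tsupport_add φ ψ).trans (union_subset h.2.2 h'.2.2)⟩

lemma IsTest.smul (c : ℝ) (h : IsTest U φ) : IsTest U (c • φ) :=
  ⟨contDiff_const.smul h.1, h.2.1.smul_left (f := fun _ => c),
    (tsupport_smul_subset_right (fun _ => c) φ).trans h.2.2⟩

/-- A smooth function whose support lies in that of a test function is a test function. -/
lemma IsTest.of_tsupport_subset (h : IsTest U φ) (hψ : ContDiff ℝ ∞ ψ)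
    (hs : ∀ x, φ x = 0 → ψ x = 0) : IsTest U ψ := by
  have : Function.support ψ ⊆ Function.support φ := fun x hx h' => hx (hs x h')
  exact ⟨hψ, h.2.1.mono this, (closure_mono this).trans h.2.2⟩

/-- The test functions supported in `U`. -/
def testSubmodule (U : Set V) : Submodule ℝ (V → ℝ) where
  carrier := {φ | IsTest U φ}
  add_mem' := IsTest.add
  zero_mem' := IsTest.zero
  smul_mem' c _ h := IsTest.smul c h

end Test

/-! ### Integration by parts -/

section IntegrationByParts

lemma hasCompactSupport_norm_sq {X E : Type*} [TopologicalSpace X] [NormedAddCommGroup E]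
    {g : X → E} (h : HasCompactSupport g) : HasCompactSupport fun x => ‖g x‖ ^ 2 :=
  h.comp_left (g := fun t => ‖t‖ ^ 2) (by simp)

/-- Integration by parts on the whole space in a direction `v`, one factor having compact
support. -/
lemma integral_mul_fderiv_of_hasCompactSupport {V : Type*} [NormedAddCommGroup V] [NormedSpace ℝ V]
    [FiniteDimensional ℝ V] [MeasurableSpace V] [BorelSpace V] {μ : Measure V}
    [μ.IsAddHaarMeasure] {f g : V → ℝ} (hf : ContDiff ℝ 1 f) (hg : ContDiff ℝ 1 g)
    (hc : HasCompactSupport g) (v : V) :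
    ∫ x, f x * fderiv ℝ g x v ∂μ = -∫ x, fderiv ℝ f x v * g x ∂μ := by
  have h1 := hf.continuous_fderiv one_ne_zero
  have h2 := hg.continuous_fderiv one_ne_zero
  have h3 := hf.continuous
  have h4 := hg.continuous
  refine integral_mul_fderiv_eq_neg_fderiv_mul_of_integrable ?_ ?_ ?_
    (fun x _ => hf.differentiable one_ne_zero x) (fun x _ => hg.differentiable one_ne_zero x)
  · exact Continuous.integrable_of_hasCompactSupport (by fun_prop)
      (hc.mono fun x hx h' => hx (by simp [h']))
  · exact Continuous.integrable_of_hasCompactSupport (by fun_prop)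
      ((hc.fderiv ℝ).mono fun x hx h' => hx (by simp [h']))
  · exact Continuous.integrable_of_hasCompactSupport (by fun_prop)
      (hc.mono fun x hx h' => hx (by simp [h']))

end IntegrationByParts

/-! ### Test functions on the domain and on the half-cylinder, Poincaré and trace inequalities -/

section Domain

variable {n : ℕ} {Ω : Set (Euc n)}

lemma cylMeasure_eq (Ω : Set (Euc n)) :
    cylMeasure Ω = (baseMeasure Ω).prod (volume.restrict (Ioi (0 : ℝ))) := by
  rw [cylMeasure, cylinder, baseMeasure, Measure.prod_restrict, Measure.volume_eq_prod]

instance : SigmaFinite (baseMeasure Ω) := by unfold baseMeasure; infer_instance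
instance : IsFiniteMeasureOnCompacts (baseMeasure Ω) := by unfold baseMeasure; infer_instance
instance : IsFiniteMeasureOnCompacts (cylMeasure Ω) := by unfold cylMeasure; infer_instance

/-! #### Functions on the base -/

lemma inner_gradient {φ : Euc n → ℝ} (x v : Euc n) :
    ⟪gradient φ x, v⟫ = fderiv ℝ φ x v := inner_gradient_left

lemma gradient_eq_symm {φ : Euc n → ℝ} (x : Euc n) :
    gradient φ x = (InnerProductSpace.toDual ℝ (Euc n)).symm (fderiv ℝ φ x) := rfl

lemma IsTest.continuous_gradient {φ : Euc n → ℝ} (h : IsTest Ω φ) : Continuous (gradient φ) :=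
  (InnerProductSpace.toDual ℝ (Euc n)).symm.continuous.comp h.continuous_fderiv

lemma IsTest.hasCompactSupport_gradient {φ : Euc n → ℝ} (h : IsTest Ω φ) :
    HasCompactSupport (gradient φ) :=
  (h.2.1.fderiv ℝ).comp_left (g := (InnerProductSpace.toDual ℝ (Euc n)).symm) (map_zero _)

lemma IsTest.gradient_eq_zero {φ : Euc n → ℝ} (h : IsTest Ω φ) {x : Euc n} (hx : x ∉ Ω) :
    gradient φ x = 0 := by rw [gradient_eq_symm, h.fderiv_eq_zero hx, map_zero]

lemma IsTest.memLp {φ : Euc n → ℝ} (h : IsTest Ω φ) : MemLp φ 2 (baseMeasure Ω) :=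
  h.continuous.memLp_of_hasCompactSupport h.2.1

lemma IsTest.memLp_gradient {φ : Euc n → ℝ} (h : IsTest Ω φ) :
    MemLp (gradient φ) 2 (baseMeasure Ω) :=
  h.continuous_gradient.memLp_of_hasCompactSupport h.hasCompactSupport_gradient

lemma gradient_add {φ ψ : Euc n → ℝ} (hφ : Differentiable ℝ φ) (hψ : Differentiable ℝ ψ) :
    gradient (φ + ψ) = gradient φ + gradient ψ := by
  ext1 x
  simp only [gradient_eq_symm, Pi.add_apply]
  rw [fderiv_add (hφ x) (hψ x), map_add]

lemma gradient_smul {φ : Euc n → ℝ} (c : ℝ) (hφ : Differentiable ℝ φ) :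
    gradient (c • φ) = c • gradient φ := by
  ext1 x
  simp only [gradient_eq_symm, Pi.smul_apply]
  rw [fderiv_const_smul (hφ x), map_smul]

lemma integral_base_eq {E : Type*} [NormedAddCommGroup E] [NormedSpace ℝ E] {g : Euc n → E}
    (hg : ∀ x ∉ Ω, g x = 0) : ∫ x, g x ∂(baseMeasure Ω) = ∫ x, g x :=
  setIntegral_eq_integral_of_forall_compl_eq_zero hg

/-- Poincaré's inequality. -/
lemma IsTest.poincare {φ : Euc n → ℝ} (h : IsTest Ω φ) (hn : 0 < n) {R : ℝ}
    (hR : ∀ x ∈ Ω, ‖x‖ ≤ R) :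
    ∫ x, φ x ^ 2 ∂(baseMeasure Ω) ≤ 4 * R ^ 2 * ∫ x, ‖gradient φ x‖ ^ 2 ∂(baseMeasure Ω) := by
  rw [integral_base_eq (fun x hx => by simp [h.eq_zero hx]),
    integral_base_eq (fun x hx => by simp [h.gradient_eq_zero hx])]
  obtain ⟨v, hv1⟩ : ∃ v : Euc n, ‖v‖ = 1 := ⟨EuclideanSpace.single ⟨0, hn⟩ 1, by simp⟩
  have hcs : HasCompactSupport fun x => φ x ^ 2 := by
    simpa using hasCompactSupport_norm_sq h.2.1
  have hi1 : Integrable fun x => φ x ^ 2 :=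
    (h.continuous.pow 2).integrable_of_hasCompactSupport hcs
  have hi2 : Integrable fun x => ‖gradient φ x‖ ^ 2 :=
    (h.continuous_gradient.norm.pow 2).integrable_of_hasCompactSupport
      (hasCompactSupport_norm_sq h.hasCompactSupport_gradient)
  have hfd : ∀ x, fderiv ℝ (fun x => φ x ^ 2) x v = 2 * φ x * ⟪gradient φ x, v⟫ := fun x => by
    rw [((h.differentiable x).hasFDerivAt.pow 2).fderiv, inner_gradient]
    simp
  have hcv : Continuous fun x => ⟪gradient φ x, v⟫ := h.continuous_gradient.inner continuous_const
  -- The derivative of φ² in the unit direction v is integrated by parts against the linear function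
  -- ⟪v, x⟫, whose derivative along v is 1.
  have hibp : ∫ x, φ x ^ 2 = -∫ x, 2 * φ x * ⟪gradient φ x, v⟫ * ⟪v, x⟫ := by
    have := integral_mul_fderiv_of_hasCompactSupport (μ := (volume : Measure (Euc n)))
      (f := innerSL ℝ v) (g := fun x => φ x ^ 2) (innerSL ℝ v).contDiff
      ((h.1.pow 2).of_le (by simp)) hcs v
    have h2 : ∀ x, ⟪v, x⟫ * (2 * φ x * ⟪gradient φ x, v⟫)
      = 2 * φ x * ⟪gradient φ x, v⟫ * ⟪v, x⟫ := fun x => mul_comm _ _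
    simp only [hfd, ContinuousLinearMap.fderiv, innerSL_apply_apply, real_inner_self_eq_norm_sq,
      hv1, one_pow, one_mul, h2] at this
    rw [this, neg_neg]
  -- Young's inequality with weight ½ on φ²: that half is absorbed on the left, which doubles 2R² to
  -- 4R².
  have hpt : ∀ x, -(2 * φ x * ⟪gradient φ x, v⟫ * ⟪v, x⟫)
      ≤ 1 / 2 * φ x ^ 2 + 2 * R ^ 2 * ‖gradient φ x‖ ^ 2 := by
    intro x
    by_cases hx : x ∈ Ω
    · have h1 : |⟪gradient φ x, v⟫| ≤ ‖gradient φ x‖ := by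
        have := abs_real_inner_le_norm (gradient φ x) v
        rwa [hv1, mul_one] at this
      have h2 : |⟪v, x⟫| ≤ R := by
        have := abs_real_inner_le_norm v x
        rw [hv1, one_mul] at this
        exact this.trans (hR x hx)
      have h3 : |⟪gradient φ x, v⟫ * ⟪v, x⟫| ≤ ‖gradient φ x‖ * R := by
        rw [abs_mul]; gcongr
      have h4 := sq_le_sq' (neg_le_of_abs_le h3) (le_of_abs_le h3)
      nlinarith [sq_nonneg (φ x + 2 * (⟪gradient φ x, v⟫ * ⟪v, x⟫))]
    · rw [h.eq_zero hx]
      simp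
      positivity
  have hle : ∫ x, φ x ^ 2 ≤ ∫ x, (1 / 2 * φ x ^ 2 + 2 * R ^ 2 * ‖gradient φ x‖ ^ 2) := by
    rw [hibp, ← integral_neg]
    refine integral_mono ?_ ((hi1.const_mul _).add (hi2.const_mul _)) hpt
    refine Continuous.integrable_of_hasCompactSupport ?_ ?_
    · have := h.continuous
      fun_prop
    · exact h.2.1.mono fun x hx h' => hx (by simp [h'])
  rw [integral_add (hi1.const_mul _) (hi2.const_mul _), integral_const_mul,
    integral_const_mul] at hle
  linarith

/-! #### Functions on the cylinder -/

variable {φ : Euc n × ℝ → ℝ} {U : Set (Euc n × ℝ)}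

lemma fderiv_slice_left (hφ : Differentiable ℝ φ) (p : Euc n × ℝ) :
    HasFDerivAt (fun x => φ (x, p.2))
      ((fderiv ℝ φ p).comp (ContinuousLinearMap.inl ℝ (Euc n) ℝ)) p.1 :=
  (hφ p).hasFDerivAt.comp p.1 (hasFDerivAt_prodMk_left p.1 p.2)

lemma inner_gradX (hφ : Differentiable ℝ φ) (p : Euc n × ℝ) (v : Euc n) :
    ⟪gradX φ p, v⟫ = fderiv ℝ φ p (v, 0) := by
  rw [gradX, inner_gradient, (fderiv_slice_left hφ p).fderiv]
  simp

lemma gradX_eq (hφ : Differentiable ℝ φ) (p : Euc n × ℝ) :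
    gradX φ p = (InnerProductSpace.toDual ℝ (Euc n)).symm
      ((fderiv ℝ φ p).comp (ContinuousLinearMap.inl ℝ (Euc n) ℝ)) := by
  rw [gradX, gradient_eq_symm, (fderiv_slice_left hφ p).fderiv]

lemma hasDerivAt_derivY (hφ : Differentiable ℝ φ) (x : Euc n) (y : ℝ) :
    HasDerivAt (fun y => φ (x, y)) (derivY φ (x, y)) y := by
  have h := ((hφ (x, y)).hasFDerivAt.comp y (hasFDerivAt_prodMk_right x y)).hasDerivAt
  exact h.differentiableAt.hasDerivAt

lemma derivY_eq (hφ : Differentiable ℝ φ) (p : Euc n × ℝ) :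
    derivY φ p = fderiv ℝ φ p (0, 1) := by
  have h := ((hφ p).hasFDerivAt.comp p.2 (hasFDerivAt_prodMk_right p.1 p.2)).hasDerivAt
  rw [derivY]
  refine h.deriv.trans ?_
  simp

lemma gradX_add {ψ : Euc n × ℝ → ℝ} (hφ : Differentiable ℝ φ) (hψ : Differentiable ℝ ψ) :
    gradX (φ + ψ) = gradX φ + gradX ψ := by
  ext1 p
  rw [Pi.add_apply, gradX_eq (hφ.add hψ), gradX_eq hφ, gradX_eq hψ, fderiv_add (hφ p) (hψ p),
    ContinuousLinearMap.add_comp, map_add]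

lemma gradX_smul (c : ℝ) (hφ : Differentiable ℝ φ) : gradX (c • φ) = c • gradX φ := by
  ext1 p
  rw [Pi.smul_apply, gradX_eq (hφ.const_smul c), gradX_eq hφ, fderiv_const_smul (hφ p),
    ContinuousLinearMap.smul_comp, map_smul]

lemma derivY_add {ψ : Euc n × ℝ → ℝ} (hφ : Differentiable ℝ φ) (hψ : Differentiable ℝ ψ) :
    derivY (φ + ψ) = derivY φ + derivY ψ := by
  ext1 p
  rw [Pi.add_apply, derivY_eq (hφ.add hψ), derivY_eq hφ, derivY_eq hψ, fderiv_add (hφ p) (hψ p)]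
  rfl

lemma derivY_smul (c : ℝ) (hφ : Differentiable ℝ φ) : derivY (c • φ) = c • derivY φ := by
  ext1 p
  rw [Pi.smul_apply, derivY_eq (hφ.const_smul c), derivY_eq hφ, fderiv_const_smul (hφ p)]
  rfl

lemma IsTest.continuous_gradX (h : IsTest U φ) : Continuous (gradX φ) := by
  rw [funext (gradX_eq h.differentiable)]
  exact (InnerProductSpace.toDual ℝ (Euc n)).symm.continuous.comp
    (h.continuous_fderiv.clm_comp continuous_const)

lemma IsTest.hasCompactSupport_gradX (h : IsTest U φ) : HasCompactSupport (gradX φ) := by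
  rw [funext (gradX_eq h.differentiable)]
  refine (h.2.1.fderiv ℝ).mono fun p hp h' => hp ?_
  simp only
  rw [h', ContinuousLinearMap.zero_comp, map_zero]

lemma IsTest.continuous_derivY (h : IsTest U φ) : Continuous (derivY φ) := by
  rw [funext (derivY_eq h.differentiable)]
  exact h.continuous_fderiv.clm_apply continuous_const

lemma IsTest.hasCompactSupport_derivY (h : IsTest U φ) : HasCompactSupport (derivY φ) := by
  rw [funext (derivY_eq h.differentiable)]
  exact (h.2.1.fderiv ℝ).comp_left (g := fun A : Euc n × ℝ →L[ℝ] ℝ => A (0, 1)) (by simp)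

lemma IsTest.gradX_eq_zero (h : IsTest U φ) {p : Euc n × ℝ} (hp : p ∉ U) : gradX φ p = 0 := by
  rw [gradX_eq h.differentiable, h.fderiv_eq_zero hp]; simp

lemma IsTest.derivY_eq_zero (h : IsTest U φ) {p : Euc n × ℝ} (hp : p ∉ U) : derivY φ p = 0 := by
  rw [derivY_eq h.differentiable, h.fderiv_eq_zero hp]; simp

lemma IsTest.memLp_cyl (h : IsTest U φ) : MemLp φ 2 (cylMeasure Ω) :=
  h.continuous.memLp_of_hasCompactSupport h.2.1

lemma IsTest.memLp_gradX (h : IsTest U φ) : MemLp (gradX φ) 2 (cylMeasure Ω) :=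
  h.continuous_gradX.memLp_of_hasCompactSupport h.hasCompactSupport_gradX

lemma IsTest.memLp_derivY (h : IsTest U φ) : MemLp (derivY φ) 2 (cylMeasure Ω) :=
  h.continuous_derivY.memLp_of_hasCompactSupport h.hasCompactSupport_derivY

lemma hasCompactSupport_slice_left {E : Type*} [Zero E] {g : Euc n × ℝ → E}
    (h : HasCompactSupport g) (y : ℝ) : HasCompactSupport fun x => g (x, y) := by
  refine HasCompactSupport.intro (h.image continuous_fst) fun x hx => ?_
  by_contra hne
  exact hx ⟨(x, y), subset_tsupport g hne, rfl⟩

lemma hasCompactSupport_slice_right {E : Type*} [Zero E] {g : Euc n × ℝ → E}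
    (h : HasCompactSupport g) (x : Euc n) : HasCompactSupport fun y => g (x, y) := by
  refine HasCompactSupport.intro (h.image continuous_snd) fun y hy => ?_
  by_contra hne
  exact hy ⟨(x, y), subset_tsupport g hne, rfl⟩

/-- Horizontal slices of test functions on `Ω × ℝ` are test functions on `Ω`. -/
lemma IsTest.slice (h : IsTest (Ω ×ˢ (univ : Set ℝ)) φ) (y : ℝ) : IsTest Ω fun x => φ (x, y) := by
  refine ⟨h.1.comp (contDiff_id.prodMk contDiff_const), hasCompactSupport_slice_left h.2.1 y, ?_⟩
  have : tsupport (fun x => φ (x, y)) ⊆ (fun x => (x, y)) ⁻¹' tsupport φ := by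
    refine closure_minimal (fun x hx => subset_tsupport φ hx) ?_
    exact (isClosed_tsupport φ).preimage (by fun_prop)
  exact fun x hx => (h.2.2 (this hx)).1

lemma gradient_slice (φ : Euc n × ℝ → ℝ) (y : ℝ) (x : Euc n) :
    gradient (fun x => φ (x, y)) x = gradX φ (x, y) := rfl

lemma integrable_cyl {E : Type*} [NormedAddCommGroup E] {g : Euc n × ℝ → E} (hg : Continuous g)
    (hc : HasCompactSupport g) : Integrable g (cylMeasure Ω) :=
  hg.integrable_of_hasCompactSupport hc

lemma integral_cyl {E : Type*} [NormedAddCommGroup E] [NormedSpace ℝ E] {g : Euc n × ℝ → E}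
    (hg : Continuous g) (hc : HasCompactSupport g) :
    ∫ p, g p ∂(cylMeasure Ω) = ∫ x, (∫ y in Ioi (0 : ℝ), g (x, y)) ∂(baseMeasure Ω) := by
  have := integrable_cyl (Ω := Ω) hg hc
  rw [cylMeasure_eq] at this ⊢
  exact integral_prod _ this

lemma integral_cyl_symm {E : Type*} [NormedAddCommGroup E] [NormedSpace ℝ E] {g : Euc n × ℝ → E}
    (hg : Continuous g) (hc : HasCompactSupport g) :
    ∫ p, g p ∂(cylMeasure Ω) = ∫ y in Ioi (0 : ℝ), (∫ x, g (x, y) ∂(baseMeasure Ω)) := by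
  have := integrable_cyl (Ω := Ω) hg hc
  rw [cylMeasure_eq] at this ⊢
  exact integral_prod_symm _ this

/-- Each horizontal slice is a test function on Ω, so Poincaré's inequality applies slice by slice
and integrates in y. -/
lemma IsTest.poincare_cyl (h : IsTest (Ω ×ˢ (univ : Set ℝ)) φ) (hn : 0 < n) {R : ℝ}
    (hR : ∀ x ∈ Ω, ‖x‖ ≤ R) :
    ∫ p, φ p ^ 2 ∂(cylMeasure Ω) ≤ 4 * R ^ 2 * ∫ p, ‖gradX φ p‖ ^ 2 ∂(cylMeasure Ω) := by
  have hc1 : HasCompactSupport fun p => φ p ^ 2 := by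
    simpa using hasCompactSupport_norm_sq h.2.1
  have hc2 := hasCompactSupport_norm_sq h.hasCompactSupport_gradX
  have hct1 : Continuous fun p => φ p ^ 2 := h.continuous.pow 2
  have hi1 := integrable_cyl (Ω := Ω) hct1 hc1
  have hct2 : Continuous fun p => ‖gradX φ p‖ ^ 2 := h.continuous_gradX.norm.pow 2
  have hi2 := integrable_cyl (Ω := Ω) hct2 hc2
  rw [integral_cyl_symm hct1 hc1, integral_cyl_symm hct2 hc2, ← integral_const_mul]
  rw [cylMeasure_eq] at hi1 hi2
  refine integral_mono hi1.integral_prod_right (hi2.integral_prod_right.const_mul _) fun y => ?_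
  exact (h.slice y).poincare hn hR

/-- On each vertical line φ(x, 0)² is minus the integral of ∂_y(φ²), and -2 φ ∂_yφ ≤ φ² + (∂_yφ)².
-/
lemma IsTest.trace_le (h : IsTest U φ) :
    ∫ x, φ (x, 0) ^ 2 ∂(baseMeasure Ω) ≤
      ∫ p, φ p ^ 2 ∂(cylMeasure Ω) + ∫ p, derivY φ p ^ 2 ∂(cylMeasure Ω) := by
  have hc1 : HasCompactSupport fun p => φ p ^ 2 := by
    simpa using hasCompactSupport_norm_sq h.2.1
  have hc2 : HasCompactSupport fun p => derivY φ p ^ 2 := by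
    simpa using hasCompactSupport_norm_sq h.hasCompactSupport_derivY
  have hct1 : Continuous fun p => φ p ^ 2 := h.continuous.pow 2
  have hi1 := integrable_cyl (Ω := Ω) hct1 hc1
  have hct2 : Continuous fun p => derivY φ p ^ 2 := h.continuous_derivY.pow 2
  have hi2 := integrable_cyl (Ω := Ω) hct2 hc2
  have hc3 : HasCompactSupport fun p => -(2 * φ p * derivY φ p) :=
    h.2.1.mono fun x hx h' => hx (by simp [h'])
  have hct3 : Continuous fun p => -(2 * φ p * derivY φ p) := by
    have := h.continuous
    have := h.continuous_derivY
    fun_prop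
  have hkey : ∫ x, φ (x, 0) ^ 2 ∂(baseMeasure Ω) = ∫ p, -(2 * φ p * derivY φ p) ∂(cylMeasure Ω) := by
    rw [integral_cyl hct3 hc3]
    refine integral_congr_ae (ae_of_all _ fun x => ?_)
    have hs : ContDiff ℝ 1 fun y => φ (x, y) ^ 2 :=
      ((h.1.comp (contDiff_const.prodMk contDiff_id)).pow 2).of_le (by simp)
    have := HasCompactSupport.integral_Ioi_deriv_eq hs
      (hasCompactSupport_slice_right (g := fun p => φ p ^ 2) hc1 x) 0
    have hd : ∀ y, deriv (fun y => φ (x, y) ^ 2) y = 2 * φ (x, y) * derivY φ (x, y) := fun y => by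
      rw [((hasDerivAt_derivY h.differentiable x y).fun_pow 2).deriv]
      simp
    simp only [hd] at this
    simp only [integral_neg, this, neg_neg]
  rw [hkey, ← integral_add hi1 hi2]
  refine integral_mono (integrable_cyl hct3 hc3) (hi1.add hi2) fun p => ?_
  simp only
  nlinarith [sq_nonneg (φ p + derivY φ p)]

end Domain

/-! ### Convergence in `L²` and weak gradients -/

section Convergence

variable {α : Type*} [MeasurableSpace α] {μ : Measure α} {E : Type*} [NormedAddCommGroup E]
  [InnerProductSpace ℝ E]

lemma integrable_smul_of_memLp_two {f : α → ℝ} {g : α → E} (hf : MemLp f 2 μ) (hg : MemLp g 2 μ) :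
    Integrable (fun x => f x • g x) μ :=
  memLp_one_iff_integrable.1 (hg.smul (r := 1) hf)

lemma integrable_mul_of_memLp_two {f g : α → ℝ} (hf : MemLp f 2 μ) (hg : MemLp g 2 μ) :
    Integrable (fun x => f x * g x) μ :=
  integrable_smul_of_memLp_two hf hg

lemma tendsto_integral_smul_left {f : ℕ → α → ℝ} {f' : α → ℝ} {g : α → E}
    (hf : ∀ k, MemLp (f k) 2 μ) (hf' : MemLp f' 2 μ) (hg : MemLp g 2 μ)
    (h : Tendsto (fun k => eLpNorm (fun x => f k x - f' x) 2 μ) atTop (𝓝 0)) :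
    Tendsto (fun k => ∫ x, f k x • g x ∂μ) atTop (𝓝 (∫ x, f' x • g x ∂μ)) := by
  refine tendsto_integral_of_L1' _ (integrable_smul_of_memLp_two hf' hg).1
    (Eventually.of_forall fun k => integrable_smul_of_memLp_two (hf k) hg) ?_
  have h2 : Tendsto (fun k => eLpNorm (fun x => f k x - f' x) 2 μ * eLpNorm g 2 μ) atTop (𝓝 0) := by
    simpa using ENNReal.Tendsto.mul_const h (Or.inr hg.2.ne)
  refine tendsto_of_tendsto_of_tendsto_of_le_of_le tendsto_const_nhds h2 (fun _ => zero_le)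
    fun k => ?_
  refine le_trans (le_of_eq ?_) (eLpNorm_smul_le_mul_eLpNorm (p := 2) (q := 2) (r := 1) hg.1
    ((hf k).sub hf').1)
  congr 1
  ext x
  simp [sub_smul]

lemma tendsto_integral_smul_right {f : α → ℝ} {g : ℕ → α → E} {g' : α → E}
    (hf : MemLp f 2 μ) (hg : ∀ k, MemLp (g k) 2 μ) (hg' : MemLp g' 2 μ)
    (h : Tendsto (fun k => eLpNorm (fun x => g k x - g' x) 2 μ) atTop (𝓝 0)) :
    Tendsto (fun k => ∫ x, f x • g k x ∂μ) atTop (𝓝 (∫ x, f x • g' x ∂μ)) := by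
  refine tendsto_integral_of_L1' _ (integrable_smul_of_memLp_two hf hg').1
    (Eventually.of_forall fun k => integrable_smul_of_memLp_two hf (hg k)) ?_
  have h2 : Tendsto (fun k => eLpNorm f 2 μ * eLpNorm (fun x => g k x - g' x) 2 μ) atTop (𝓝 0) := by
    simpa using ENNReal.Tendsto.const_mul h (Or.inr hf.2.ne)
  refine tendsto_of_tendsto_of_tendsto_of_le_of_le tendsto_const_nhds h2 (fun _ => zero_le)
    fun k => ?_
  refine le_trans (le_of_eq ?_) (eLpNorm_smul_le_mul_eLpNorm (p := 2) (q := 2) (r := 1)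
    ((hg k).sub hg').1 hf.1)
  congr 1
  ext x
  simp [smul_sub]

lemma norm_toLp_sq {E : Type*} [NormedAddCommGroup E] [InnerProductSpace ℝ E] {f : α → E}
    (hf : MemLp f 2 μ) : ‖hf.toLp f‖ ^ 2 = ∫ x, ‖f x‖ ^ 2 ∂μ := by
  rw [← real_inner_self_eq_norm_sq, L2.inner_def]
  refine integral_congr_ae ?_
  filter_upwards [hf.coeFn_toLp] with x hx
  rw [hx, real_inner_self_eq_norm_sq]

lemma norm_Lp_sq {E : Type*} [NormedAddCommGroup E] [InnerProductSpace ℝ E] (f : Lp E 2 μ) :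
    ‖f‖ ^ 2 = ∫ x, ‖f x‖ ^ 2 ∂μ := by
  rw [← real_inner_self_eq_norm_sq, L2.inner_def]
  simp only [real_inner_self_eq_norm_sq]

lemma inner_Lp_eq (f g : Lp ℝ 2 μ) : ⟪f, g⟫ = ∫ x, f x * g x ∂μ := by
  rw [L2.inner_def]
  refine integral_congr_ae (ae_of_all _ fun x => ?_)
  simp [mul_comm]

lemma integrable_inner_of_memLp_two {f g : α → E} (hf : MemLp f 2 μ) (hg : MemLp g 2 μ) :
    Integrable (fun x => ⟪f x, g x⟫) μ := by
  have h := L2.integrable_inner (𝕜 := ℝ) (hf.toLp f) (hg.toLp g)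
  refine h.congr ?_
  filter_upwards [hf.coeFn_toLp, hg.coeFn_toLp] with x h1 h2
  rw [h1, h2]

end Convergence

/-! ### Weak gradients of limits of test functions -/

section WeakGradient

variable {n : ℕ} {Ω : Set (Euc n)}

lemma IsTest.mul_smooth_contDiff {V : Type*} [NormedAddCommGroup V] [NormedSpace ℝ V] {U : Set V}
    {φ : V → ℝ} (h : IsTest U φ) : ContDiff ℝ 1 φ := h.1.of_le (by simp)

lemma IsTest.integral_gradient {φ ψ : Euc n → ℝ} (hφ : IsTest Ω φ) (hψ : IsTest Ω ψ) :
    ∫ x, φ x • gradient ψ x ∂(baseMeasure Ω) = -∫ x, ψ x • gradient φ x ∂(baseMeasure Ω) := by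
  have key : ∀ {φ ψ : Euc n → ℝ}, IsTest Ω φ → IsTest Ω ψ → ∀ v : Euc n,
      ⟪∫ x, φ x • gradient ψ x ∂(baseMeasure Ω), v⟫ = ∫ x, φ x * fderiv ℝ ψ x v := by
    intro φ ψ hφ hψ v
    rw [integral_base_eq (fun x hx => by simp [hφ.eq_zero hx]), real_inner_comm, ← integral_inner]
    · refine integral_congr_ae (ae_of_all _ fun x => ?_)
      simp only
      rw [real_inner_comm, inner_smul_left, inner_gradient]
      simp
    · exact (hφ.continuous.smul hψ.continuous_gradient).integrable_of_hasCompactSupport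
        (hφ.2.1.smul_right (f' := gradient ψ))
  refine ext_inner_right ℝ fun v => ?_
  rw [inner_neg_left, key hφ hψ, key hψ hφ, integral_mul_fderiv_of_hasCompactSupport
    hφ.mul_smooth_contDiff hψ.mul_smooth_contDiff hψ.2.1]
  simp only [mul_comm]

/-- Both sides of the integration by parts formula are continuous under L² convergence. Thus the
weak gradient condition is a consequence of approximability wherever an element of H^1_0 has to be
produced. -/
lemma isWeakGradient_of_tendsto {u : Euc n → ℝ} {g : Euc n → Euc n} {φ : ℕ → Euc n → ℝ}
    (hu : MemLp u 2 (baseMeasure Ω)) (hg : MemLp g 2 (baseMeasure Ω)) (hφ : ∀ k, IsTest Ω (φ k))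
    (h1 : Tendsto (fun k => eLpNorm (fun x => φ k x - u x) 2 (baseMeasure Ω)) atTop (𝓝 0))
    (h2 : Tendsto (fun k => eLpNorm (fun x => gradient (φ k) x - g x) 2 (baseMeasure Ω))
      atTop (𝓝 0)) : IsWeakGradient Ω u g := by
  intro ψ hψ
  refine tendsto_nhds_unique
    (tendsto_integral_smul_left (fun k => (hφ k).memLp) hu hψ.memLp_gradient h1) ?_
  refine ((tendsto_integral_smul_right hψ.memLp
    (fun k => (hφ k).memLp_gradient) hg h2).neg).congr fun k => ?_
  exact ((hφ k).integral_gradient hψ).symm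

/-- Only ψ vanishes near the bottom of the half-cylinder, and that is enough: its support confines
both integrals, which may then be taken over the whole space. This admits functions φ with a nonzero
trace. -/
lemma IsTest.integral_gradX {φ ψ : Euc n × ℝ → ℝ} {U : Set (Euc n × ℝ)} (hφ : IsTest U φ)
    (hψ : IsTest (cylinder Ω) ψ) :
    ∫ p, φ p • gradX ψ p ∂(cylMeasure Ω) = -∫ p, ψ p • gradX φ p ∂(cylMeasure Ω) := by
  have hz1 : ∫ p, φ p • gradX ψ p ∂(cylMeasure Ω) = ∫ p, φ p • gradX ψ p :=
    setIntegral_eq_integral_of_forall_compl_eq_zero fun p hp => by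
      rw [hψ.gradX_eq_zero hp, smul_zero]
  have hz2 : ∫ p, ψ p • gradX φ p ∂(cylMeasure Ω) = ∫ p, ψ p • gradX φ p :=
    setIntegral_eq_integral_of_forall_compl_eq_zero fun p hp => by
      rw [hψ.eq_zero hp, zero_smul]
  have key : ∀ {φ ψ : Euc n × ℝ → ℝ} {U U' : Set (Euc n × ℝ)}, IsTest U φ → IsTest U' ψ →
      ∀ v : Euc n, ⟪∫ p, φ p • gradX ψ p, v⟫ = ∫ p, φ p * fderiv ℝ ψ p (v, 0) := by
    intro φ ψ U U' hφ hψ v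
    rw [real_inner_comm, ← integral_inner]
    · refine integral_congr_ae (ae_of_all _ fun p => ?_)
      simp only
      rw [real_inner_comm, inner_smul_left, inner_gradX hψ.differentiable]
      simp
    · exact (hφ.continuous.smul hψ.continuous_gradX).integrable_of_hasCompactSupport
        (hφ.2.1.smul_right (f' := gradX ψ))
  rw [hz1, hz2]
  refine ext_inner_right ℝ fun v => ?_
  rw [inner_neg_left, key hφ hψ, key hψ hφ, Measure.volume_eq_prod,
    integral_mul_fderiv_of_hasCompactSupport hφ.mul_smooth_contDiff
    hψ.mul_smooth_contDiff hψ.2.1]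
  simp only [mul_comm]

lemma IsTest.integral_derivY {φ ψ : Euc n × ℝ → ℝ} {U : Set (Euc n × ℝ)} (hφ : IsTest U φ)
    (hψ : IsTest (cylinder Ω) ψ) :
    ∫ p, φ p * derivY ψ p ∂(cylMeasure Ω) = -∫ p, ψ p * derivY φ p ∂(cylMeasure Ω) := by
  have hz1 : ∫ p, φ p * derivY ψ p ∂(cylMeasure Ω) = ∫ p, φ p * derivY ψ p :=
    setIntegral_eq_integral_of_forall_compl_eq_zero fun p hp => by
      rw [hψ.derivY_eq_zero hp, mul_zero]
  have hz2 : ∫ p, ψ p * derivY φ p ∂(cylMeasure Ω) = ∫ p, ψ p * derivY φ p :=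
    setIntegral_eq_integral_of_forall_compl_eq_zero fun p hp => by
      rw [hψ.eq_zero hp, zero_mul]
  rw [hz1, hz2]
  simp only [derivY_eq hφ.differentiable, derivY_eq hψ.differentiable]
  rw [Measure.volume_eq_prod, integral_mul_fderiv_of_hasCompactSupport hφ.mul_smooth_contDiff
    hψ.mul_smooth_contDiff hψ.2.1]
  simp only [mul_comm]

lemma isWeakGradientCyl_of_tendsto {w : Euc n × ℝ → ℝ} {gx : Euc n × ℝ → Euc n}
    {gy : Euc n × ℝ → ℝ} {φ : ℕ → Euc n × ℝ → ℝ} {U : Set (Euc n × ℝ)}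
    (hw : MemLp w 2 (cylMeasure Ω)) (hgx : MemLp gx 2 (cylMeasure Ω))
    (hgy : MemLp gy 2 (cylMeasure Ω)) (hφ : ∀ k, IsTest U (φ k))
    (h1 : Tendsto (fun k => eLpNorm (fun p => φ k p - w p) 2 (cylMeasure Ω)) atTop (𝓝 0))
    (h2 : Tendsto (fun k => eLpNorm (fun p => gradX (φ k) p - gx p) 2 (cylMeasure Ω))
      atTop (𝓝 0))
    (h3 : Tendsto (fun k => eLpNorm (fun p => derivY (φ k) p - gy p) 2 (cylMeasure Ω))
      atTop (𝓝 0)) : IsWeakGradientCyl Ω w gx gy := by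
  intro ψ hψ
  constructor
  · refine tendsto_nhds_unique
      (tendsto_integral_smul_left (fun k => (hφ k).memLp_cyl) hw hψ.memLp_gradX h1) ?_
    refine ((tendsto_integral_smul_right hψ.memLp_cyl
      (fun k => (hφ k).memLp_gradX) hgx h2).neg).congr fun k => ?_
    exact ((hφ k).integral_gradX hψ).symm
  · refine tendsto_nhds_unique
      (tendsto_integral_smul_left (fun k => (hφ k).memLp_cyl) hw hψ.memLp_derivY h1) ?_
    refine ((tendsto_integral_smul_right hψ.memLp_cyl
      (fun k => (hφ k).memLp_derivY) hgy h3).neg).congr fun k => ?_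
    exact ((hφ k).integral_derivY hψ).symm

end WeakGradient

/-! ### The energy spaces -/

section Base

variable {n : ℕ} {Ω : Set (Euc n)}

/-- The class of a test function in `L²(Ω)`. -/
def baseVal (Ω : Set (Euc n)) : testSubmodule Ω →ₗ[ℝ] Lp ℝ 2 (baseMeasure Ω) where
  toFun φ := (show IsTest Ω φ.1 from φ.2).memLp.toLp φ.1
  map_add' _ _ := MemLp.toLp_add _ _
  map_smul' _ _ := MemLp.toLp_const_smul _ _

/-- The gradient of a test function in `L²(Ω)`. -/
def baseGrad (Ω : Set (Euc n)) : testSubmodule Ω →ₗ[ℝ] Lp (Euc n) 2 (baseMeasure Ω) where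
  toFun φ := (show IsTest Ω φ.1 from φ.2).memLp_gradient.toLp (gradient φ.1)
  map_add' φ ψ := by
    rw [← MemLp.toLp_add]
    exact MemLp.toLp_congr _ _ (by
      rw [Submodule.coe_add, gradient_add (IsTest.differentiable φ.2) (IsTest.differentiable ψ.2)])
  map_smul' c φ := by
    rw [RingHom.id_apply, ← MemLp.toLp_const_smul]
    exact MemLp.toLp_congr _ _ (by
      rw [Submodule.coe_smul, gradient_smul c (IsTest.differentiable φ.2)])

/-- The space of gradients of functions in `H^1_0(Ω)`. -/
def baseSpace (Ω : Set (Euc n)) : Submodule ℝ (Lp (Euc n) 2 (baseMeasure Ω)) :=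
  (LinearMap.range (baseGrad Ω)).topologicalClosure

instance : CompleteSpace (baseSpace Ω) :=
  (Submodule.isClosed_topologicalClosure _).completeSpace_coe

/-- The gradient of a test function, as an element of `baseSpace Ω`. -/
def baseEmb (Ω : Set (Euc n)) : testSubmodule Ω →ₗ[ℝ] baseSpace Ω :=
  (baseGrad Ω).codRestrict _ fun φ => Submodule.le_topologicalClosure _ (LinearMap.mem_range_self _ φ)

lemma denseRange_codRestrict {M W : Type*} [AddCommGroup M] [Module ℝ M] [NormedAddCommGroup W]
    [NormedSpace ℝ W] (e : M →ₗ[ℝ] W) :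
    DenseRange (e.codRestrict (LinearMap.range e).topologicalClosure
      fun φ => Submodule.le_topologicalClosure _ (LinearMap.mem_range_self _ φ)) := by
  rintro ⟨k, hk⟩
  refine closure_subtype.2 ?_
  have h : k ∈ closure (range e) := hk
  refine closure_mono ?_ h
  rintro _ ⟨m, rfl⟩
  exact ⟨_, ⟨m, rfl⟩, rfl⟩

lemma denseRange_baseEmb : DenseRange (baseEmb Ω) := denseRange_codRestrict (baseGrad Ω)

lemma norm_baseVal_sq (φ : testSubmodule Ω) :
    ‖baseVal Ω φ‖ ^ 2 = ∫ x, φ.1 x ^ 2 ∂(baseMeasure Ω) := by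
  refine (norm_toLp_sq (IsTest.memLp φ.2)).trans ?_
  simp

lemma norm_baseEmb_sq (φ : testSubmodule Ω) :
    ‖baseEmb Ω φ‖ ^ 2 = ∫ x, ‖gradient φ.1 x‖ ^ 2 ∂(baseMeasure Ω) :=
  norm_toLp_sq (IsTest.memLp_gradient φ.2)

/-- The function with given gradient, as an operator into `L²(Ω)`. -/
def baseFun (Ω : Set (Euc n)) : baseSpace Ω →L[ℝ] Lp ℝ 2 (baseMeasure Ω) :=
  (baseVal Ω).extendOfNorm (baseEmb Ω)

/-- `Ω` is bounded, in a space of positive dimension. -/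
structure IsAdmissible (Ω : Set (Euc n)) : Prop where
  pos : 0 < n
  bounded : Bornology.IsBounded Ω

lemma IsAdmissible.exists_radius (h : IsAdmissible Ω) : ∃ R > 0, ∀ x ∈ Ω, ‖x‖ ≤ R :=
  h.bounded.exists_pos_norm_le

lemma IsAdmissible.norm_baseVal_le (h : IsAdmissible Ω) :
    ∃ C, ∀ φ, ‖baseVal Ω φ‖ ≤ C * ‖baseEmb Ω φ‖ := by
  obtain ⟨R, hR0, hR⟩ := h.exists_radius
  refine ⟨2 * R, fun φ => ?_⟩
  refine le_of_sq_le_sq ?_ (by positivity)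
  rw [mul_pow, norm_baseVal_sq, norm_baseEmb_sq]
  refine (IsTest.poincare φ.2 h.pos hR).trans (le_of_eq ?_)
  ring

/-- Poincaré's inequality bounds a function by its gradient; this is what makes the extension by
density agree with the original map on test functions. -/
lemma IsAdmissible.baseFun_baseEmb (h : IsAdmissible Ω) (φ : testSubmodule Ω) :
    baseFun Ω (baseEmb Ω φ) = baseVal Ω φ :=
  LinearMap.extendOfNorm_eq denseRange_baseEmb h.norm_baseVal_le φ

lemma exists_seq_tendsto_of_denseRange {M W : Type*} [NormedAddCommGroup W] {e : M → W}
    (h : DenseRange e) (k : W) : ∃ φ : ℕ → M, Tendsto (fun j => e (φ j)) atTop (𝓝 k) := by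
  obtain ⟨x, hx, hlim⟩ := mem_closure_iff_seq_limit.1 (h k)
  choose φ hφ using hx
  exact ⟨φ, by simpa only [hφ] using hlim⟩

lemma tendsto_eLpNorm_of_tendsto_toLp {α E : Type*} [MeasurableSpace α] {μ : Measure α}
    [NormedAddCommGroup E] {f : ℕ → α → E} (hf : ∀ k, MemLp (f k) 2 μ) {f' : α → E} {F : Lp E 2 μ}
    (hF : F =ᵐ[μ] f') (h : Tendsto (fun k => (hf k).toLp (f k)) atTop (𝓝 F)) :
    Tendsto (fun k => eLpNorm (fun x => f k x - f' x) 2 μ) atTop (𝓝 0) := by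
  have hf' : MemLp f' 2 μ := (memLp_congr_ae hF).1 (Lp.memLp F)
  have : F = hf'.toLp f' := Lp.ext (hF.trans hf'.coeFn_toLp.symm)
  rw [this] at h
  exact (Lp.tendsto_Lp_iff_tendsto_eLpNorm'' f hf f' hf').1 h

lemma IsAdmissible.isH01 (h : IsAdmissible Ω) (v : baseSpace Ω) {u : Euc n → ℝ}
    (hu : baseFun Ω v =ᵐ[baseMeasure Ω] u) : IsH01 Ω u v.1 := by
  obtain ⟨φ, hφ⟩ := exists_seq_tendsto_of_denseRange denseRange_baseEmb v
  have hu2 : MemLp u 2 (baseMeasure Ω) := (memLp_congr_ae hu).1 (Lp.memLp _)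
  have h1 : Tendsto (fun k => eLpNorm (fun x => (φ k).1 x - u x) 2 (baseMeasure Ω)) atTop (𝓝 0) := by
    have := ((baseFun Ω).continuous.tendsto v).comp hφ
    simp only [Function.comp_def, h.baseFun_baseEmb] at this
    exact tendsto_eLpNorm_of_tendsto_toLp (fun k => IsTest.memLp (φ k).2) hu this
  have h2 : Tendsto (fun k => eLpNorm (fun x => gradient (φ k).1 x - v.1 x) 2 (baseMeasure Ω))
      atTop (𝓝 0) := by
    have := (continuous_subtype_val.tendsto v).comp hφ
    exact tendsto_eLpNorm_of_tendsto_toLp (fun k => IsTest.memLp_gradient (φ k).2) (ae_eq_refl _) this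
  exact ⟨hu2, Lp.memLp _, isWeakGradient_of_tendsto hu2 (Lp.memLp _) (fun k => (φ k).2) h1 h2,
    fun k => (φ k).1, fun k => (φ k).2, h1, h2⟩

/-- The approximating gradients converge inside the closed space `baseSpace Ω`, and continuity of
`baseFun Ω` identifies the limit of the functions. With `isH01` this makes elements of H^1_0 and of
`baseSpace Ω` interchangeable. -/
lemma IsAdmissible.exists_of_isH01 (h : IsAdmissible Ω) {u : Euc n → ℝ} {g : Euc n → Euc n}
    (hu : IsH01 Ω u g) : ∃ v : baseSpace Ω, v.1 =ᵐ[baseMeasure Ω] g ∧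
      baseFun Ω v =ᵐ[baseMeasure Ω] u := by
  obtain ⟨φ, hφ, h1, h2⟩ := hu.approx
  set e : ℕ → testSubmodule Ω := fun k => ⟨φ k, hφ k⟩
  have h2' : Tendsto (fun k => (baseEmb Ω (e k)).1) atTop (𝓝 (hu.memLp_grad.toLp g)) :=
    (Lp.tendsto_Lp_iff_tendsto_eLpNorm'' _ (fun k => (hφ k).memLp_gradient) _ _).2 h2
  have h1' : Tendsto (fun k => baseVal Ω (e k)) atTop (𝓝 (hu.memLp.toLp u)) :=
    (Lp.tendsto_Lp_iff_tendsto_eLpNorm'' _ (fun k => (hφ k).memLp) _ _).2 h1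
  have hmem : hu.memLp_grad.toLp g ∈ baseSpace Ω :=
    (Submodule.isClosed_topologicalClosure _).mem_of_tendsto h2'
      (Eventually.of_forall fun k => (baseEmb Ω (e k)).2)
  refine ⟨⟨_, hmem⟩, hu.memLp_grad.coeFn_toLp, ?_⟩
  have h3 : Tendsto (fun k => baseEmb Ω (e k)) atTop (𝓝 ⟨_, hmem⟩) := tendsto_subtype_rng.2 h2'
  have h4 := ((baseFun Ω).continuous.tendsto _).comp h3
  simp only [Function.comp_def, h.baseFun_baseEmb] at h4
  rw [tendsto_nhds_unique h4 h1']
  exact hu.memLp.coeFn_toLp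

end Base

/-! ### The energy space of the half-cylinder and its trace operator -/

section Cylinder

variable {n : ℕ} {Ω : Set (Euc n)}

/-- The smooth functions with compact support in `Ω × ℝ`. -/
abbrev cylTest (Ω : Set (Euc n)) : Submodule ℝ (Euc n × ℝ → ℝ) :=
  testSubmodule (Ω ×ˢ (univ : Set ℝ))

/-- The class of a test function in `L²` of the half-cylinder. -/
def cylVal (Ω : Set (Euc n)) : cylTest Ω →ₗ[ℝ] Lp ℝ 2 (cylMeasure Ω) where
  toFun φ := (IsTest.memLp_cyl φ.2).toLp φ.1
  map_add' _ _ := MemLp.toLp_add _ _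
  map_smul' _ _ := MemLp.toLp_const_smul _ _

lemma IsTest.memLp_trace {φ : Euc n × ℝ → ℝ} {U : Set (Euc n × ℝ)} (h : IsTest U φ) :
    MemLp (fun x => φ (x, 0)) 2 (baseMeasure Ω) :=
  Continuous.memLp_of_hasCompactSupport (h.continuous.comp (by fun_prop))
    (hasCompactSupport_slice_left h.2.1 0)

/-- The trace of a test function. -/
def cylTrace (Ω : Set (Euc n)) : cylTest Ω →ₗ[ℝ] Lp ℝ 2 (baseMeasure Ω) where
  toFun φ := (IsTest.memLp_trace φ.2).toLp fun x => φ.1 (x, 0)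
  map_add' φ ψ := MemLp.toLp_add (IsTest.memLp_trace φ.2) (IsTest.memLp_trace ψ.2)
  map_smul' c φ := MemLp.toLp_const_smul c (IsTest.memLp_trace φ.2)

/-- The space of square integrable vector fields on the half-cylinder. -/
abbrev cylFields (Ω : Set (Euc n)) : Type :=
  WithLp 2 (Lp (Euc n) 2 (cylMeasure Ω) × Lp ℝ 2 (cylMeasure Ω))

/-- The gradient of a test function. -/
def cylGrad (Ω : Set (Euc n)) : cylTest Ω →ₗ[ℝ] cylFields Ω where
  toFun φ := WithLp.toLp 2 ((IsTest.memLp_gradX φ.2).toLp (gradX φ.1),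
    (IsTest.memLp_derivY φ.2).toLp (derivY φ.1))
  map_add' φ ψ := by
    rw [← WithLp.toLp_add, Prod.mk_add_mk, ← MemLp.toLp_add, ← MemLp.toLp_add]
    congr 2
    · exact MemLp.toLp_congr _ _ (by rw [Submodule.coe_add,
        gradX_add (IsTest.differentiable φ.2) (IsTest.differentiable ψ.2)])
    · exact MemLp.toLp_congr _ _ (by rw [Submodule.coe_add,
        derivY_add (IsTest.differentiable φ.2) (IsTest.differentiable ψ.2)])
  map_smul' c φ := by
    rw [RingHom.id_apply, ← WithLp.toLp_smul, Prod.smul_mk, ← MemLp.toLp_const_smul,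
      ← MemLp.toLp_const_smul]
    congr 2
    · exact MemLp.toLp_congr _ _ (by rw [Submodule.coe_smul,
        gradX_smul c (IsTest.differentiable φ.2)])
    · exact MemLp.toLp_congr _ _ (by rw [Submodule.coe_smul,
        derivY_smul c (IsTest.differentiable φ.2)])

/-- The space of gradients of functions in `X_0^{1/2}`; its inner product is the Dirichlet form. -/
def energySpace (Ω : Set (Euc n)) : Submodule ℝ (cylFields Ω) :=
  (LinearMap.range (cylGrad Ω)).topologicalClosure

instance : CompleteSpace (energySpace Ω) :=
  (Submodule.isClosed_topologicalClosure _).completeSpace_coe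

/-- The gradient of a test function, as an element of `energySpace Ω`. -/
def cylEmb (Ω : Set (Euc n)) : cylTest Ω →ₗ[ℝ] energySpace Ω :=
  (cylGrad Ω).codRestrict _ fun φ => Submodule.le_topologicalClosure _ (LinearMap.mem_range_self _ φ)

lemma denseRange_cylEmb : DenseRange (cylEmb Ω) := denseRange_codRestrict (cylGrad Ω)

/-- The function with given gradient, as an operator into `L²` of the half-cylinder. -/
def energyFun (Ω : Set (Euc n)) : energySpace Ω →L[ℝ] Lp ℝ 2 (cylMeasure Ω) :=
  (cylVal Ω).extendOfNorm (cylEmb Ω)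

/-- The trace operator. -/
def energyTrace (Ω : Set (Euc n)) : energySpace Ω →L[ℝ] Lp ℝ 2 (baseMeasure Ω) :=
  (cylTrace Ω).extendOfNorm (cylEmb Ω)

lemma norm_cylVal_sq (φ : cylTest Ω) :
    ‖cylVal Ω φ‖ ^ 2 = ∫ p, φ.1 p ^ 2 ∂(cylMeasure Ω) := by
  refine (norm_toLp_sq (IsTest.memLp_cyl φ.2)).trans ?_
  simp

lemma norm_cylTrace_sq (φ : cylTest Ω) :
    ‖cylTrace Ω φ‖ ^ 2 = ∫ x, φ.1 (x, 0) ^ 2 ∂(baseMeasure Ω) := by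
  refine (norm_toLp_sq (IsTest.memLp_trace φ.2)).trans ?_
  simp

lemma norm_cylEmb_sq (φ : cylTest Ω) :
    ‖cylEmb Ω φ‖ ^ 2 = ∫ p, ‖gradX φ.1 p‖ ^ 2 ∂(cylMeasure Ω)
      + ∫ p, derivY φ.1 p ^ 2 ∂(cylMeasure Ω) := by
  refine (WithLp.prod_norm_sq_eq_of_L2 _).trans ?_
  refine congrArg₂ (· + ·) (norm_toLp_sq (IsTest.memLp_gradX φ.2))
    ((norm_toLp_sq (IsTest.memLp_derivY φ.2)).trans ?_)
  simp

lemma IsAdmissible.norm_cylVal_le (h : IsAdmissible Ω) :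
    ∃ C, ∀ φ, ‖cylVal Ω φ‖ ≤ C * ‖cylEmb Ω φ‖ := by
  obtain ⟨R, hR0, hR⟩ := h.exists_radius
  refine ⟨2 * R, fun φ => ?_⟩
  refine le_of_sq_le_sq ?_ (by positivity)
  rw [mul_pow, norm_cylVal_sq, norm_cylEmb_sq]
  have h1 := IsTest.poincare_cyl φ.2 h.pos hR
  have h2 : 0 ≤ ∫ p, derivY φ.1 p ^ 2 ∂(cylMeasure Ω) := integral_nonneg fun p => sq_nonneg _
  nlinarith [mul_nonneg (sq_nonneg R) h2]

lemma IsAdmissible.norm_cylTrace_le (h : IsAdmissible Ω) :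
    ∃ C, ∀ φ, ‖cylTrace Ω φ‖ ≤ C * ‖cylEmb Ω φ‖ := by
  obtain ⟨R, hR0, hR⟩ := h.exists_radius
  -- Its square dominates 4R² + 1, the constants of Poincaré's inequality and of the trace
  -- inequality combined.
  refine ⟨2 * R + 1, fun φ => ?_⟩
  refine le_of_sq_le_sq ?_ (by positivity)
  rw [mul_pow, norm_cylTrace_sq, norm_cylEmb_sq]
  have h1 := IsTest.poincare_cyl φ.2 h.pos hR
  have h2 : 0 ≤ ∫ p, derivY φ.1 p ^ 2 ∂(cylMeasure Ω) := integral_nonneg fun p => sq_nonneg _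
  have h3 : 0 ≤ ∫ p, ‖gradX φ.1 p‖ ^ 2 ∂(cylMeasure Ω) := integral_nonneg fun p => sq_nonneg _
  have h4 := IsTest.trace_le (Ω := Ω) φ.2
  nlinarith [mul_nonneg (sq_nonneg R) h2, mul_nonneg hR0.le h2, mul_nonneg hR0.le h3]

lemma IsAdmissible.energyFun_cylEmb (h : IsAdmissible Ω) (φ : cylTest Ω) :
    energyFun Ω (cylEmb Ω φ) = cylVal Ω φ :=
  LinearMap.extendOfNorm_eq denseRange_cylEmb h.norm_cylVal_le φ

lemma IsAdmissible.energyTrace_cylEmb (h : IsAdmissible Ω) (φ : cylTest Ω) :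
    energyTrace Ω (cylEmb Ω φ) = cylTrace Ω φ :=
  LinearMap.extendOfNorm_eq denseRange_cylEmb h.norm_cylTrace_le φ

/-- The function on the half-cylinder given by an element of the energy space. -/
def IsAdmissible.extSpace (h : IsAdmissible Ω) (k : energySpace Ω) : ExtSpace Ω := by
  have h1 : ∃ φ : ℕ → Euc n × ℝ → ℝ, (∀ k, IsTest (Ω ×ˢ (univ : Set ℝ)) (φ k)) ∧
      Tendsto (fun j => eLpNorm (fun p => φ j p - energyFun Ω k p) 2 (cylMeasure Ω)) atTop (𝓝 0) ∧
      Tendsto (fun j => eLpNorm (fun p => gradX (φ j) p - k.1.fst p) 2 (cylMeasure Ω))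
        atTop (𝓝 0) ∧
      Tendsto (fun j => eLpNorm (fun p => derivY (φ j) p - k.1.snd p) 2 (cylMeasure Ω))
        atTop (𝓝 0) ∧
      Tendsto (fun j => eLpNorm (fun x => φ j (x, 0) - energyTrace Ω k x) 2 (baseMeasure Ω))
        atTop (𝓝 0) := by
    obtain ⟨φ, hφ⟩ := exists_seq_tendsto_of_denseRange denseRange_cylEmb k
    refine ⟨fun j => (φ j).1, fun j => (φ j).2, ?_, ?_, ?_, ?_⟩
    · have := ((energyFun Ω).continuous.tendsto k).comp hφ
      simp only [Function.comp_def, h.energyFun_cylEmb] at this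
      exact tendsto_eLpNorm_of_tendsto_toLp (fun j => IsTest.memLp_cyl (φ j).2) (ae_eq_refl _) this
    · have := (((WithLp.fstL 2 ℝ (Lp (Euc n) 2 (cylMeasure Ω)) (Lp ℝ 2 (cylMeasure Ω))).continuous.comp
        continuous_subtype_val).tendsto k).comp hφ
      exact tendsto_eLpNorm_of_tendsto_toLp (fun j => IsTest.memLp_gradX (φ j).2) (ae_eq_refl _) this
    · have := (((WithLp.sndL 2 ℝ (Lp (Euc n) 2 (cylMeasure Ω)) (Lp ℝ 2 (cylMeasure Ω))).continuous.comp
        continuous_subtype_val).tendsto k).comp hφ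
      exact tendsto_eLpNorm_of_tendsto_toLp (fun j => IsTest.memLp_derivY (φ j).2) (ae_eq_refl _) this
    · have := ((energyTrace Ω).continuous.tendsto k).comp hφ
      simp only [Function.comp_def, h.energyTrace_cylEmb] at this
      exact tendsto_eLpNorm_of_tendsto_toLp (fun j => IsTest.memLp_trace (φ j).2) (ae_eq_refl _) this
  refine ⟨energyFun Ω k, k.1.fst, k.1.snd, energyTrace Ω k, Lp.memLp _, Lp.memLp _, Lp.memLp _,
    Lp.memLp _, ?_, h1⟩
  obtain ⟨φ, hφ, h2, h3, h4, -⟩ := h1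
  exact isWeakGradientCyl_of_tendsto (Lp.memLp _) (Lp.memLp _) (Lp.memLp _) hφ h2 h3 h4

/-- Convergence of both gradient components places the limit in the closed energy space, and
continuity of the trace operator identifies the trace. Every statement quantified over `ExtSpace Ω`
is reduced to the Hilbert space through this lemma and `form_eq_inner`. -/
lemma IsAdmissible.exists_energy (h : IsAdmissible Ω) (w : ExtSpace Ω) :
    ∃ k : energySpace Ω, k.1.fst =ᵐ[cylMeasure Ω] w.gx ∧ k.1.snd =ᵐ[cylMeasure Ω] w.gy ∧
      energyTrace Ω k =ᵐ[baseMeasure Ω] w.tr := by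
  obtain ⟨φ, hφ, -, h2, h3, h4⟩ := w.approx
  set e : ℕ → cylTest Ω := fun k => ⟨φ k, hφ k⟩
  have h2' : Tendsto (fun j => (hφ j).memLp_gradX.toLp (gradX (φ j))) atTop
      (𝓝 (w.memLp_gx.toLp w.gx)) :=
    (Lp.tendsto_Lp_iff_tendsto_eLpNorm'' _ (fun k => (hφ k).memLp_gradX) _ _).2 h2
  have h3' : Tendsto (fun j => (hφ j).memLp_derivY.toLp (derivY (φ j))) atTop
      (𝓝 (w.memLp_gy.toLp w.gy)) :=
    (Lp.tendsto_Lp_iff_tendsto_eLpNorm'' _ (fun k => (hφ k).memLp_derivY) _ _).2 h3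
  have h4' : Tendsto (fun j => cylTrace Ω (e j)) atTop (𝓝 (w.memLp_tr.toLp w.tr)) :=
    (Lp.tendsto_Lp_iff_tendsto_eLpNorm'' _ (fun k => (hφ k).memLp_trace) _ _).2 h4
  set K : cylFields Ω := WithLp.toLp 2 (w.memLp_gx.toLp w.gx, w.memLp_gy.toLp w.gy)
  have h5 : Tendsto (fun j => (cylEmb Ω (e j)).1) atTop (𝓝 K) :=
    ((WithLp.prod_continuous_toLp 2 _ _).tendsto _).comp (h2'.prodMk_nhds h3')
  have hmem : K ∈ energySpace Ω :=
    (Submodule.isClosed_topologicalClosure _).mem_of_tendsto h5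
      (Eventually.of_forall fun k => (cylEmb Ω (e k)).2)
  refine ⟨⟨K, hmem⟩, w.memLp_gx.coeFn_toLp, w.memLp_gy.coeFn_toLp, ?_⟩
  have h6 : Tendsto (fun k => cylEmb Ω (e k)) atTop (𝓝 ⟨K, hmem⟩) := tendsto_subtype_rng.2 h5
  have h7 := ((energyTrace Ω).continuous.tendsto _).comp h6
  simp only [Function.comp_def, h.energyTrace_cylEmb] at h7
  rw [tendsto_nhds_unique h7 h4']
  exact w.memLp_tr.coeFn_toLp

lemma form_eq_inner {w v : ExtSpace Ω} {k l : energySpace Ω}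
    (hk1 : k.1.fst =ᵐ[cylMeasure Ω] w.gx) (hk2 : k.1.snd =ᵐ[cylMeasure Ω] w.gy)
    (hl1 : l.1.fst =ᵐ[cylMeasure Ω] v.gx) (hl2 : l.1.snd =ᵐ[cylMeasure Ω] v.gy) :
    w.form v = ⟪k, l⟫ := by
  rw [Submodule.coe_inner, WithLp.prod_inner_apply, L2.inner_def, L2.inner_def, ExtSpace.form,
    integral_add (integrable_inner_of_memLp_two w.memLp_gx v.memLp_gx)
      (integrable_mul_of_memLp_two w.memLp_gy v.memLp_gy)]
  refine congrArg₂ (· + ·) (integral_congr_ae ?_) (integral_congr_ae ?_)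
  · filter_upwards [hk1, hl1] with p h1 h2
    exact h1 ▸ h2 ▸ rfl
  · filter_upwards [hk2, hl2] with p h1 h2
    rw [← h1, ← h2]
    simp [mul_comm]

end Cylinder

/-! ### Compactness of the trace -/

/-- This is Cauchy–Schwarz against the constant 1, read off from ∫ (M f - I)² ≥ 0 with M the total
mass and I the integral of f. The expansion carries an extra factor M, so the zero measure is
treated separately. -/
lemma sq_integral_le {α : Type*} [MeasurableSpace α] {μ : Measure α} [IsFiniteMeasure μ]
    {f : α → ℝ} (hf : Integrable f μ) (hf2 : Integrable (fun x => f x ^ 2) μ) :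
    (∫ x, f x ∂μ) ^ 2 ≤ μ.real univ * ∫ x, f x ^ 2 ∂μ := by
  set M := μ.real univ with hM
  set I := ∫ x, f x ∂μ with hI
  have h0 : 0 ≤ ∫ x, (M * f x - I) ^ 2 ∂μ := integral_nonneg fun x => sq_nonneg _
  have h1 : ∫ x, (M * f x - I) ^ 2 ∂μ = M ^ 2 * ∫ x, f x ^ 2 ∂μ - M * I ^ 2 := by
    have : ∀ x, (M * f x - I) ^ 2 = (M ^ 2 * f x ^ 2 - 2 * M * I * f x) + I ^ 2 := fun x => by ring
    simp only [this]
    have hi : Integrable (fun x => M ^ 2 * f x ^ 2 - 2 * M * I * f x) μ :=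
      (hf2.const_mul _).sub (hf.const_mul _)
    rw [integral_add hi (integrable_const _),
      integral_sub (hf2.const_mul _) (hf.const_mul _), integral_const_mul, integral_const_mul,
      integral_const, smul_eq_mul, ← hM, ← hI]
    ring
  rw [h1] at h0
  rcases (measureReal_nonneg : 0 ≤ μ.real univ).eq_or_lt with h | h
  · have hμ : μ = 0 := by
      rw [eq_comm, measureReal_eq_zero_iff] at h
      exact Measure.measure_univ_eq_zero.1 h
    simp [hI, hμ]
  · rw [← hM] at h
    have : 0 ≤ M * (M * ∫ x, f x ^ 2 ∂μ - I ^ 2) := by nlinarith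
    linarith [nonneg_of_mul_nonneg_right this h]

/-- The `L²` norm of a difference quotient is at most that of the gradient. -/
lemma IsTest.integral_translate_le {n : ℕ} {Ω : Set (Euc n)} {φ : Euc n → ℝ} (hφ : IsTest Ω φ)
    (h : Euc n) : ∫ x, (φ (x + h) - φ x) ^ 2 ≤ ‖h‖ ^ 2 * ∫ x, ‖gradient φ x‖ ^ 2 := by
  have hcg := hφ.continuous_gradient
  have hG : Integrable fun x => ‖gradient φ x‖ ^ 2 :=
    (hcg.norm.pow 2).integrable_of_hasCompactSupport
      (hasCompactSupport_norm_sq hφ.hasCompactSupport_gradient)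
  -- The fundamental theorem of calculus on the segment from x to x + h, then Cauchy–Schwarz on the
  -- unit interval. Fubini and translation invariance finish the estimate.
  have hpt : ∀ x, (φ (x + h) - φ x) ^ 2
      ≤ ‖h‖ ^ 2 * ∫ t in Ioc (0 : ℝ) 1, ‖gradient φ (x + t • h)‖ ^ 2 := by
    intro x
    have hc : Continuous fun t : ℝ => ⟪gradient φ (x + t • h), h⟫ := by fun_prop
    have hc2 : Continuous fun t : ℝ => ‖gradient φ (x + t • h)‖ ^ 2 := by fun_prop
    have hd : ∀ t : ℝ, HasDerivAt (fun t : ℝ => φ (x + t • h)) ⟪gradient φ (x + t • h), h⟫ t := by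
      intro t
      rw [inner_gradient]
      have h1 : HasDerivAt (fun t : ℝ => x + t • h) h t := by
        simpa using ((hasDerivAt_id t).smul_const h).const_add x
      exact (hφ.differentiable _).hasFDerivAt.comp_hasDerivAt t h1
    have hftc := intervalIntegral.integral_eq_sub_of_hasDerivAt (a := 0) (b := 1)
      (fun t _ => hd t) (hc.intervalIntegrable _ _)
    simp only [one_smul, zero_smul, add_zero] at hftc
    rw [← hftc, intervalIntegral.integral_of_le zero_le_one]
    have h1 := sq_integral_le (μ := volume.restrict (Ioc (0 : ℝ) 1)) (hc.integrableOn_Ioc)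
      ((hc.pow 2).integrableOn_Ioc)
    simp only [measureReal_restrict_apply_univ, Real.volume_real_Ioc_of_le zero_le_one, sub_zero,
      one_mul] at h1
    refine h1.trans ?_
    rw [← integral_const_mul]
    refine integral_mono (hc.pow 2).integrableOn_Ioc (hc2.integrableOn_Ioc.const_mul _) fun t => ?_
    have := sq_le_sq' (neg_le_of_abs_le (abs_real_inner_le_norm (gradient φ (x + t • h)) h))
      (le_of_abs_le (abs_real_inner_le_norm (gradient φ (x + t • h)) h))
    simp only
    nlinarith
  have htr : ∀ t : ℝ, ∫ x, ‖gradient φ (x + t • h)‖ ^ 2 = ∫ x, ‖gradient φ x‖ ^ 2 := fun t =>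
    integral_add_right_eq_self (fun x => ‖gradient φ x‖ ^ 2) (t • h)
  have hprod : Integrable (fun p : Euc n × ℝ => ‖gradient φ (p.1 + p.2 • h)‖ ^ 2)
      (volume.prod (volume.restrict (Ioc (0 : ℝ) 1))) := by
    have hcp : Continuous fun p : Euc n × ℝ => ‖gradient φ (p.1 + p.2 • h)‖ ^ 2 := by fun_prop
    refine (integrable_prod_iff' hcp.aestronglyMeasurable).2
      ⟨ae_of_all _ fun t => hG.comp_add_right (t • h), ?_⟩
    simp only [norm_pow, norm_norm, htr]
    exact integrable_const _
  have hcs : HasCompactSupport fun x => φ (x + h) :=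
    hφ.2.1.comp_homeomorph (Homeomorph.addRight h)
  have hl : Integrable fun x => (φ (x + h) - φ x) ^ 2 := by
    have := hφ.continuous
    refine Continuous.integrable_of_hasCompactSupport (by fun_prop) ?_
    exact (hcs.sub hφ.2.1).comp_left (g := fun t : ℝ => t ^ 2) (by simp)
  calc ∫ x, (φ (x + h) - φ x) ^ 2
      ≤ ∫ x, ‖h‖ ^ 2 * ∫ t in Ioc (0 : ℝ) 1, ‖gradient φ (x + t • h)‖ ^ 2 :=
        integral_mono hl (hprod.integral_prod_left.const_mul _) hpt
    _ = ‖h‖ ^ 2 * ∫ t in Ioc (0 : ℝ) 1, ∫ x, ‖gradient φ (x + t • h)‖ ^ 2 := by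
        rw [integral_const_mul, integral_integral_swap hprod]
    _ = ‖h‖ ^ 2 * ∫ x, ‖gradient φ x‖ ^ 2 := by
        simp [htr]

/-- The `L²` norm of the difference of two horizontal slices. -/
lemma IsTest.integral_slice_sub_le {n : ℕ} {Ω : Set (Euc n)} {U : Set (Euc n × ℝ)}
    {φ : Euc n × ℝ → ℝ} (hφ : IsTest U φ) {y : ℝ} (hy : 0 ≤ y) :
    ∫ x, (φ (x, y) - φ (x, 0)) ^ 2 ∂(baseMeasure Ω)
      ≤ y * ∫ p, derivY φ p ^ 2 ∂(cylMeasure Ω) := by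
  have hcφ := hφ.continuous
  have hcd := hφ.continuous_derivY
  have hct : Continuous fun p => derivY φ p ^ 2 := hcd.pow 2
  have hcs : HasCompactSupport fun p => derivY φ p ^ 2 := by
    simpa using hasCompactSupport_norm_sq hφ.hasCompactSupport_derivY
  have hi := integrable_cyl (Ω := Ω) hct hcs
  rw [integral_cyl hct hcs, ← integral_const_mul]
  rw [cylMeasure_eq] at hi
  refine integral_mono ?_ (hi.integral_prod_left.const_mul y) fun x => ?_
  · refine Continuous.integrable_of_hasCompactSupport (by fun_prop) ?_
    exact ((hasCompactSupport_slice_left hφ.2.1 y).sub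
      (hasCompactSupport_slice_left hφ.2.1 0)).comp_left (g := fun t : ℝ => t ^ 2) (by simp)
  · have hc : Continuous fun s => derivY φ (x, s) := by fun_prop
    have hftc := intervalIntegral.integral_eq_sub_of_hasDerivAt (a := 0) (b := y)
      (fun t _ => hasDerivAt_derivY hφ.differentiable x t) (hc.intervalIntegrable _ _)
    simp only
    rw [← hftc, intervalIntegral.integral_of_le hy]
    have h1 := sq_integral_le (μ := volume.restrict (Ioc (0 : ℝ) y)) (hc.integrableOn_Ioc)
      ((hc.pow 2).integrableOn_Ioc)
    simp only [measureReal_restrict_apply_univ, Real.volume_real_Ioc_of_le hy, sub_zero] at h1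
    refine h1.trans (mul_le_mul_of_nonneg_left ?_ hy)
    refine setIntegral_mono_set ?_ (ae_of_all _ fun s => sq_nonneg _)
      (Ioc_subset_Ioi_self.eventuallyLE)
    exact (hct.comp (by fun_prop : Continuous fun s : ℝ => (x, s))).integrable_of_hasCompactSupport
      (hasCompactSupport_slice_right hcs x)

/-! ### Approximation of traces by averages over small boxes -/

section Averaging

variable {n : ℕ} {Ω : Set (Euc n)}

/-- A measurable map with finitely many values that is uniformly close to the identity on `Ω`. -/
lemma exists_simpleFunc_dist_lt (hΩ : Bornology.IsBounded Ω) {r : ℝ} (hr : 0 < r) :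
    ∃ q : SimpleFunc (Euc n) (Euc n), ∀ x ∈ Ω, dist (q x) x < r := by
  obtain ⟨t, ht⟩ := hΩ.isCompact_closure.elim_finite_subcover
    (fun k : ℕ => Metric.ball (TopologicalSpace.denseSeq (Euc n) k) r)
    (fun _ => Metric.isOpen_ball) (fun x _ => by
      obtain ⟨k, hk⟩ := (TopologicalSpace.denseRange_denseSeq (Euc n)).exists_dist_lt x hr
      exact mem_iUnion.2 ⟨k, hk⟩)
  refine ⟨SimpleFunc.nearestPt (TopologicalSpace.denseSeq (Euc n)) (t.sup id), fun x hx => ?_⟩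
  obtain ⟨k, hk, hxk⟩ := mem_iUnion₂.1 (ht (subset_closure hx))
  have h1 := SimpleFunc.edist_nearestPt_le (TopologicalSpace.denseSeq (Euc n)) x
    (Finset.le_sup (f := id) hk)
  rw [edist_dist, edist_dist, ENNReal.ofReal_le_ofReal_iff dist_nonneg] at h1
  rw [Metric.mem_ball, dist_comm] at hxk
  exact h1.trans_lt hxk

/-- The box over the ball `B(z, r)`, of height `r`. -/
def box (z : Euc n) (ρ r : ℝ) : Set (Euc n × ℝ) := Metric.ball z ρ ×ˢ Ioo (0 : ℝ) r

lemma measurableSet_box (z : Euc n) (ρ r : ℝ) : MeasurableSet (box z ρ r) :=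
  Metric.isOpen_ball.measurableSet.prod measurableSet_Ioo

lemma measureReal_box (z : Euc n) (ρ : ℝ) {r : ℝ} (hr : 0 < r) :
    (volume : Measure (Euc n × ℝ)).real (box z ρ r)
      = (volume : Measure (Euc n)).real (Metric.ball 0 ρ) * r := by
  rw [box, Measure.volume_eq_prod, measureReal_prod_prod, Real.volume_real_Ioo_of_le hr.le, sub_zero,
    measureReal_def, measureReal_def, Measure.addHaar_ball_center]

lemma isBounded_box (z : Euc n) (ρ r : ℝ) : Bornology.IsBounded (box z ρ r) :=
  Metric.isBounded_ball.prod (Metric.isBounded_Ioo 0 r)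

lemma measure_box_lt_top (z : Euc n) (ρ r : ℝ) : (volume : Measure (Euc n × ℝ)) (box z ρ r) < ⊤ :=
  (isBounded_box z ρ r).measure_lt_top

lemma integrableOn_box {g : Euc n × ℝ → ℝ} (hg : Continuous g) (z : Euc n) (ρ r : ℝ) :
    IntegrableOn g (box z ρ r) :=
  (hg.continuousOn.integrableOn_compact (isBounded_box z ρ r).isCompact_closure).mono_set
    subset_closure

/-- Cauchy–Schwarz bounds the squared distance to a mean by the mean of squared distances. The box
over B(z, r) is then enlarged to one over B(x, 2r), so that the right side is free of z and becomes
an integral over displacements, ready for Fubini. -/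
lemma sq_sub_average_le {φ : Euc n × ℝ → ℝ} (hφ : Continuous φ) {r : ℝ} (hr : 0 < r) {z x : Euc n}
    (hz : dist z x < r) :
    (φ (x, 0) - (volume.real (Metric.ball (0 : Euc n) r) * r)⁻¹ * ∫ p in box z r r, φ p) ^ 2
      ≤ (volume.real (Metric.ball (0 : Euc n) r) * r)⁻¹ *
        ∫ p in box (0 : Euc n) (2 * r) r, (φ (x, 0) - φ (x + p.1, p.2)) ^ 2 := by
  have hb : 0 < (volume : Measure (Euc n)).real (Metric.ball 0 r) :=
    ENNReal.toReal_pos (Metric.measure_ball_pos _ _ hr).ne' measure_ball_lt_top.ne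
  set m := (volume : Measure (Euc n)).real (Metric.ball 0 r) * r with hm
  have hm0 : 0 < m := mul_pos hb hr
  have hmb : ∀ z : Euc n, (volume : Measure (Euc n × ℝ)).real (box z r r) = m := fun z =>
    measureReal_box z r hr
  have : IsFiniteMeasure ((volume : Measure (Euc n × ℝ)).restrict (box z r r)) :=
    ⟨by simpa using measure_box_lt_top z r r⟩
  have hcd : Continuous fun p => φ (x, 0) - φ p := by fun_prop
  have hcd2 : Continuous fun p => (φ (x, 0) - φ p) ^ 2 := by fun_prop
  have h1 : φ (x, 0) - m⁻¹ * ∫ p in box z r r, φ p = m⁻¹ * ∫ p in box z r r, (φ (x, 0) - φ p) := by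
    rw [integral_sub (integrable_const _) (integrableOn_box hφ z r r), setIntegral_const, hmb,
      smul_eq_mul]
    field_simp
  have h2 := sq_integral_le (integrableOn_box hcd z r r) (integrableOn_box hcd2 z r r)
  rw [measureReal_restrict_apply_univ, hmb] at h2
  have h3 : ∫ p in box z r r, (φ (x, 0) - φ p) ^ 2 ≤ ∫ p in box x (2 * r) r, (φ (x, 0) - φ p) ^ 2 := by
    refine setIntegral_mono_set (integrableOn_box hcd2 _ _ _) (ae_of_all _ fun p => sq_nonneg _)
      (LE.le.eventuallyLE ?_)
    exact prod_mono (Metric.ball_subset_ball' (by linarith)) subset_rfl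
  have h4 : ∫ p in box x (2 * r) r, (φ (x, 0) - φ p) ^ 2
      = ∫ p in box (0 : Euc n) (2 * r) r, (φ (x, 0) - φ (x + p.1, p.2)) ^ 2 := by
    have hmp : MeasurePreserving (fun p : Euc n × ℝ => (x, (0 : ℝ)) + p) volume volume := by
      rw [Measure.volume_eq_prod]
      exact measurePreserving_add_left _ _
    have := hmp.setIntegral_preimage_emb (measurableEmbedding_addLeft _)
      (fun p => (φ (x, 0) - φ p) ^ 2) (box x (2 * r) r)
    rw [← this]
    have hpre : (fun p : Euc n × ℝ => (x, (0 : ℝ)) + p) ⁻¹' box x (2 * r) r = box 0 (2 * r) r := by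
      ext p
      simp [box, dist_eq_norm]
    rw [hpre]
    simp only [Prod.add_def, zero_add]
  rw [h1, mul_pow, ← h4]
  calc m⁻¹ ^ 2 * (∫ p in box z r r, (φ (x, 0) - φ p)) ^ 2
      ≤ m⁻¹ ^ 2 * (m * ∫ p in box z r r, (φ (x, 0) - φ p) ^ 2) := by gcongr
    _ = m⁻¹ * ∫ p in box z r r, (φ (x, 0) - φ p) ^ 2 := by field_simp
    _ ≤ _ := by gcongr

/-- The displacement is made in two legs: vertically from (x, 0) to (x, y), paid by ∂_yφ, then
horizontally to (x + h, y), paid by the horizontal gradient at height y. The square of the sum costs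
a factor 2. -/
lemma IsTest.integral_shift_le {φ : Euc n × ℝ → ℝ} (hφ : IsTest (Ω ×ˢ (univ : Set ℝ)) φ) {r y : ℝ}
    (hy : 0 ≤ y) (hyr : y ≤ r) {h : Euc n} (hh : ‖h‖ ≤ 2 * r) :
    ∫ x, (φ (x, 0) - φ (x + h, y)) ^ 2 ∂(baseMeasure Ω)
      ≤ 2 * r * ∫ p, derivY φ p ^ 2 ∂(cylMeasure Ω)
        + 8 * r ^ 2 * ∫ x, ‖gradX φ (x, y)‖ ^ 2 ∂(baseMeasure Ω) := by
  have hc := hφ.continuous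
  have hs : ∀ y, HasCompactSupport fun x => φ (x, y) := hasCompactSupport_slice_left hφ.2.1
  have hsh : HasCompactSupport fun x => φ (x + h, y) :=
    (hs y).comp_homeomorph (Homeomorph.addRight h)
  have hsq : ∀ {g : Euc n → ℝ}, HasCompactSupport g → HasCompactSupport fun x => g x ^ 2 :=
    fun hg => hg.comp_left (g := fun t : ℝ => t ^ 2) (by simp)
  have hi1 : ∀ {μ : Measure (Euc n)} [IsFiniteMeasureOnCompacts μ],
      Integrable (fun x => (φ (x, y) - φ (x, 0)) ^ 2) μ := fun {_} _ =>
    Continuous.integrable_of_hasCompactSupport (by fun_prop) (hsq ((hs y).sub (hs 0)))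
  have hi2 : ∀ {μ : Measure (Euc n)} [IsFiniteMeasureOnCompacts μ],
      Integrable (fun x => (φ (x + h, y) - φ (x, y)) ^ 2) μ := fun {_} _ =>
    Continuous.integrable_of_hasCompactSupport (by fun_prop) (hsq (hsh.sub (hs y)))
  have hi3 : Integrable (fun x => (φ (x, 0) - φ (x + h, y)) ^ 2) (baseMeasure Ω) :=
    Continuous.integrable_of_hasCompactSupport (by fun_prop) (hsq ((hs 0).sub hsh))
  have e1 := hφ.integral_slice_sub_le (Ω := Ω) hy
  have e2 := (hφ.slice y).integral_translate_le h
  have hD : 0 ≤ ∫ p, derivY φ p ^ 2 ∂(cylMeasure Ω) := integral_nonneg fun p => sq_nonneg _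
  have hG : 0 ≤ ∫ x, ‖gradX φ (x, y)‖ ^ 2 ∂(baseMeasure Ω) := integral_nonneg fun p => sq_nonneg _
  have e3 : ∫ x, ‖gradient (fun x => φ (x, y)) x‖ ^ 2 = ∫ x, ‖gradX φ (x, y)‖ ^ 2 ∂(baseMeasure Ω) := by
    rw [integral_base_eq (fun x hx => by rw [hφ.gradX_eq_zero (fun hp => hx hp.1)]; simp)]
    rfl
  rw [e3] at e2
  have e4 : ∫ x, (φ (x + h, y) - φ (x, y)) ^ 2 ∂(baseMeasure Ω)
      ≤ ∫ x, (φ (x + h, y) - φ (x, y)) ^ 2 :=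
    setIntegral_le_integral hi2 (ae_of_all _ fun x => sq_nonneg _)
  have e5 : ∫ x, (φ (x, 0) - φ (x + h, y)) ^ 2 ∂(baseMeasure Ω)
      ≤ ∫ x, (2 * (φ (x, y) - φ (x, 0)) ^ 2 + 2 * (φ (x + h, y) - φ (x, y)) ^ 2)
        ∂(baseMeasure Ω) := by
    refine integral_mono hi3 ((hi1.const_mul 2).add (hi2.const_mul 2)) fun x => ?_
    simp only
    nlinarith [sq_nonneg ((φ (x, y) - φ (x, 0)) - (φ (x + h, y) - φ (x, y)))]
  rw [integral_add (hi1.const_mul 2) (hi2.const_mul 2), integral_const_mul, integral_const_mul] at e5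
  have e6 : ‖h‖ ^ 2 ≤ 4 * r ^ 2 := by nlinarith [norm_nonneg h]
  nlinarith [mul_le_mul_of_nonneg_right e6 hG, mul_le_mul_of_nonneg_right hyr hD]

/-- The trace is approximated by averages over small boxes. -/
lemma IsTest.integral_sub_average_le {φ : Euc n × ℝ → ℝ} (hφ : IsTest (Ω ×ˢ (univ : Set ℝ)) φ)
    (hΩ : Bornology.IsBounded Ω) (hΩm : MeasurableSet Ω) {r : ℝ} (hr : 0 < r)
    {q : SimpleFunc (Euc n) (Euc n)} (hq : ∀ x ∈ Ω, dist (q x) x < r) :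
    ∫ x, (φ (x, 0) - (volume.real (Metric.ball (0 : Euc n) r) * r)⁻¹ *
        ∫ p in box (q x) r r, φ p) ^ 2 ∂(baseMeasure Ω)
      ≤ 2 ^ n * 8 * r * (∫ p, ‖gradX φ p‖ ^ 2 ∂(cylMeasure Ω)
        + ∫ p, derivY φ p ^ 2 ∂(cylMeasure Ω)) := by
  have hc := hφ.continuous
  have hb : 0 < (volume : Measure (Euc n)).real (Metric.ball 0 r) :=
    ENNReal.toReal_pos (Metric.measure_ball_pos _ _ hr).ne' measure_ball_lt_top.ne
  set b := (volume : Measure (Euc n)).real (Metric.ball 0 r) with hbdef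
  set D := ∫ p, derivY φ p ^ 2 ∂(cylMeasure Ω) with hDdef
  have hD : 0 ≤ D := integral_nonneg fun p => sq_nonneg _
  set G : ℝ → ℝ := fun y => ∫ x, ‖gradX φ (x, y)‖ ^ 2 ∂(baseMeasure Ω) with hGdef
  have hG0 : ∀ y, 0 ≤ G y := fun y => integral_nonneg fun x => sq_nonneg _
  have hcs2 := hasCompactSupport_norm_sq hφ.hasCompactSupport_gradX
  have hct2 : Continuous fun p => ‖gradX φ p‖ ^ 2 := hφ.continuous_gradX.norm.pow 2
  have hGi : IntegrableOn G (Ioi 0) := by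
    have := integrable_cyl (Ω := Ω) hct2 hcs2
    rw [cylMeasure_eq] at this
    exact this.integral_prod_right
  have hGt : ∫ p, ‖gradX φ p‖ ^ 2 ∂(cylMeasure Ω) = ∫ y in Ioi (0 : ℝ), G y :=
    integral_cyl_symm hct2 hcs2
  set Q : Set (Euc n × ℝ) := box 0 (2 * r) r with hQ
  set F : Euc n × (Euc n × ℝ) → ℝ := fun z => (φ (z.1, 0) - φ (z.1 + z.2.1, z.2.2)) ^ 2 with hF
  have hFi : Integrable F ((baseMeasure Ω).prod (volume.restrict Q)) := by
    rw [baseMeasure, Measure.prod_restrict]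
    have hFc : Continuous F := by fun_prop
    exact (hFc.continuousOn.integrableOn_compact
      (hΩ.prod (isBounded_box 0 (2 * r) r)).isCompact_closure).mono_set subset_closure
  -- Doubling the radius of the box is the source of the factor 2^n.
  have hvol2 : (volume : Measure (Euc n)).real (Metric.ball 0 (2 * r)) = 2 ^ n * b := by
    rw [hbdef, measureReal_def, measureReal_def, Measure.addHaar_ball_mul_of_pos _ _ two_pos,
      ENNReal.toReal_mul, ENNReal.toReal_ofReal (by positivity), finrank_euclideanSpace_fin]
  have hQint : ∫ p in Q, (2 * r * D + 8 * r ^ 2 * G p.2)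
      = 2 ^ n * b * ∫ y in Ioo (0 : ℝ) r, (2 * r * D + 8 * r ^ 2 * G y) := by
    rw [hQ, box, Measure.volume_eq_prod, ← Measure.prod_restrict,
      integral_fun_snd (fun y => 2 * r * D + 8 * r ^ 2 * G y), smul_eq_mul,
      measureReal_restrict_apply_univ, hvol2]
  have hGr : IntegrableOn G (Ioo 0 r) := hGi.mono_set Ioo_subset_Ioi_self
  have hQi : IntegrableOn (fun p : Euc n × ℝ => 2 * r * D + 8 * r ^ 2 * G p.2) Q := by
    rw [hQ, box, IntegrableOn, Measure.volume_eq_prod, ← Measure.prod_restrict]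
    have : IsFiniteMeasure ((volume : Measure (Euc n)).restrict (Metric.ball 0 (2 * r))) :=
      ⟨by simpa using measure_ball_lt_top⟩
    exact (integrable_const _).add ((hGr.comp_snd _).const_mul _)
  calc ∫ x, (φ (x, 0) - (b * r)⁻¹ * ∫ p in box (q x) r r, φ p) ^ 2 ∂(baseMeasure Ω)
      ≤ ∫ x, ((b * r)⁻¹ * ∫ p in Q, F (x, p)) ∂(baseMeasure Ω) := by
        refine integral_mono_of_nonneg (ae_of_all _ fun x => sq_nonneg _)
          (hFi.integral_prod_left.const_mul _) ?_
        refine (ae_restrict_iff' hΩm).2 (ae_of_all _ fun x hx => ?_)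
        exact sq_sub_average_le hc hr (hq x hx)
    -- After the exchange the displacement p is fixed and the shift estimate applies. Integration
    -- over heights below r and division by the volume b r leave a bound of order r.
    _ = (b * r)⁻¹ * ∫ p in Q, (∫ x, F (x, p) ∂(baseMeasure Ω)) := by
        rw [integral_const_mul, integral_integral_swap hFi]
    _ ≤ (b * r)⁻¹ * ∫ p in Q, (2 * r * D + 8 * r ^ 2 * G p.2) := by
        refine mul_le_mul_of_nonneg_left ?_ (by positivity)
        refine setIntegral_mono_on hFi.integral_prod_right hQi (measurableSet_box _ _ _) ?_
        rintro ⟨h, y⟩ ⟨hh, hy⟩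
        exact hφ.integral_shift_le hy.1.le hy.2.le (by simpa using (mem_ball_zero_iff.1 hh).le)
    _ = 2 ^ n * (2 * r * D + 8 * r * ∫ y in Ioo (0 : ℝ) r, G y) := by
        rw [hQint, integral_add (integrable_const _) (hGr.const_mul _), setIntegral_const,
          integral_const_mul, Real.volume_real_Ioo_of_le hr.le, smul_eq_mul]
        field_simp
        ring
    _ ≤ 2 ^ n * 8 * r * (∫ p, ‖gradX φ p‖ ^ 2 ∂(cylMeasure Ω) + D) := by
        have h1 : ∫ y in Ioo (0 : ℝ) r, G y ≤ ∫ p, ‖gradX φ p‖ ^ 2 ∂(cylMeasure Ω) := by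
          rw [hGt]
          exact setIntegral_mono_set hGi (ae_of_all _ hG0) Ioo_subset_Ioi_self.eventuallyLE
        have h2 : 2 * r * D + 8 * r * ∫ y in Ioo (0 : ℝ) r, G y
            ≤ 8 * r * (∫ p, ‖gradX φ p‖ ^ 2 ∂(cylMeasure Ω) + D) := by
          nlinarith [mul_le_mul_of_nonneg_left h1 hr.le, mul_nonneg hr.le hD]
        calc _ ≤ 2 ^ n * (8 * r * (∫ p, ‖gradX φ p‖ ^ 2 ∂(cylMeasure Ω) + D)) := by gcongr
          _ = _ := by ring

end Averaging

/-! ### Compactness of the trace operator -/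

section TraceCompact

variable {n : ℕ} {Ω : Set (Euc n)}

lemma isFiniteMeasure_baseMeasure (hΩ : Bornology.IsBounded Ω) : IsFiniteMeasure (baseMeasure Ω) :=
  ⟨by simpa [baseMeasure] using hΩ.measure_lt_top⟩

lemma cylMeasure_box_ne_top (z : Euc n) (ρ r : ℝ) : cylMeasure Ω (box z ρ r) ≠ ⊤ :=
  ((Measure.restrict_apply_le _ _).trans_lt (measure_box_lt_top z ρ r)).ne

/-- The average over the part of a box in the half-cylinder. -/
def boxAverage (Ω : Set (Euc n)) (r : ℝ) (z : Euc n) : Lp ℝ 2 (cylMeasure Ω) →L[ℝ] ℝ :=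
  (volume.real (Metric.ball (0 : Euc n) r) * r)⁻¹ •
    innerSL ℝ (indicatorConstLp 2 (measurableSet_box z r r) (cylMeasure_box_ne_top z r r) (1 : ℝ))

/-- The functional sees only the part of the box over Ω; the remaining part contributes nothing
because the test function vanishes there. -/
lemma boxAverage_cylVal (r : ℝ) (z : Euc n) (φ : cylTest Ω) :
    boxAverage Ω r z (cylVal Ω φ) = (volume.real (Metric.ball (0 : Euc n) r) * r)⁻¹ *
      ∫ p in box z r r, φ.1 p := by
  have hφ : IsTest (Ω ×ˢ (univ : Set ℝ)) φ.1 := φ.2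
  have h1 : ⟪indicatorConstLp 2 (measurableSet_box z r r) (cylMeasure_box_ne_top z r r) (1 : ℝ),
      cylVal Ω φ⟫ = ∫ p in box z r r, φ.1 p := by
    rw [L2.inner_indicatorConstLp_one]
    rw [setIntegral_congr_ae (g := φ.1) (measurableSet_box z r r)
      (by filter_upwards [hφ.memLp_cyl.coeFn_toLp] with p hp _ using hp)]
    rw [cylMeasure, Measure.restrict_restrict (measurableSet_box z r r)]
    symm
    refine setIntegral_eq_of_subset_of_forall_sdiff_eq_zero (measurableSet_box z r r)
      inter_subset_left fun p hp => hφ.eq_zero fun h => hp.2 ⟨hp.1, h.1, hp.1.2.1⟩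
  simp [boxAverage, h1]

/-- Averages over boxes indexed by the values of a simple function. -/
def averageOp (hΩ : Bornology.IsBounded Ω) (r : ℝ) (q : SimpleFunc (Euc n) (Euc n)) :
    energySpace Ω →L[ℝ] Lp ℝ 2 (baseMeasure Ω) :=
  have := isFiniteMeasure_baseMeasure hΩ
  ∑ z ∈ q.range, ((boxAverage Ω r z).comp (energyFun Ω)).smulRight
    (indicatorConstLp 2 (q.measurableSet_fiber z) (measure_ne_top (baseMeasure Ω) _) (1 : ℝ))

lemma coeFn_finset_sum {α ι : Type*} [MeasurableSpace α] {μ : Measure α} (s : Finset ι)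
    (F : ι → Lp ℝ 2 μ) : ⇑(∑ i ∈ s, F i) =ᵐ[μ] fun x => ∑ i ∈ s, F i x := by
  classical
  induction s using Finset.induction_on with
  | empty =>
    filter_upwards [Lp.coeFn_zero ℝ 2 μ] with x hx
    simpa using hx
  | insert i s hi ih =>
    rw [Finset.sum_insert hi]
    filter_upwards [Lp.coeFn_add (F i) (∑ i ∈ s, F i), ih] with x h1 h2
    rw [h1, Pi.add_apply, h2, Finset.sum_insert hi]

lemma averageOp_apply (hΩ : Bornology.IsBounded Ω) (r : ℝ) (q : SimpleFunc (Euc n) (Euc n))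
    (k : energySpace Ω) : averageOp hΩ r q k =ᵐ[baseMeasure Ω]
      fun x => boxAverage Ω r (q x) (energyFun Ω k) := by
  have := isFiniteMeasure_baseMeasure hΩ
  have h1 : averageOp hΩ r q k = ∑ z ∈ q.range, boxAverage Ω r z (energyFun Ω k) •
      indicatorConstLp 2 (q.measurableSet_fiber z) (measure_ne_top (baseMeasure Ω) _) (1 : ℝ) := by
    simp [averageOp]
  rw [h1]
  have h2 : ∀ᵐ x ∂(baseMeasure Ω), ∀ z ∈ q.range, (boxAverage Ω r z (energyFun Ω k) •
      indicatorConstLp 2 (q.measurableSet_fiber z) (measure_ne_top (baseMeasure Ω) _) (1 : ℝ) :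
      Lp ℝ 2 (baseMeasure Ω)) x
      = boxAverage Ω r z (energyFun Ω k) * (q ⁻¹' {z}).indicator (fun _ => (1 : ℝ)) x := by
    rw [Finset.eventually_all]
    intro z _
    filter_upwards [Lp.coeFn_smul (boxAverage Ω r z (energyFun Ω k))
      (indicatorConstLp 2 (q.measurableSet_fiber z) (measure_ne_top (baseMeasure Ω) _) (1 : ℝ)),
      indicatorConstLp_coeFn (p := 2) (hs := q.measurableSet_fiber z)
        (hμs := measure_ne_top (baseMeasure Ω) _) (c := (1 : ℝ))] with x h3 h4
    rw [h3, Pi.smul_apply, h4, smul_eq_mul]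
  filter_upwards [coeFn_finset_sum q.range fun z => (boxAverage Ω r z (energyFun Ω k) •
      indicatorConstLp 2 (q.measurableSet_fiber z) (measure_ne_top (baseMeasure Ω) _) (1 : ℝ) :
      Lp ℝ 2 (baseMeasure Ω)), h2] with x h3 h4
  rw [h3, Finset.sum_congr rfl h4, Finset.sum_eq_single (q x)]
  · simp
  · intro z _ hz
    simp [indicator_of_notMem, hz.symm]
  · intro h
    exact absurd (q.mem_range_self x) h

lemma isCompactOperator_sum_smulRight {H W ι : Type*} [NormedAddCommGroup H] [NormedSpace ℝ H]
    [NormedAddCommGroup W] [NormedSpace ℝ W] (s : Finset ι) (ℓ : ι → H →L[ℝ] ℝ) (v : ι → W) :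
    IsCompactOperator (∑ z ∈ s, (ℓ z).smulRight (v z) : H →L[ℝ] W) := by
  classical
  induction s using Finset.induction_on with
  | empty => simpa using isCompactOperator_zero
  | insert i s hi ih =>
    rw [Finset.sum_insert hi]
    refine IsCompactOperator.add ?_ ih
    have h1 : IsCompactOperator (ℓ i) := isCompactOperator_of_locallyCompactSpace_dom (ℓ i)
    exact h1.clm_comp (ContinuousLinearMap.toSpanSingleton ℝ (v i))

lemma isCompactOperator_averageOp (hΩ : Bornology.IsBounded Ω) (r : ℝ)
    (q : SimpleFunc (Euc n) (Euc n)) : IsCompactOperator (averageOp hΩ r q) :=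
  isCompactOperator_sum_smulRight _ _ _

lemma exists_bound_averageOp (hΩ : Bornology.IsBounded Ω) (r : ℝ)
    (q : SimpleFunc (Euc n) (Euc n)) : ∃ M, 0 ≤ M ∧ ∀ k : energySpace Ω,
      ∀ᵐ x ∂(baseMeasure Ω), |averageOp hΩ r q k x| ≤ M * ‖k‖ := by
  refine ⟨∑ z ∈ q.range, ‖(boxAverage Ω r z).comp (energyFun Ω)‖,
    Finset.sum_nonneg fun z _ => ContinuousLinearMap.opNorm_nonneg _, fun k => ?_⟩
  filter_upwards [averageOp_apply hΩ r q k] with x hx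
  rw [hx]
  refine (((boxAverage Ω r (q x)).comp (energyFun Ω)).le_opNorm k).trans ?_
  gcongr
  exact Finset.single_le_sum (f := fun z => ‖(boxAverage Ω r z).comp (energyFun Ω)‖)
    (fun z _ => ContinuousLinearMap.opNorm_nonneg _) (q.mem_range_self x)

/-- Both sides are continuous in k, so it suffices to check the inequality on test functions, where
it is the averaging estimate. -/
lemma IsAdmissible.norm_trace_sub_averageOp_le (h : IsAdmissible Ω) (hΩm : MeasurableSet Ω) {r : ℝ}
    (hr : 0 < r) {q : SimpleFunc (Euc n) (Euc n)} (hq : ∀ x ∈ Ω, dist (q x) x < r)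
    (k : energySpace Ω) :
    ‖energyTrace Ω k - averageOp h.bounded r q k‖ ^ 2 ≤ 2 ^ n * 8 * r * ‖k‖ ^ 2 := by
  refine denseRange_cylEmb.induction_on
    (p := fun k => ‖energyTrace Ω k - averageOp h.bounded r q k‖ ^ 2 ≤ 2 ^ n * 8 * r * ‖k‖ ^ 2) k
    (isClosed_le (by fun_prop) (by fun_prop)) fun φ => ?_
  rw [norm_cylEmb_sq, h.energyTrace_cylEmb, norm_Lp_sq]
  refine le_trans (le_of_eq (integral_congr_ae ?_))
    (IsTest.integral_sub_average_le φ.2 h.bounded hΩm hr hq)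
  filter_upwards [Lp.coeFn_sub (cylTrace Ω φ) (averageOp h.bounded r q (cylEmb Ω φ)),
    averageOp_apply h.bounded r q (cylEmb Ω φ), (IsTest.memLp_trace (Ω := Ω) φ.2).coeFn_toLp]
    with x h1 h2 h3
  rw [h1, Pi.sub_apply, h2, h.energyFun_cylEmb, boxAverage_cylVal, Real.norm_eq_abs, sq_abs]
  exact congrArg (fun t => (t - _) ^ 2) h3

/-- The trace operator is approximated by compact operators whose values are bounded functions. -/
lemma IsAdmissible.exists_averageOp (h : IsAdmissible Ω) (hΩm : MeasurableSet Ω) {ε : ℝ}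
    (hε : 0 < ε) : ∃ P : energySpace Ω →L[ℝ] Lp ℝ 2 (baseMeasure Ω), IsCompactOperator P ∧
      ‖energyTrace Ω - P‖ ≤ ε ∧ ∃ M, 0 ≤ M ∧ ∀ k : energySpace Ω,
      ∀ᵐ x ∂(baseMeasure Ω), |P k x| ≤ M * ‖k‖ := by
  -- This radius turns the factor 2^n · 8 · r of the averaging estimate into ε².
  have hr : 0 < ε ^ 2 / (2 ^ n * 8) := by positivity
  obtain ⟨q, hq⟩ := exists_simpleFunc_dist_lt h.bounded hr
  refine ⟨averageOp h.bounded (ε ^ 2 / (2 ^ n * 8)) q, isCompactOperator_averageOp _ _ _, ?_,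
    exists_bound_averageOp _ _ _⟩
  refine ContinuousLinearMap.opNorm_le_bound _ hε.le fun k => ?_
  refine le_of_sq_le_sq ((h.norm_trace_sub_averageOp_le hΩm hr hq k).trans (le_of_eq ?_))
    (by positivity)
  field_simp

lemma isCompactOperator_of_approx {H W : Type*} [NormedAddCommGroup H] [NormedSpace ℝ H]
    [NormedAddCommGroup W] [NormedSpace ℝ W] [CompleteSpace W] {T : H →L[ℝ] W}
    (h : ∀ ε > 0, ∃ P : H →L[ℝ] W, IsCompactOperator P ∧ ‖T - P‖ ≤ ε) : IsCompactOperator T := by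
  choose P hP hPε using fun j : ℕ => h (1 / ((j : ℝ) + 1)) Nat.one_div_pos_of_nat
  have hlim : Tendsto (fun j => ‖P j - T‖) atTop (𝓝 0) :=
    squeeze_zero (fun j => norm_nonneg _)
      (fun j => by rw [norm_sub_rev]; exact hPε j) tendsto_one_div_add_atTop_nhds_zero_nat
  exact isCompactOperator_of_tendsto (tendsto_iff_norm_sub_tendsto_zero.2 hlim)
    (Eventually.of_forall hP)

theorem IsAdmissible.isCompactOperator_energyTrace (h : IsAdmissible Ω) (hΩm : MeasurableSet Ω) :
    IsCompactOperator (energyTrace Ω) :=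
  isCompactOperator_of_approx fun _ hε =>
    let ⟨P, hP, hPε, _⟩ := h.exists_averageOp hΩm hε
    ⟨P, hP, hPε⟩

end TraceCompact

/-! ### Products of functions on the base with functions of the vertical variable -/

lemma tendsto_eLpNorm_of_dominated {α E : Type*} [MeasurableSpace α] {μ : Measure α}
    [NormedAddCommGroup E] {f : ℕ → α → E} {f' : α → E} {g : α → ℝ}
    (hf : ∀ k, AEStronglyMeasurable (f k) μ) (hf' : AEStronglyMeasurable f' μ) (hg : MemLp g 2 μ)
    (hb : ∀ k, ∀ᵐ x ∂μ, ‖f k x - f' x‖ ≤ g x)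
    (hlim : ∀ᵐ x ∂μ, Tendsto (fun k => f k x) atTop (𝓝 (f' x))) :
    Tendsto (fun k => eLpNorm (fun x => f k x - f' x) 2 μ) atTop (𝓝 0) := by
  have h2 : ∀ k, eLpNorm (fun x => f k x - f' x) 2 μ
      = (∫⁻ x, ‖f k x - f' x‖ₑ ^ (2 : ℝ) ∂μ) ^ ((1 : ℝ) / 2) := fun k => by
    rw [eLpNorm_eq_lintegral_rpow_enorm_toReal two_ne_zero ENNReal.ofNat_ne_top]
    simp
  simp only [h2]
  have hgfin : ∫⁻ x, ‖g x‖ₑ ^ (2 : ℝ) ∂μ ≠ ⊤ := by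
    have := lintegral_rpow_enorm_lt_top_of_eLpNorm_lt_top two_ne_zero ENNReal.ofNat_ne_top hg.2
    simpa using this.ne
  have h3 : Tendsto (fun k => ∫⁻ x, ‖f k x - f' x‖ₑ ^ (2 : ℝ) ∂μ) atTop (𝓝 (∫⁻ _, 0 ∂μ)) := by
    refine tendsto_lintegral_of_dominated_convergence' (fun x => ‖g x‖ₑ ^ (2 : ℝ))
      (fun k => (((hf k).sub hf').enorm.pow_const _)) (fun k => ?_) hgfin ?_
    · filter_upwards [hb k] with x hx
      gcongr
      exact enorm_le_iff_norm_le.2 (hx.trans (le_abs_self _))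
    · filter_upwards [hlim] with x hx
      have h4 : Tendsto (fun k => ‖f k x - f' x‖ₑ) atTop (𝓝 0) := by
        have := (hx.sub_const (f' x)).enorm
        simpa using this
      have := (ENNReal.continuous_rpow_const (y := 2)).tendsto 0 |>.comp h4
      simpa [Function.comp_def] using this
  rw [lintegral_zero] at h3
  have := (ENNReal.continuous_rpow_const (y := (1 : ℝ) / 2)).tendsto 0 |>.comp h3
  simpa [Function.comp_def] using this

section Product

variable {n : ℕ} {Ω : Set (Euc n)}

lemma eLpNorm_prod_smul {α E : Type*} [MeasurableSpace α] {μ : Measure α} {ν : Measure ℝ}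
    [SFinite μ] [SFinite ν] [NormedAddCommGroup E] [NormedSpace ℝ E] {b : ℝ → ℝ} {F : α → E}
    (hb : AEStronglyMeasurable b ν) (hF : AEStronglyMeasurable F μ) :
    eLpNorm (fun p : α × ℝ => b p.2 • F p.1) 2 (μ.prod ν) = eLpNorm F 2 μ * eLpNorm b 2 ν := by
  simp only [eLpNorm_eq_lintegral_rpow_enorm_toReal two_ne_zero ENNReal.ofNat_ne_top,
    ENNReal.toReal_ofNat]
  rw [← ENNReal.mul_rpow_of_nonneg _ _ (by norm_num),
    ← lintegral_prod_mul (hF.enorm.pow_const _) (hb.enorm.pow_const _)]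
  congr 1
  refine lintegral_congr fun p => ?_
  rw [enorm_smul, ENNReal.mul_rpow_of_nonneg _ _ (by norm_num), mul_comm]

lemma MemLp.prod_smul {E : Type*} [NormedAddCommGroup E] [NormedSpace ℝ E]
    {b : ℝ → ℝ} {F : Euc n → E} (hb : MemLp b 2 (volume.restrict (Ioi (0 : ℝ))))
    (hF : MemLp F 2 (baseMeasure Ω)) : MemLp (fun p => b p.2 • F p.1) 2 (cylMeasure Ω) := by
  rw [cylMeasure_eq]
  refine ⟨hb.1.comp_snd.smul hF.1.comp_fst, ?_⟩
  rw [eLpNorm_prod_smul hb.1 hF.1]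
  exact ENNReal.mul_lt_top hF.2 hb.2

lemma tendsto_eLpNorm_prod_smul {E : Type*} [NormedAddCommGroup E] [NormedSpace ℝ E]
    {b : ℕ → ℝ → ℝ} {b' : ℝ → ℝ} {F : ℕ → Euc n → E} {F' : Euc n → E}
    (hb : ∀ k, MemLp (b k) 2 (volume.restrict (Ioi (0 : ℝ))))
    (hb' : MemLp b' 2 (volume.restrict (Ioi (0 : ℝ))))
    (hF : ∀ k, MemLp (F k) 2 (baseMeasure Ω)) (hF' : MemLp F' 2 (baseMeasure Ω))
    (h1 : Tendsto (fun k => eLpNorm (fun y => b k y - b' y) 2 (volume.restrict (Ioi (0 : ℝ))))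
      atTop (𝓝 0))
    (h2 : Tendsto (fun k => eLpNorm (fun x => F k x - F' x) 2 (baseMeasure Ω)) atTop (𝓝 0)) :
    Tendsto (fun k => eLpNorm (fun p => b k p.2 • F k p.1 - b' p.2 • F' p.1) 2 (cylMeasure Ω))
      atTop (𝓝 0) := by
  set N1 : ℕ → ℝ≥0∞ := fun k => eLpNorm (fun y => b k y - b' y) 2 (volume.restrict (Ioi (0 : ℝ)))
  set N2 : ℕ → ℝ≥0∞ := fun k => eLpNorm (fun x => F k x - F' x) 2 (baseMeasure Ω)
  have hlim : Tendsto (fun k => N2 k * N1 k + eLpNorm F' 2 (baseMeasure Ω) * N1 k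
      + N2 k * eLpNorm b' 2 (volume.restrict (Ioi (0 : ℝ)))) atTop (𝓝 0) := by
    have e1 := ENNReal.Tendsto.mul h2 (Or.inr (by simp)) h1 (Or.inr (by simp))
    have e2 := ENNReal.Tendsto.const_mul h1 (Or.inr hF'.2.ne)
    have e3 := ENNReal.Tendsto.mul_const h2 (Or.inr hb'.2.ne)
    simpa using (e1.add e2).add e3
  refine tendsto_of_tendsto_of_tendsto_of_le_of_le tendsto_const_nhds hlim (fun _ => zero_le)
    fun k => ?_
  have hbk := (hb k).sub hb'
  have hFk := (hF k).sub hF'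
  -- The difference is split into three pure products, each with a factor tending to zero, so that
  -- the norms of all three factorize.
  have heq : (fun p : Euc n × ℝ => b k p.2 • F k p.1 - b' p.2 • F' p.1)
      = ((fun p : Euc n × ℝ => (b k - b') p.2 • (F k - F') p.1)
        + (fun p => (b k - b') p.2 • F' p.1)) + fun p => b' p.2 • (F k - F') p.1 := by
    ext1 p
    simp only [Pi.add_apply, Pi.sub_apply, sub_smul, smul_sub]
    abel
  rw [heq]
  have m1 : MemLp (fun p : Euc n × ℝ => (b k - b') p.2 • (F k - F') p.1) 2 (cylMeasure Ω) :=
    MemLp.prod_smul hbk hFk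
  have m2 : MemLp (fun p : Euc n × ℝ => (b k - b') p.2 • F' p.1) 2 (cylMeasure Ω) :=
    MemLp.prod_smul hbk hF'
  have m3 : MemLp (fun p : Euc n × ℝ => b' p.2 • (F k - F') p.1) 2 (cylMeasure Ω) :=
    MemLp.prod_smul hb' hFk
  refine (eLpNorm_add_le (m1.1.add m2.1) m3.1 one_le_two).trans ?_
  refine add_le_add ((eLpNorm_add_le m1.1 m2.1 one_le_two).trans (add_le_add ?_ ?_)) ?_
  · rw [cylMeasure_eq, eLpNorm_prod_smul hbk.1 hFk.1]; exact le_rfl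
  · rw [cylMeasure_eq, eLpNorm_prod_smul hbk.1 hF'.1]; exact le_rfl
  · rw [cylMeasure_eq, eLpNorm_prod_smul hb'.1 hFk.1]; exact le_rfl

/-! #### A smooth cutoff of the exponential -/

lemma exists_abs_deriv_smoothTransition_le : ∃ C, 0 ≤ C ∧ ∀ x, |deriv Real.smoothTransition x| ≤ C := by
  have hc : Continuous (deriv Real.smoothTransition) :=
    (Real.smoothTransition.contDiff (n := 1)).continuous_deriv le_rfl
  obtain ⟨C, hC⟩ := (isCompact_Icc (a := (0 : ℝ)) (b := 1)).exists_bound_of_continuousOn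
    hc.continuousOn
  have hC0 : 0 ≤ C := (norm_nonneg _).trans (hC 0 (by simp))
  refine ⟨C, hC0, fun x => ?_⟩
  rcases lt_or_ge x 0 with hx | hx
  · have : Real.smoothTransition =ᶠ[𝓝 x] fun _ => 0 := by
      filter_upwards [Iio_mem_nhds hx] with z hz using Real.smoothTransition.zero_of_nonpos hz.le
    rw [this.deriv_eq]
    simpa using hC0
  rcases lt_or_ge 1 x with hx1 | hx1
  · have : Real.smoothTransition =ᶠ[𝓝 x] fun _ => 1 := by
      filter_upwards [Ioi_mem_nhds hx1] with z hz using Real.smoothTransition.one_of_one_le hz.le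
    rw [this.deriv_eq]
    simpa using hC0
  · exact hC x ⟨hx, hx1⟩

/-- A smooth function equal to `1` on `[-1, k]` and to `0` off `[-2, k + 1]`. -/
def cutoff (k : ℕ) (y : ℝ) : ℝ :=
  Real.smoothTransition (k + 1 - y) * Real.smoothTransition (y + 2)

/-- A smooth cutoff of `exp (-y / 2)`. -/
def expCutoff (k : ℕ) (y : ℝ) : ℝ := Real.exp (-y / 2) * cutoff k y

lemma contDiff_cutoff (k : ℕ) : ContDiff ℝ ∞ (cutoff k) :=
  (Real.smoothTransition.contDiff.comp (by fun_prop)).mul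
    (Real.smoothTransition.contDiff.comp (by fun_prop))

lemma contDiff_expCutoff (k : ℕ) : ContDiff ℝ ∞ (expCutoff k) :=
  (Real.contDiff_exp.comp (by fun_prop)).mul (contDiff_cutoff k)

lemma cutoff_nonneg (k : ℕ) (y : ℝ) : 0 ≤ cutoff k y :=
  mul_nonneg (Real.smoothTransition.nonneg _) (Real.smoothTransition.nonneg _)

lemma cutoff_le_one (k : ℕ) (y : ℝ) : cutoff k y ≤ 1 :=
  mul_le_one₀ (Real.smoothTransition.le_one _) (Real.smoothTransition.nonneg _)
    (Real.smoothTransition.le_one _)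

lemma cutoff_eq_one {k : ℕ} {y : ℝ} (h0 : -1 ≤ y) (hk : y ≤ k) : cutoff k y = 1 := by
  rw [cutoff, Real.smoothTransition.one_of_one_le (by linarith),
    Real.smoothTransition.one_of_one_le (by linarith), mul_one]

lemma expCutoff_zero (k : ℕ) : expCutoff k 0 = 1 := by
  rw [expCutoff, cutoff_eq_one (by norm_num) (by positivity)]
  simp

lemma hasCompactSupport_expCutoff (k : ℕ) : HasCompactSupport (expCutoff k) := by
  refine HasCompactSupport.intro (isCompact_Icc (a := (-2 : ℝ)) (b := k + 1)) fun y hy => ?_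
  rw [mem_Icc, not_and_or, not_le, not_le] at hy
  rw [expCutoff, cutoff]
  rcases hy with hy | hy
  · rw [Real.smoothTransition.zero_of_nonpos (x := y + 2) (by linarith)]; simp
  · rw [Real.smoothTransition.zero_of_nonpos (x := k + 1 - y) (by linarith)]; simp

lemma exists_abs_deriv_cutoff_le : ∃ C, 0 ≤ C ∧ ∀ k y, |deriv (cutoff k) y| ≤ C := by
  obtain ⟨C, hC0, hC⟩ := exists_abs_deriv_smoothTransition_le
  refine ⟨C + C, by positivity, fun k y => ?_⟩
  have hd : ∀ z, HasDerivAt Real.smoothTransition (deriv Real.smoothTransition z) z := fun z =>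
    ((Real.smoothTransition.contDiff (n := 1)).differentiable one_ne_zero z).hasDerivAt
  have h1 : HasDerivAt (fun y : ℝ => (k : ℝ) + 1 - y) (-1) y := by
    simpa using (hasDerivAt_id y).const_sub ((k : ℝ) + 1)
  have h2 : HasDerivAt (fun y : ℝ => y + 2) 1 y := (hasDerivAt_id y).add_const 2
  have h3 : HasDerivAt (cutoff k) _ y := ((hd _).comp y h1).mul ((hd _).comp y h2)
  rw [h3.deriv]
  refine (abs_add_le _ _).trans (add_le_add ?_ ?_)
  · simp only [abs_mul, abs_neg, abs_one, mul_one]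
    exact (mul_le_of_le_one_right (abs_nonneg _) (by
      rw [abs_of_nonneg (Real.smoothTransition.nonneg _)]
      exact Real.smoothTransition.le_one _)).trans (hC _)
  · simp only [abs_mul, mul_one]
    exact (mul_le_of_le_one_left (abs_nonneg _) (by
      rw [Function.comp_apply, abs_of_nonneg (Real.smoothTransition.nonneg _)]
      exact Real.smoothTransition.le_one _)).trans (hC _)

lemma hasDerivAt_expCutoff (k : ℕ) (y : ℝ) : HasDerivAt (expCutoff k)
    (Real.exp (-y / 2) * (-(1 / 2) * cutoff k y + deriv (cutoff k) y)) y := by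
  have h1 : HasDerivAt (fun y : ℝ => Real.exp (-y / 2)) (Real.exp (-y / 2) * (-1 / 2)) y :=
    ((hasDerivAt_id y).neg.div_const 2).exp
  have h2 : HasDerivAt (cutoff k) (deriv (cutoff k) y) y :=
    ((contDiff_cutoff k).differentiable (by simp) y).hasDerivAt
  refine (h1.mul h2).congr_deriv ?_
  ring

lemma memLp_exp : MemLp (fun y : ℝ => Real.exp (-y / 2)) 2 (volume.restrict (Ioi (0 : ℝ))) := by
  rw [memLp_two_iff_integrable_sq (by fun_prop)]
  have : ∀ y : ℝ, Real.exp (-y / 2) ^ 2 = Real.exp (-y) := fun y => by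
    rw [← Real.exp_nat_mul]; congr 1; push_cast; ring
  simp only [this]
  exact integrableOn_exp_neg_Ioi 0

lemma memLp_expCutoff (k : ℕ) : MemLp (expCutoff k) 2 (volume.restrict (Ioi (0 : ℝ))) :=
  (contDiff_expCutoff k).continuous.memLp_of_hasCompactSupport (hasCompactSupport_expCutoff k)

lemma memLp_deriv_expCutoff (k : ℕ) :
    MemLp (deriv (expCutoff k)) 2 (volume.restrict (Ioi (0 : ℝ))) :=
  ((contDiff_expCutoff k).continuous_deriv (by simp)).memLp_of_hasCompactSupport
    (hasCompactSupport_expCutoff k).deriv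

lemma tendsto_expCutoff : Tendsto (fun k => eLpNorm (fun y => expCutoff k y - Real.exp (-y / 2)) 2
    (volume.restrict (Ioi (0 : ℝ)))) atTop (𝓝 0) := by
  refine tendsto_eLpNorm_of_dominated (fun k => (memLp_expCutoff k).1) memLp_exp.1 memLp_exp
    (fun k => ae_of_all _ fun y => ?_) ?_
  · have : expCutoff k y - Real.exp (-y / 2) = -(Real.exp (-y / 2) * (1 - cutoff k y)) := by
      rw [expCutoff]; ring
    rw [this, norm_neg, Real.norm_eq_abs, abs_of_nonneg
      (mul_nonneg (Real.exp_nonneg _) (by linarith [cutoff_le_one k y]))]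
    exact mul_le_of_le_one_right (Real.exp_nonneg _) (by linarith [cutoff_nonneg k y])
  · refine (ae_restrict_iff' measurableSet_Ioi).2 (ae_of_all _ fun y hy => ?_)
    refine tendsto_const_nhds.congr' ?_
    filter_upwards [eventually_ge_atTop ⌈y⌉₊] with k hk
    rw [expCutoff, cutoff_eq_one (by linarith [mem_Ioi.1 hy]) (Nat.ceil_le.1 hk), mul_one]

lemma tendsto_deriv_expCutoff : Tendsto (fun k =>
    eLpNorm (fun y => deriv (expCutoff k) y - -(1 / 2) * Real.exp (-y / 2)) 2
      (volume.restrict (Ioi (0 : ℝ)))) atTop (𝓝 0) := by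
  obtain ⟨C, hC0, hC⟩ := exists_abs_deriv_cutoff_le
  refine tendsto_eLpNorm_of_dominated (g := fun y => (1 / 2 + C) * Real.exp (-y / 2))
    (fun k => (memLp_deriv_expCutoff k).1) (memLp_exp.const_mul _).1 (memLp_exp.const_mul _)
    (fun k => ae_of_all _ fun y => ?_) ?_
  · rw [(hasDerivAt_expCutoff k y).deriv]
    have : Real.exp (-y / 2) * (-(1 / 2) * cutoff k y + deriv (cutoff k) y)
        - -(1 / 2) * Real.exp (-y / 2)
        = (1 / 2 * (1 - cutoff k y) + deriv (cutoff k) y) * Real.exp (-y / 2) := by ring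
    rw [this, norm_mul, Real.norm_of_nonneg (Real.exp_nonneg _)]
    gcongr
    refine (norm_add_le _ _).trans (add_le_add ?_ (hC k y))
    rw [Real.norm_eq_abs, abs_of_nonneg (by linarith [cutoff_le_one k y])]
    linarith [cutoff_nonneg k y]
  · refine (ae_restrict_iff' measurableSet_Ioi).2 (ae_of_all _ fun y hy => ?_)
    refine tendsto_const_nhds.congr' ?_
    -- The inequality is strict so that the cutoff equals 1 on a neighbourhood of y, which makes its
    -- derivative at y vanish.
    filter_upwards [eventually_gt_atTop ⌈y⌉₊] with k hk
    have hyk : y < k := (Nat.le_ceil y).trans_lt (by exact_mod_cast hk)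
    have h1 : cutoff k =ᶠ[𝓝 y] fun _ => 1 := by
      filter_upwards [Ioo_mem_nhds (mem_Ioi.1 hy) hyk] with z hz
      exact cutoff_eq_one (by linarith [hz.1]) hz.2.le
    rw [(hasDerivAt_expCutoff k y).deriv, h1.deriv_eq, h1.self_of_nhds]
    simp
    ring

end Product

/-! ### Extensions of functions on the base -/

section Extension

variable {n : ℕ} {Ω : Set (Euc n)}

lemma IsTest.prod {φ : Euc n → ℝ} {η : ℝ → ℝ} (hφ : IsTest Ω φ) (hη : ContDiff ℝ ∞ η)
    (hc : HasCompactSupport η) :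
    IsTest (Ω ×ˢ (univ : Set ℝ)) fun p : Euc n × ℝ => η p.2 * φ p.1 := by
  have hs : tsupport (fun p : Euc n × ℝ => η p.2 * φ p.1) ⊆ tsupport φ ×ˢ tsupport η := by
    refine closure_minimal (fun p hp => ?_) ((isClosed_tsupport φ).prod (isClosed_tsupport η))
    exact ⟨subset_tsupport φ (right_ne_zero_of_mul hp), subset_tsupport η (left_ne_zero_of_mul hp)⟩
  refine ⟨(hη.comp contDiff_snd).mul (hφ.1.comp contDiff_fst), ?_, fun p hp =>
    ⟨hφ.2.2 (hs hp).1, mem_univ _⟩⟩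
  exact HasCompactSupport.of_support_subset_isCompact (hφ.2.1.prod hc)
    ((subset_tsupport _).trans hs)

lemma gradX_prod {φ : Euc n → ℝ} (hφ : Differentiable ℝ φ) (η : ℝ → ℝ) :
    gradX (fun p : Euc n × ℝ => η p.2 * φ p.1) = fun p => η p.2 • gradient φ p.1 := by
  ext1 p
  exact congrFun (gradient_smul (η p.2) hφ) p.1

lemma derivY_prod (φ : Euc n → ℝ) {η : ℝ → ℝ} (hη : Differentiable ℝ η) :
    derivY (fun p : Euc n × ℝ => η p.2 * φ p.1) = fun p => deriv η p.2 * φ p.1 := by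
  ext1 p
  exact deriv_mul_const (d := φ p.1) (hη p.2)

/-- The extension `(x, y) ↦ exp (-y / 2) u x` of a function in `H^1_0(Ω)`. -/
def IsH01.extSpace {u : Euc n → ℝ} {g : Euc n → Euc n} (h : IsH01 Ω u g) : ExtSpace Ω := by
  have hd : MemLp (fun y : ℝ => -(1 / 2) * Real.exp (-y / 2)) 2 (volume.restrict (Ioi (0 : ℝ))) :=
    memLp_exp.const_mul _
  have m1 : MemLp (fun p => Real.exp (-p.2 / 2) * u p.1) 2 (cylMeasure Ω) :=
    MemLp.prod_smul (F := u) memLp_exp h.memLp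
  have m2 : MemLp (fun p => Real.exp (-p.2 / 2) • g p.1) 2 (cylMeasure Ω) :=
    MemLp.prod_smul memLp_exp h.memLp_grad
  have m3 : MemLp (fun p => (-(1 / 2) * Real.exp (-p.2 / 2)) * u p.1) 2 (cylMeasure Ω) :=
    MemLp.prod_smul (F := u) hd h.memLp
  have ha : ∃ φ : ℕ → Euc n × ℝ → ℝ, (∀ k, IsTest (Ω ×ˢ (univ : Set ℝ)) (φ k)) ∧
      Tendsto (fun k => eLpNorm (fun p => φ k p - Real.exp (-p.2 / 2) * u p.1) 2 (cylMeasure Ω))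
        atTop (𝓝 0) ∧
      Tendsto (fun k => eLpNorm (fun p => gradX (φ k) p - Real.exp (-p.2 / 2) • g p.1) 2
        (cylMeasure Ω)) atTop (𝓝 0) ∧
      Tendsto (fun k => eLpNorm (fun p => derivY (φ k) p
        - (-(1 / 2) * Real.exp (-p.2 / 2)) * u p.1) 2 (cylMeasure Ω)) atTop (𝓝 0) ∧
      Tendsto (fun k => eLpNorm (fun x => φ k (x, 0) - u x) 2 (baseMeasure Ω)) atTop (𝓝 0) := by
    -- The same index drives the vertical cutoff and the horizontal approximation. Since the cutoff
    -- exponential is 1 at height zero, the traces are exactly the approximating test functions on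
    -- Ω.
    obtain ⟨φ, hφ, h1, h2⟩ := h.approx
    refine ⟨fun k p => expCutoff k p.2 * φ k p.1, fun k =>
      (hφ k).prod (contDiff_expCutoff k) (hasCompactSupport_expCutoff k), ?_, ?_, ?_, ?_⟩
    · have := tendsto_eLpNorm_prod_smul memLp_expCutoff memLp_exp (fun k => (hφ k).memLp) h.memLp
        tendsto_expCutoff h1
      simpa only [smul_eq_mul] using this
    · have := tendsto_eLpNorm_prod_smul memLp_expCutoff memLp_exp (fun k => (hφ k).memLp_gradient)
        h.memLp_grad tendsto_expCutoff h2
      refine this.congr fun k => ?_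
      rw [gradX_prod (hφ k).differentiable]
    · have := tendsto_eLpNorm_prod_smul memLp_deriv_expCutoff hd (fun k => (hφ k).memLp) h.memLp
        tendsto_deriv_expCutoff h1
      refine this.congr fun k => ?_
      rw [derivY_prod _ ((contDiff_expCutoff k).differentiable (by simp))]
      rfl
    · simpa only [expCutoff_zero, one_mul] using h1
  refine ⟨fun p => Real.exp (-p.2 / 2) * u p.1, fun p => Real.exp (-p.2 / 2) • g p.1,
    fun p => (-(1 / 2) * Real.exp (-p.2 / 2)) * u p.1, u, m1, m2, m3, h.memLp, ?_, ha⟩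
  obtain ⟨φ, hφ, h2, h3, h4, -⟩ := ha
  exact isWeakGradientCyl_of_tendsto m1 m2 m3 hφ h2 h3 h4

lemma integral_exp_neg_half_sq : ∫ y in Ioi (0 : ℝ), Real.exp (-y / 2) ^ 2 = 1 := by
  have : ∀ y : ℝ, Real.exp (-y / 2) ^ 2 = Real.exp (-y) := fun y => by
    rw [← Real.exp_nat_mul]; congr 1; push_cast; ring
  simp only [this]
  exact integral_exp_neg_Ioi_zero

/-- The vertical factor integrates to ∫ e^{-y} dy = 1, and differentiating e^{-y/2} in y produces
the factor ¼. -/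
lemma IsH01.phi_extSpace {u : Euc n → ℝ} {g : Euc n → Euc n} (h : IsH01 Ω u g) :
    Phi h.extSpace = 1 / 2 * (∫ x, ‖g x‖ ^ 2 ∂(baseMeasure Ω)
      + 1 / 4 * ∫ x, u x ^ 2 ∂(baseMeasure Ω)) := by
  have h1 : h.extSpace.form h.extSpace
      = ∫ p, (‖g p.1‖ ^ 2 + 1 / 4 * u p.1 ^ 2) * Real.exp (-p.2 / 2) ^ 2 ∂(cylMeasure Ω) := by
    refine integral_congr_ae (ae_of_all _ fun p => ?_)
    simp only [IsH01.extSpace, real_inner_self_eq_norm_sq, norm_smul, mul_pow, Real.norm_eq_abs,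
      sq_abs]
    ring
  have hi1 : Integrable (fun x => ‖g x‖ ^ 2) (baseMeasure Ω) := h.memLp_grad.integrable_norm_pow two_ne_zero
  have hi2 : Integrable (fun x => u x ^ 2) (baseMeasure Ω) := h.memLp.integrable_sq
  rw [Phi, h1, cylMeasure_eq, integral_prod_mul (fun x => ‖g x‖ ^ 2 + 1 / 4 * u x ^ 2)
    (fun y => Real.exp (-y / 2) ^ 2), integral_exp_neg_half_sq, mul_one,
    integral_add hi1 (hi2.const_mul _), integral_const_mul]

/-- The lift of test functions on `Ω` to the half-cylinder. -/
def liftTest (Ω : Set (Euc n)) : testSubmodule Ω →ₗ[ℝ] cylTest Ω where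
  toFun φ := ⟨fun p => expCutoff 0 p.2 * φ.1 p.1,
    IsTest.prod φ.2 (contDiff_expCutoff 0) (hasCompactSupport_expCutoff 0)⟩
  map_add' φ ψ := by
    ext p
    exact mul_add _ _ _
  map_smul' c φ := by
    ext p
    exact mul_left_comm _ _ _

/-- The lift as an operator between the energy spaces. -/
def energyLift (Ω : Set (Euc n)) : baseSpace Ω →L[ℝ] energySpace Ω :=
  ((cylEmb Ω).comp (liftTest Ω)).extendOfNorm (baseEmb Ω)

lemma IsAdmissible.norm_liftTest_le (h : IsAdmissible Ω) :
    ∃ C, ∀ φ, ‖(cylEmb Ω).comp (liftTest Ω) φ‖ ≤ C * ‖baseEmb Ω φ‖ := by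
  obtain ⟨C, hC⟩ := h.norm_baseVal_le
  set A := ∫ y in Ioi (0 : ℝ), expCutoff 0 y ^ 2
  set B := ∫ y in Ioi (0 : ℝ), deriv (expCutoff 0) y ^ 2
  have hA : 0 ≤ A := integral_nonneg fun y => sq_nonneg _
  have hB : 0 ≤ B := integral_nonneg fun y => sq_nonneg _
  refine ⟨√(A + B * C ^ 2), fun φ => le_of_sq_le_sq ?_ (by positivity)⟩
  have h1 : ∫ p, ‖gradX (liftTest Ω φ).1 p‖ ^ 2 ∂(cylMeasure Ω) = ‖baseEmb Ω φ‖ ^ 2 * A := by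
    rw [norm_baseEmb_sq, ← integral_prod_mul, cylMeasure_eq]
    refine integral_congr_ae (ae_of_all _ fun p => ?_)
    simp only
    rw [show gradX (liftTest Ω φ).1 = _ from gradX_prod (IsTest.differentiable φ.2) _]
    simp only [norm_smul, mul_pow, Real.norm_eq_abs, sq_abs]
    ring
  have h2 : ∫ p, derivY (liftTest Ω φ).1 p ^ 2 ∂(cylMeasure Ω) = ‖baseVal Ω φ‖ ^ 2 * B := by
    rw [norm_baseVal_sq, ← integral_prod_mul, cylMeasure_eq]
    refine integral_congr_ae (ae_of_all _ fun p => ?_)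
    simp only
    rw [show derivY (liftTest Ω φ).1 = _ from
      derivY_prod _ ((contDiff_expCutoff 0).differentiable (by simp))]
    ring
  rw [LinearMap.comp_apply, norm_cylEmb_sq, h1, h2, mul_pow, Real.sq_sqrt (by positivity)]
  have h3 : ‖baseVal Ω φ‖ ^ 2 ≤ C ^ 2 * ‖baseEmb Ω φ‖ ^ 2 := by
    rw [← mul_pow]; exact pow_le_pow_left₀ (norm_nonneg _) (hC φ) 2
  nlinarith [mul_le_mul_of_nonneg_left h3 hB]

lemma IsAdmissible.energyLift_baseEmb (h : IsAdmissible Ω) (φ : testSubmodule Ω) :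
    energyLift Ω (baseEmb Ω φ) = cylEmb Ω (liftTest Ω φ) :=
  LinearMap.extendOfNorm_eq denseRange_baseEmb h.norm_liftTest_le φ

lemma cylTrace_liftTest (φ : testSubmodule Ω) : cylTrace Ω (liftTest Ω φ) = baseVal Ω φ := by
  refine MemLp.toLp_congr (IsTest.memLp_trace (liftTest Ω φ).2) (IsTest.memLp φ.2)
    (ae_of_all _ fun x => ?_)
  change expCutoff 0 0 * φ.1 x = φ.1 x
  rw [expCutoff_zero, one_mul]

lemma ext_of_denseRange {M W Y : Type*} [TopologicalSpace W] [TopologicalSpace Y] [T2Space Y]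
    {e : M → W} (he : DenseRange e) {a b : W → Y} (ha : Continuous a) (hb : Continuous b)
    (h : ∀ m, a (e m) = b (e m)) (k : W) : a k = b k :=
  congrFun (he.equalizer ha hb (funext h)) k

/-- The embedding of H^1_0 in L² thereby factors through the trace operator, so compactness of the
trace also yields Rellich's theorem on Ω. -/
lemma IsAdmissible.energyTrace_energyLift (h : IsAdmissible Ω) (v : baseSpace Ω) :
    energyTrace Ω (energyLift Ω v) = baseFun Ω v :=
  ext_of_denseRange denseRange_baseEmb ((energyTrace Ω).continuous.comp (energyLift Ω).continuous)
    (baseFun Ω).continuous (fun φ => by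
      rw [Function.comp_apply, h.energyLift_baseEmb, h.energyTrace_cylEmb, cylTrace_liftTest, h.baseFun_baseEmb]) v

lemma isCompactOperator_of_factor {U V W : Type*} [NormedAddCommGroup U] [NormedSpace ℝ U]
    [NormedAddCommGroup V] [NormedSpace ℝ V] [NormedAddCommGroup W] [NormedSpace ℝ W]
    {T : V →L[ℝ] W} (hT : IsCompactOperator T) (L : U →L[ℝ] V) {S : U →L[ℝ] W}
    (h : ∀ u, T (L u) = S u) : IsCompactOperator S := by
  have : (S : U → W) = T ∘ L := funext fun u => (h u).symm
  rw [this]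
  exact hT.comp_clm L

end Extension

/-! ### Spectral decomposition -/

section Abstract

variable {L : Type*} [NormedAddCommGroup L] [InnerProductSpace ℝ L]

open Module.End in
/-- An injective compact symmetric operator has a total orthonormal family of eigenvectors. -/
lemma exists_orthonormal_eigenvectors [CompleteSpace L] {S : L →L[ℝ] L} (hS : IsCompactOperator S)
    (hsym : S.toLinearMap.IsSymmetric) (hinj : ∀ x, S x = 0 → x = 0) :
    ∃ (ι : Type) (e : ι → L) (m : ι → ℝ), Orthonormal ℝ e ∧ (∀ i, S (e i) = m i • e i) ∧
      ∀ x, (∀ i, ⟪e i, x⟫ = 0) → x = 0 := by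
  -- Eigenspaces for nonzero eigenvalues are finite-dimensional by compactness, and injectivity
  -- rules out the eigenvalue zero, so orthonormal bases of these eigenspaces exhaust the spectrum.
  have hfin : ∀ μ : {μ : ℝ // μ ≠ 0}, FiniteDimensional ℝ (eigenspace S.toLinearMap μ.1) :=
    fun μ => ContinuousLinearMap.finite_dimensional_eigenspace hS μ.1 μ.2
  have hV := hsym.orthogonalFamily_eigenspaces.comp
    (Subtype.val_injective (p := fun μ : ℝ => μ ≠ 0))
  refine ⟨Σ μ : {μ : ℝ // μ ≠ 0}, Fin (Module.finrank ℝ (eigenspace S.toLinearMap μ.1)),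
    fun a => (stdOrthonormalBasis ℝ (eigenspace S.toLinearMap a.1.1) a.2 : L), fun a => a.1.1,
    hV.orthonormal_sigma_orthonormal fun μ => (stdOrthonormalBasis ℝ _).orthonormal, ?_, ?_⟩
  · intro a
    exact mem_eigenspace_iff.1 (stdOrthonormalBasis ℝ (eigenspace S.toLinearMap a.1.1) a.2).2
  · intro x hx
    have h1 : x ∈ (⨆ μ, eigenspace S.toLinearMap μ)ᗮ := by
      rw [← Submodule.iInf_orthogonal, Submodule.mem_iInf]
      intro μ
      rw [Submodule.mem_orthogonal]
      intro u hu
      rcases eq_or_ne μ 0 with rfl | hμ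
      · have : u = 0 := hinj u (by simpa using mem_eigenspace_iff.1 hu)
        rw [this, inner_zero_left]
      · have := hfin ⟨μ, hμ⟩
        have h2 := (stdOrthonormalBasis ℝ (eigenspace S.toLinearMap μ)).sum_repr ⟨u, hu⟩
        have h3 : u = ∑ i, (stdOrthonormalBasis ℝ (eigenspace S.toLinearMap μ)).repr ⟨u, hu⟩ i •
            (stdOrthonormalBasis ℝ (eigenspace S.toLinearMap μ) i : L) := by
          conv_lhs => rw [← Subtype.coe_mk u hu, ← h2]
          simp
        rw [h3, sum_inner]
        refine Finset.sum_eq_zero fun i _ => ?_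
        rw [inner_smul_left, hx ⟨⟨μ, hμ⟩, i⟩, mul_zero]
    rw [ContinuousLinearMap.orthogonalComplement_iSup_eigenspaces_eq_bot hS hsym] at h1
    exact (Submodule.mem_bot ℝ).1 h1

/-- A compact operator has finitely many eigenvalues off a neighbourhood of zero, counted with
multiplicity. -/
lemma finite_setOf_le_of_isCompactOperator {ι : Type*} {S : L →L[ℝ] L} (hS : IsCompactOperator S)
    {e : ι → L} {m : ι → ℝ} (he : Orthonormal ℝ e) (hSe : ∀ i, S (e i) = m i • e i) {δ : ℝ}
    (hδ : 0 < δ) : {i | δ ≤ m i}.Finite := by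
  by_contra hinf
  set a := Set.Infinite.natEmbedding _ hinf
  obtain ⟨K, hK, hKs⟩ := hS.image_closedBall_subset_compact 1
  obtain ⟨y, -, φ, hφ, hlim⟩ := hK.tendsto_subseq (x := fun j => S (e (a j)))
    fun j => hKs ⟨_, by simp [he.1], rfl⟩
  obtain ⟨N, hN⟩ := Metric.cauchySeq_iff'.1 hlim.cauchySeq δ hδ
  have h1 := hN (N + 1) (Nat.le_succ N)
  set i := (a (φ (N + 1))).1
  set j := (a (φ N)).1
  have hij : i ≠ j := fun h => (hφ (Nat.lt_succ_self N)).ne' (a.injective (Subtype.ext h))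
  have hi : δ ≤ m i := (a (φ (N + 1))).2
  -- Images of distinct orthonormal eigenvectors with eigenvalues at least δ stay at distance at
  -- least δ, so their sequence has no Cauchy subsequence.
  have h2 : ‖m i • e i - m j • e j‖ ^ 2 = m i ^ 2 + m j ^ 2 := by
    rw [norm_sub_sq_real, norm_smul, norm_smul, he.1, he.1, inner_smul_left, inner_smul_right,
      he.2 hij]
    simp
  have h3 : ‖m i • e i - m j • e j‖ < δ := by
    rw [← hSe, ← hSe, ← dist_eq_norm]
    exact h1
  nlinarith [norm_nonneg (m i • e i - m j • e j), sq_nonneg (m j)]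

/-- Simultaneous diagonalization of the forms `⟪v, z⟫` and `⟪J v, J z⟫`. -/
theorem exists_spectral_basis [CompleteSpace L] {V : Type*} [NormedAddCommGroup V] [InnerProductSpace ℝ V]
    [CompleteSpace V] {J : V →L[ℝ] L} (hJ : IsCompactOperator J) (hd : DenseRange J)
    (hL : ¬ FiniteDimensional ℝ L) :
    ∃ (v : ℕ → V) (Λ : ℕ → ℝ), (∀ j, 0 < Λ j) ∧ Orthonormal ℝ (fun j => J (v j)) ∧
      (∀ x, (∀ j, ⟪J (v j), x⟫ = 0) → x = 0) ∧
      (∀ j z, ⟪v j, z⟫ = Λ j * ⟪J (v j), J z⟫) ∧ ∃ j₀, ∀ j, Λ j₀ ≤ Λ j := by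
  -- The operator J J* is compact, symmetric and, J having dense range, injective. An eigenvector e
  -- of eigenvalue m gives v = m⁻¹ J* e with J v = e and ⟪v, z⟫ = m⁻¹ ⟪e, J z⟫; hence Λ = 1/m.
  set S : L →L[ℝ] L := J ∘L J.adjoint
  have hS : IsCompactOperator S := hJ.comp_clm _
  have hSinner : ∀ x y, ⟪S x, y⟫ = ⟪J.adjoint x, J.adjoint y⟫ := fun x y => by
    rw [ContinuousLinearMap.adjoint_inner_right]; rfl
  have hsym : S.toLinearMap.IsSymmetric := fun x y =>
    (hSinner x y).trans ((real_inner_comm _ _).trans ((hSinner y x).symm.trans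
      (real_inner_comm _ _)))
  have hadj : ∀ x, J.adjoint x = 0 → x = 0 := fun x hx => by
    have h0 : ∀ y, ⟪x, y⟫ = (0 : ℝ) := ext_of_denseRange hd (by fun_prop) continuous_const
      fun z => by rw [← ContinuousLinearMap.adjoint_inner_left, hx, inner_zero_left]
    exact inner_self_eq_zero.1 (h0 x)
  have hinj : ∀ x, S x = 0 → x = 0 := fun x hx => hadj x (by
    have := hSinner x x
    rw [hx, inner_zero_left] at this
    exact inner_self_eq_zero.1 this.symm)
  obtain ⟨ι, e, m, he, hSe, htot⟩ := exists_orthonormal_eigenvectors hS hsym hinj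
  have hm : ∀ i, 0 < m i := fun i => by
    have h1 : m i = ‖J.adjoint (e i)‖ ^ 2 := by
      rw [← real_inner_self_eq_norm_sq, ← hSinner, hSe, inner_smul_left, real_inner_self_eq_norm_sq,
        he.1]
      simp
    have h2 : J.adjoint (e i) ≠ 0 := fun h => he.ne_zero i (hadj _ h)
    rw [h1]
    positivity
  have hfin : ∀ {δ : ℝ}, 0 < δ → {i | δ ≤ m i}.Finite := fun hδ =>
    finite_setOf_le_of_isCompactOperator hS he hSe hδ
  have hcount : Countable ι := by
    rw [← countable_univ_iff]
    have : (univ : Set ι) = ⋃ k : ℕ, {i | 1 / ((k : ℝ) + 1) ≤ m i} := by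
      refine (eq_univ_of_forall fun i => ?_).symm
      obtain ⟨k, hk⟩ := exists_nat_one_div_lt (hm i)
      exact mem_iUnion.2 ⟨k, hk.le⟩
    rw [this]
    exact countable_iUnion fun k => (hfin (by positivity)).countable
  have hinf : Infinite ι := by
    by_contra hn
    rw [not_infinite_iff_finite] at hn
    refine hL (Module.finite_def.2 ⟨(finite_range e).toFinset, ?_⟩)
    rw [Finite.coe_toFinset]
    have : FiniteDimensional ℝ (Submodule.span ℝ (range e)) :=
      FiniteDimensional.span_of_finite ℝ (finite_range e)
    rw [← Submodule.orthogonal_eq_bot_iff, Submodule.eq_bot_iff]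
    exact fun x hx => htot x fun i => hx _ (Submodule.subset_span (mem_range_self i))
  -- Only finitely many indices have eigenvalue at least m i₁, so a largest eigenvalue of J J*
  -- exists; it corresponds to the least Λ.
  obtain ⟨i₀, hi₀⟩ : ∃ i₀, ∀ i, m i ≤ m i₀ := by
    obtain ⟨i₁⟩ : Nonempty ι := inferInstance
    obtain ⟨i₀, hi₀, hmax⟩ := Set.exists_max_image _ m (hfin (hm i₁)) ⟨i₁, le_refl (m i₁)⟩
    refine ⟨i₀, fun i => ?_⟩
    rcases le_total (m i₁) (m i) with h | h
    · exact hmax i h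
    · exact h.trans hi₀
  obtain ⟨E⟩ : Nonempty (ℕ ≃ ι) := by
    have := Encodable.ofCountable ι
    exact ⟨(Denumerable.ofEncodableOfInfinite ι).eqv.symm⟩
  have hJv : ∀ i, J ((m i)⁻¹ • J.adjoint (e i)) = e i := fun i => by
    rw [map_smul, show J (J.adjoint (e i)) = m i • e i from hSe i, smul_smul,
      inv_mul_cancel₀ (hm i).ne', one_smul]
  refine ⟨fun j => (m (E j))⁻¹ • J.adjoint (e (E j)), fun j => (m (E j))⁻¹,
    fun j => inv_pos.2 (hm _), ?_, ?_, ?_, E.symm i₀, fun j => ?_⟩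
  · simp only [hJv]
    exact he.comp _ E.injective
  · simp only [hJv]
    exact fun x hx => htot x fun i => by simpa using hx (E.symm i)
  · intro j z
    rw [hJv, inner_smul_left, ContinuousLinearMap.adjoint_inner_left]
    rfl
  · simp only [Equiv.apply_symm_apply]
    exact inv_anti₀ (hm _) (hi₀ _)

end Abstract

/-! ### Dirichlet eigenfunctions and the first eigenvalue -/

section Dirichlet

variable {n : ℕ} {Ω : Set (Euc n)}

/-- Infinitely many disjoint nonempty open subsets of Ω have orthogonal nonzero indicators. This
lets the eigenbasis be indexed by the natural numbers, as `MemH0Half` demands. -/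
lemma not_finiteDimensional_lp (hn : 0 < n) (hΩ : IsOpen Ω) (hne : Ω.Nonempty)
    (hb : Bornology.IsBounded Ω) : ¬ FiniteDimensional ℝ (Lp ℝ 2 (baseMeasure Ω)) := by
  obtain ⟨x, hx⟩ := hne
  have : Nonempty (Fin n) := ⟨⟨0, hn⟩⟩
  have : Infinite Ω := (infinite_of_mem_nhds x (hΩ.mem_nhds hx)).to_subtype
  obtain ⟨U, hUi, hUo, hUd⟩ := exists_seq_infinite_isOpen_pairwise_disjoint (X := Ω)
  set W : ℕ → Set (Euc n) := fun k => (↑) '' U k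
  have hWo : ∀ k, IsOpen (W k) := fun k => hΩ.isOpenMap_subtype_val _ (hUo k)
  have hWs : ∀ k, W k ⊆ Ω := fun k => Subtype.coe_image_subset _ _
  have hμ : ∀ k, baseMeasure Ω (W k) = volume (W k) := fun k => by
    rw [baseMeasure, Measure.restrict_apply (hWo k).measurableSet, inter_eq_left.2 (hWs k)]
  have hfin : ∀ k, baseMeasure Ω (W k) ≠ ⊤ := fun k => by
    rw [hμ]; exact (hb.subset (hWs k)).measure_lt_top.ne
  have hpos : ∀ k, 0 < (baseMeasure Ω).real (W k) := fun k => by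
    refine ENNReal.toReal_pos ?_ (hfin k)
    rw [hμ]
    exact ((hWo k).measure_pos volume ((hUi k).nonempty.image _)).ne'
  intro hfd
  have hli : LinearIndependent ℝ fun k =>
      indicatorConstLp 2 (hWo k).measurableSet (hfin k) (1 : ℝ) := by
    refine linearIndependent_of_ne_zero_of_inner_eq_zero (fun k h0 => ?_) fun i j hij => ?_
    · have := L2.real_inner_indicatorConstLp_one_indicatorConstLp_one (hWo k).measurableSet
        (hWo k).measurableSet (hfin k) (hfin k)
      rw [h0, inner_zero_left, inter_self] at this
      exact (hpos k).ne this
    · refine (L2.real_inner_indicatorConstLp_one_indicatorConstLp_one (hWo i).measurableSet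
        (hWo j).measurableSet (hfin i) (hfin j)).trans ?_
      have : W i ∩ W j = ∅ := by
        rw [← disjoint_iff_inter_eq_empty]
        exact (disjoint_image_iff Subtype.val_injective).2 (hUd hij)
      rw [this]
      simp
  have := hli.finite
  exact not_finite ℕ


lemma inner_baseEmb (v : baseSpace Ω) (φ : testSubmodule Ω) :
    ⟪v, baseEmb Ω φ⟫ = ∫ x, ⟪v.1 x, gradient φ.1 x⟫ ∂(baseMeasure Ω) := by
  refine (L2.inner_def _ _).trans (integral_congr_ae ?_)
  filter_upwards [(IsTest.memLp_gradient φ.2).coeFn_toLp] with x hx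
  exact congrArg _ hx

lemma inner_baseVal (u : Lp ℝ 2 (baseMeasure Ω)) (φ : testSubmodule Ω) :
    ⟪u, baseVal Ω φ⟫ = ∫ x, u x * φ.1 x ∂(baseMeasure Ω) := by
  refine (L2.inner_def _ _).trans (integral_congr_ae ?_)
  filter_upwards [(IsTest.memLp φ.2).coeFn_toLp] with x hx
  exact (congrArg _ hx).trans (mul_comm _ _)

lemma IsAdmissible.isDirichletEigenfunction (h : IsAdmissible Ω) {v : baseSpace Ω} {μ : ℝ}
    (hv : baseFun Ω v ≠ 0) (hμ : ∀ z, ⟪v, z⟫ = μ * ⟪baseFun Ω v, baseFun Ω z⟫) :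
    IsDirichletEigenfunction Ω μ (baseFun Ω v) := by
  refine ⟨fun h0 => hv (Lp.ext (h0.trans (Lp.coeFn_zero _ _ _).symm)), v.1,
    h.isH01 v (ae_eq_refl _), fun φ hφ => ?_⟩
  have := hμ (baseEmb Ω ⟨φ, hφ⟩)
  rwa [inner_baseEmb, h.baseFun_baseEmb, inner_baseVal] at this

lemma IsAdmissible.exists_of_isDirichletEigenfunction (h : IsAdmissible Ω) {u : Euc n → ℝ} {μ : ℝ}
    (hu : IsDirichletEigenfunction Ω μ u) : ∃ v : baseSpace Ω, baseFun Ω v ≠ 0 ∧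
      ∀ z, ⟪v, z⟫ = μ * ⟪baseFun Ω v, baseFun Ω z⟫ := by
  obtain ⟨hu0, g, hg, hug⟩ := hu
  obtain ⟨v, hvg, hvu⟩ := h.exists_of_isH01 hg
  refine ⟨v, fun h0 => hu0 (hvu.symm.trans (h0 ▸ Lp.coeFn_zero _ _ _)), ?_⟩
  refine ext_of_denseRange denseRange_baseEmb (by fun_prop) (by fun_prop) fun φ => ?_
  rw [inner_baseEmb, h.baseFun_baseEmb, inner_baseVal]
  refine Eq.trans (integral_congr_ae ?_) ((hug φ.1 φ.2).trans
    (congrArg (μ * ·) (integral_congr_ae ?_)))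
  · filter_upwards [hvg] with x hx using by rw [hx]
  · filter_upwards [hvu] with x hx using by rw [hx]

/-- An L² function orthogonal to all test functions vanishes almost everywhere, by the fundamental
lemma of the calculus of variations. -/
lemma IsAdmissible.denseRange_baseFun (h : IsAdmissible Ω) (hΩ : IsOpen Ω) :
    DenseRange (baseFun Ω) := by
  have h1 : (LinearMap.range (baseFun Ω).toLinearMap).topologicalClosure = ⊤ := by
    rw [Submodule.topologicalClosure_eq_top_iff, Submodule.eq_bot_iff]
    intro x hx
    have := isFiniteMeasure_baseMeasure h.bounded
    have hi : IntegrableOn x Ω volume := (Lp.memLp x).integrable one_le_two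
    have h2 : ∀ᵐ y ∂volume, y ∈ Ω → x y = 0 := by
      refine hΩ.ae_eq_zero_of_integral_contDiff_smul_eq_zero hi.locallyIntegrableOn
        fun g hg hgc hgs => ?_
      have ht : IsTest Ω g := ⟨hg, hgc, hgs⟩
      have h3 : ⟪baseFun Ω (baseEmb Ω ⟨g, ht⟩), x⟫ = 0 := hx _ ⟨baseEmb Ω ⟨g, ht⟩, rfl⟩
      rw [real_inner_comm, h.baseFun_baseEmb, inner_baseVal] at h3
      rw [← integral_base_eq fun y hy => by rw [ht.eq_zero hy, zero_smul], ← h3]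
      exact integral_congr_ae (ae_of_all _ fun y => mul_comm _ _)
    refine Lp.ext (EventuallyEq.trans ?_ (Lp.coeFn_zero _ _ _).symm)
    exact (ae_restrict_iff' hΩ.measurableSet).2 h2
  intro x
  have h2 : x ∈ (LinearMap.range (baseFun Ω).toLinearMap).topologicalClosure := h1 ▸ trivial
  exact h2

/-- A complete orthonormal system of Dirichlet eigenfunctions. -/
theorem IsAdmissible.exists_dirichlet_basis (h : IsAdmissible Ω) (hΩ : IsOpen Ω)
    (hne : Ω.Nonempty) :
    ∃ (v : ℕ → baseSpace Ω) (Λ : ℕ → ℝ), Orthonormal ℝ (fun j => baseFun Ω (v j)) ∧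
      (∀ x, (∀ j, ⟪baseFun Ω (v j), x⟫ = 0) → x = 0) ∧
      (∀ j z, ⟪v j, z⟫ = Λ j * ⟪baseFun Ω (v j), baseFun Ω z⟫) ∧
      IsLeast (dirichletEigenvalues Ω) (firstEigenvalue Ω) ∧ 0 < firstEigenvalue Ω ∧
      ∀ j, firstEigenvalue Ω ≤ Λ j := by
  have hJ : IsCompactOperator (baseFun Ω) := isCompactOperator_of_factor
    (h.isCompactOperator_energyTrace hΩ.measurableSet) (energyLift Ω) h.energyTrace_energyLift
  obtain ⟨v, Λ, hΛ, ho, htot, hv, j₀, hj₀⟩ := exists_spectral_basis hJ (h.denseRange_baseFun hΩ)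
    (not_finiteDimensional_lp h.pos hΩ hne h.bounded)
  have hl : IsLeast (dirichletEigenvalues Ω) (Λ j₀) := by
    refine ⟨⟨_, h.isDirichletEigenfunction (ho.ne_zero j₀) (hv j₀)⟩, ?_⟩
    rintro μ ⟨u, hu⟩
    obtain ⟨z, hz0, hz⟩ := h.exists_of_isDirichletEigenfunction hu
    -- By totality an arbitrary eigenfunction pairs nontrivially with some basis element; symmetry
    -- of the two forms then forces its eigenvalue to be Λ j.
    obtain ⟨j, hj⟩ : ∃ j, ⟪baseFun Ω (v j), baseFun Ω z⟫ ≠ 0 := by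
      by_contra! hc
      exact hz0 (htot _ hc)
    have h1 := hv j z
    rw [real_inner_comm, hz, real_inner_comm] at h1
    rw [mul_right_cancel₀ hj h1]
    exact hj₀ j
  have hf : firstEigenvalue Ω = Λ j₀ := hl.csInf_eq
  exact ⟨v, Λ, ho, htot, hv, hf ▸ hl, hf ▸ hΛ j₀, fun j => hf ▸ hj₀ j⟩

end Dirichlet

/-! ### The fractional spectral inequality -/

section Fractional

variable {n : ℕ} {Ω : Set (Euc n)}

/-- Expand ∫ (s c + c')² ≥ 0: the cross term is s times the integral of (c²)', that is, -s c(0)².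
The profile e^{-sy} would give equality; it is the vertical decay of a mode with horizontal
eigenvalue s², whence the square root. -/
lemma mul_sq_le_integral {c c' : ℝ → ℝ} (hc : ∀ y, HasDerivAt c (c' y) y) (hc' : Continuous c')
    (hs : HasCompactSupport c) (s : ℝ) :
    s * c 0 ^ 2 ≤ ∫ y in Ioi (0 : ℝ), (s ^ 2 * c y ^ 2 + c' y ^ 2) := by
  have hcont : Continuous c := continuous_iff_continuousAt.2 fun y => (hc y).continuousAt
  have hs' : HasCompactSupport c' := by
    rw [← funext fun y => (hc y).deriv]
    exact hs.deriv
  have hcs1 : HasCompactSupport fun y => s ^ 2 * c y ^ 2 + c' y ^ 2 := by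
    refine HasCompactSupport.intro (hs.isCompact.union hs'.isCompact) fun y hy => ?_
    rw [mem_union, not_or] at hy
    rw [image_eq_zero_of_notMem_tsupport hy.1, image_eq_zero_of_notMem_tsupport hy.2]
    simp
  have hcs2 : HasCompactSupport fun y => -s * (2 * c y * c' y) := by
    refine HasCompactSupport.intro hs.isCompact fun y hy => ?_
    rw [image_eq_zero_of_notMem_tsupport hy]
    simp
  have hd : ∀ y, HasDerivAt (fun y => c y ^ 2) (2 * c y * c' y) y := fun y => by
    simpa using (hc y).fun_pow 2
  have h1 : ∫ y in Ioi (0 : ℝ), 2 * c y * c' y = -c 0 ^ 2 := by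
    have hcd : ContDiff ℝ 1 fun y => c y ^ 2 := by
      rw [contDiff_one_iff_deriv]
      refine ⟨fun y => (hd y).differentiableAt, ?_⟩
      rw [funext fun y => (hd y).deriv]
      fun_prop
    have := HasCompactSupport.integral_Ioi_deriv_eq hcd (by simpa using hasCompactSupport_norm_sq hs) 0
    rw [funext fun y => (hd y).deriv] at this
    simpa using this
  have h2 : s * c 0 ^ 2 = ∫ y in Ioi (0 : ℝ), -s * (2 * c y * c' y) := by
    rw [integral_const_mul, h1]; ring
  rw [h2]
  refine integral_mono (Continuous.integrable_of_hasCompactSupport (by fun_prop) hcs2)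
    (Continuous.integrable_of_hasCompactSupport (by fun_prop) hcs1) fun y => ?_
  simp only
  nlinarith [sq_nonneg (s * c y + c' y)]

/-- The pairing of the horizontal slices of a function with a fixed function. -/
def slicePairing (e : Euc n → ℝ) (φ : Euc n × ℝ → ℝ) (μ : Measure (Euc n)) (y : ℝ) : ℝ :=
  ∫ x, e x * φ (x, y) ∂μ

lemma hasCompactSupport_slicePairing {e : Euc n → ℝ} {φ : Euc n × ℝ → ℝ} {μ : Measure (Euc n)}
    (hφ : HasCompactSupport φ) : HasCompactSupport (slicePairing e φ μ) := by
  refine HasCompactSupport.intro (hφ.image continuous_snd) fun y hy => ?_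
  refine integral_eq_zero_of_ae (ae_of_all _ fun x => ?_)
  have : φ (x, y) = 0 := by
    by_contra hne
    exact hy ⟨(x, y), subset_tsupport φ hne, rfl⟩
  simp [this]

lemma continuous_slicePairing {e : Euc n → ℝ} {φ : Euc n × ℝ → ℝ} {μ : Measure (Euc n)}
    (he : Integrable e μ) (hφ : Continuous φ) (hc : HasCompactSupport φ) :
    Continuous (slicePairing e φ μ) := by
  obtain ⟨C, hC⟩ := hφ.bounded_above_of_compact_support hc
  refine continuous_of_dominated (bound := fun x => ‖e x‖ * C)
    (fun y => he.1.mul (by fun_prop)) (fun y => ae_of_all _ fun x => ?_)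
    (he.norm.mul_const C) (ae_of_all _ fun x => by fun_prop)
  rw [norm_mul]
  gcongr
  exact hC _

lemma hasDerivAt_slicePairing {e : Euc n → ℝ} {φ : Euc n × ℝ → ℝ} {μ : Measure (Euc n)}
    {U : Set (Euc n × ℝ)} (he : Integrable e μ) (hφ : IsTest U φ) (y : ℝ) :
    HasDerivAt (slicePairing e φ μ) (slicePairing e (derivY φ) μ y) y := by
  have hct := hφ.continuous
  have hct' := hφ.continuous_derivY
  obtain ⟨C, hC⟩ := hct.bounded_above_of_compact_support hφ.2.1
  obtain ⟨C', hC'⟩ := hct'.bounded_above_of_compact_support hφ.hasCompactSupport_derivY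
  refine (hasDerivAt_integral_of_dominated_loc_of_deriv_le (s := univ)
    (F := fun z x => e x * φ (x, z)) (F' := fun z x => e x * derivY φ (x, z)) (bound := fun x => ‖e x‖ * C') univ_mem (Eventually.of_forall fun z => he.1.mul (by fun_prop))
    (he.mul_bdd (c := C) (by fun_prop) (ae_of_all _ fun x => hC _)) (he.1.mul (by fun_prop))
    (ae_of_all _ fun x z _ => ?_) (he.norm.mul_const C') (ae_of_all _ fun x z _ => ?_)).2
  · rw [norm_mul]
    gcongr
    exact hC' _
  · exact (hasDerivAt_derivY hφ.differentiable x z).const_mul (e x)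

/-- Bessel's inequality for an orthogonal family. -/
lemma sum_inv_mul_inner_sq_le {V : Type*} [NormedAddCommGroup V] [InnerProductSpace ℝ V]
    {v : ℕ → V} {Λ : ℕ → ℝ} (hΛ : ∀ j, 0 < Λ j)
    (hv : ∀ i j, ⟪v i, v j⟫ = if i = j then Λ i else 0) (F : Finset ℕ) (z : V) :
    ∑ j ∈ F, (Λ j)⁻¹ * ⟪v j, z⟫ ^ 2 ≤ ‖z‖ ^ 2 := by
  have ho : Orthonormal ℝ fun j => (√(Λ j))⁻¹ • v j := by
    rw [orthonormal_iff_ite]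
    intro i j
    rw [real_inner_smul_left, real_inner_smul_right, hv]
    split_ifs with hij
    · subst hij
      rw [← mul_assoc, ← mul_inv, Real.mul_self_sqrt (hΛ i).le, inv_mul_cancel₀ (hΛ i).ne']
    · simp
  refine le_of_eq_of_le (Finset.sum_congr rfl fun j _ => ?_) (ho.sum_inner_products_le (s := F) z)
  rw [real_inner_smul_left, Real.norm_eq_abs, sq_abs, mul_pow, inv_pow, Real.sq_sqrt (hΛ j).le]

/-- For a test function, let c_j(y) be the coefficient of the slice at height y along the j-th
eigenfunction. Bessel's inequality in H^1_0 bounds ∑ Λ_j c_j² by the horizontal energy of the slice,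
Bessel's inequality in L² bounds ∑ c_j'² by the vertical one, and the half-line inequality with s =
√Λ_j concludes. Density extends the result. -/
lemma IsAdmissible.sum_sqrt_mul_inner_sq_le (h : IsAdmissible Ω) {v : ℕ → baseSpace Ω} {Λ : ℕ → ℝ}
    (hΛ : ∀ j, 0 < Λ j) (ho : Orthonormal ℝ fun j => baseFun Ω (v j))
    (hv : ∀ j z, ⟪v j, z⟫ = Λ j * ⟪baseFun Ω (v j), baseFun Ω z⟫) (F : Finset ℕ)
    (k : energySpace Ω) :
    ∑ j ∈ F, √(Λ j) * ⟪baseFun Ω (v j), energyTrace Ω k⟫ ^ 2 ≤ ‖k‖ ^ 2 := by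
  have := isFiniteMeasure_baseMeasure h.bounded
  have hvv : ∀ i j, ⟪v i, v j⟫ = if i = j then Λ i else 0 := fun i j => by
    rw [hv, orthonormal_iff_ite.1 ho i j]
    split_ifs <;> simp
  have key : ∀ φ : cylTest Ω, ∑ j ∈ F, √(Λ j) * ⟪baseFun Ω (v j), energyTrace Ω (cylEmb Ω φ)⟫ ^ 2
      ≤ ‖cylEmb Ω φ‖ ^ 2 := by
    intro φ
    have hφ : IsTest (Ω ×ˢ (univ : Set ℝ)) φ.1 := φ.2
    set e : ℕ → Lp ℝ 2 (baseMeasure Ω) := fun j => baseFun Ω (v j)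
    have hei : ∀ j, Integrable (e j) (baseMeasure Ω) := fun j =>
      (Lp.memLp (e j)).integrable one_le_two
    set c : ℕ → ℝ → ℝ := fun j => slicePairing (e j) φ.1 (baseMeasure Ω)
    set c' : ℕ → ℝ → ℝ := fun j => slicePairing (e j) (derivY φ.1) (baseMeasure Ω)
    have hc0 : ∀ j, ⟪e j, energyTrace Ω (cylEmb Ω φ)⟫ = c j 0 := fun j => by
      rw [h.energyTrace_cylEmb]
      exact inner_baseVal (e j) ⟨_, hφ.slice 0⟩
    have hcc : ∀ j, Continuous (c j) := fun j =>
      continuous_slicePairing (hei j) hφ.continuous hφ.2.1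
    have hcc' : ∀ j, Continuous (c' j) := fun j =>
      continuous_slicePairing (hei j) hφ.continuous_derivY hφ.hasCompactSupport_derivY
    have hcs : ∀ j, HasCompactSupport (c j) := fun j => hasCompactSupport_slicePairing hφ.2.1
    have hcs' : ∀ j, HasCompactSupport (c' j) := fun j =>
      hasCompactSupport_slicePairing hφ.hasCompactSupport_derivY
    have hi1 : ∀ j, Integrable (fun y => √(Λ j) ^ 2 * c j y ^ 2 + c' j y ^ 2)
        (volume.restrict (Ioi (0 : ℝ))) := fun j => by
      have e1 : Integrable (fun y => c j y ^ 2) (volume.restrict (Ioi (0 : ℝ))) :=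
        Continuous.integrable_of_hasCompactSupport (f := fun y => c j y ^ 2) ((hcc j).pow 2) (by
          simpa using hasCompactSupport_norm_sq (hcs j))
      have e2 : Integrable (fun y => c' j y ^ 2) (volume.restrict (Ioi (0 : ℝ))) :=
        Continuous.integrable_of_hasCompactSupport (f := fun y => c' j y ^ 2) ((hcc' j).pow 2) (by
          simpa using hasCompactSupport_norm_sq (hcs' j))
      exact (e1.const_mul _).add e2
    have hcs1 := hasCompactSupport_norm_sq hφ.hasCompactSupport_gradX
    have hcs2 : HasCompactSupport fun p => derivY φ.1 p ^ 2 := by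
      simpa using hasCompactSupport_norm_sq hφ.hasCompactSupport_derivY
    have hct1 : Continuous fun p => ‖gradX φ.1 p‖ ^ 2 := hφ.continuous_gradX.norm.pow 2
    have hct2 : Continuous fun p => derivY φ.1 p ^ 2 := hφ.continuous_derivY.pow 2
    have hj1 : Integrable (fun y => ∫ x, ‖gradX φ.1 (x, y)‖ ^ 2 ∂(baseMeasure Ω))
        (volume.restrict (Ioi (0 : ℝ))) := by
      have := integrable_cyl (Ω := Ω) hct1 hcs1
      rw [cylMeasure_eq] at this
      exact this.integral_prod_right
    have hj2 : Integrable (fun y => ∫ x, derivY φ.1 (x, y) ^ 2 ∂(baseMeasure Ω))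
        (volume.restrict (Ioi (0 : ℝ))) := by
      have := integrable_cyl (Ω := Ω) hct2 hcs2
      rw [cylMeasure_eq] at this
      exact this.integral_prod_right
    calc ∑ j ∈ F, √(Λ j) * ⟪e j, energyTrace Ω (cylEmb Ω φ)⟫ ^ 2
        ≤ ∑ j ∈ F, ∫ y in Ioi (0 : ℝ), (√(Λ j) ^ 2 * c j y ^ 2 + c' j y ^ 2) := by
          refine Finset.sum_le_sum fun j _ => ?_
          rw [hc0]
          exact mul_sq_le_integral (hasDerivAt_slicePairing (hei j) hφ) (hcc' j) (hcs j) _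
      _ = ∫ y in Ioi (0 : ℝ), ∑ j ∈ F, (√(Λ j) ^ 2 * c j y ^ 2 + c' j y ^ 2) :=
          (integral_finsetSum _ fun j _ => hi1 j).symm
      _ ≤ ∫ y in Ioi (0 : ℝ), ((∫ x, ‖gradX φ.1 (x, y)‖ ^ 2 ∂(baseMeasure Ω))
            + ∫ x, derivY φ.1 (x, y) ^ 2 ∂(baseMeasure Ω)) := by
          refine integral_mono (integrable_finsetSum _ fun j _ => hi1 j) (hj1.add hj2) fun y => ?_
          simp only [Finset.sum_add_distrib]
          refine add_le_add ?_ ?_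
          -- The eigenvalue relation turns Λ_j⁻¹ ⟪v_j, ∇z⟫² into Λ_j c_j(y)².
          · set z : testSubmodule Ω := ⟨fun x => φ.1 (x, y), hφ.slice y⟩
            have h1 := sum_inv_mul_inner_sq_le hΛ hvv F (baseEmb Ω z)
            rw [norm_baseEmb_sq] at h1
            refine le_of_eq_of_le (Finset.sum_congr rfl fun j _ => ?_) h1
            have h2 : ⟪e j, baseVal Ω z⟫ = c j y := inner_baseVal (e j) _
            rw [hv, h.baseFun_baseEmb, h2, Real.sq_sqrt (hΛ j).le]
            have := (hΛ j).ne'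
            field_simp
          · have hm : MemLp (fun x => derivY φ.1 (x, y)) 2 (baseMeasure Ω) :=
              Continuous.memLp_of_hasCompactSupport
                (hφ.continuous_derivY.comp (by fun_prop))
                (hasCompactSupport_slice_left hφ.hasCompactSupport_derivY y)
            have h1 := ho.sum_inner_products_le (s := F) (x := hm.toLp _)
            rw [norm_toLp_sq] at h1
            refine (le_of_eq_of_le (Finset.sum_congr rfl fun j _ => ?_) h1).trans_eq ?_
            · have h2 : ⟪e j, hm.toLp _⟫ = c' j y := by
                rw [inner_Lp_eq]
                refine integral_congr_ae ?_
                filter_upwards [hm.coeFn_toLp] with x hx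
                rw [hx]
              rw [h2, Real.norm_eq_abs, sq_abs]
            · simp
      _ = ‖cylEmb Ω φ‖ ^ 2 := by
          rw [integral_add hj1 hj2, norm_cylEmb_sq, integral_cyl_symm hct1 hcs1,
            integral_cyl_symm hct2 hcs2]
  have hcl : IsClosed {k : energySpace Ω |
      ∑ j ∈ F, √(Λ j) * ⟪baseFun Ω (v j), energyTrace Ω k⟫ ^ 2 ≤ ‖k‖ ^ 2} :=
    isClosed_le (by fun_prop) (by fun_prop)
  exact denseRange_cylEmb.induction_on k hcl key

lemma IsAdmissible.memH0Half (h : IsAdmissible Ω) (hΩ : IsOpen Ω) (hne : Ω.Nonempty)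
    (k : energySpace Ω) : MemH0Half Ω (energyTrace Ω k) := by
  obtain ⟨v, Λ, ho, htot, hv, -, hpos, hle⟩ := h.exists_dirichlet_basis hΩ hne
  have hΛ : ∀ j, 0 < Λ j := fun j => hpos.trans_le (hle j)
  refine ⟨Lp.memLp _, fun j => baseFun Ω (v j), Λ,
    fun j => h.isDirichletEigenfunction (ho.ne_zero j) (hv j), fun i j => ?_, fun u hu huz => ?_, ?_⟩
  · rw [← inner_Lp_eq]
    exact orthonormal_iff_ite.1 ho i j
  · have h0 : hu.toLp u = 0 := htot _ fun j => by
      rw [inner_Lp_eq, ← huz j]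
      refine integral_congr_ae ?_
      filter_upwards [hu.coeFn_toLp] with x hx
      rw [hx, mul_comm]
    exact hu.coeFn_toLp.symm.trans (h0 ▸ Lp.coeFn_zero _ _ _)
  · refine summable_of_sum_le (c := ‖k‖ ^ 2) (fun j => by positivity) fun F => ?_
    refine le_of_eq_of_le (Finset.sum_congr rfl fun j _ => ?_)
      (h.sum_sqrt_mul_inner_sq_le hΛ ho hv F k)
    rw [inner_Lp_eq, mul_comm]
    congr 2
    exact integral_congr_ae (ae_of_all _ fun x => mul_comm _ _)

/-- Parseval's identity for the trace, with √λ₁ ≤ √Λ_j in each term. -/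
lemma IsAdmissible.sqrt_firstEigenvalue_mul_le (h : IsAdmissible Ω) (hΩ : IsOpen Ω)
    (hne : Ω.Nonempty) (k : energySpace Ω) :
    √(firstEigenvalue Ω) * ‖energyTrace Ω k‖ ^ 2 ≤ ‖k‖ ^ 2 := by
  obtain ⟨v, Λ, ho, htot, hv, -, hpos, hle⟩ := h.exists_dirichlet_basis hΩ hne
  have hΛ : ∀ j, 0 < Λ j := fun j => hpos.trans_le (hle j)
  set b := HilbertBasis.mkOfOrthogonalEqBot ho (by
    rw [Submodule.eq_bot_iff]
    exact fun x hx => htot x fun i => hx _ (Submodule.subset_span (mem_range_self i)))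
  have hb : ∀ j, b j = baseFun Ω (v j) := fun j => by
    rw [HilbertBasis.coe_mkOfOrthogonalEqBot]
  have hsum := (b.hasSum_inner_mul_inner (energyTrace Ω k) (energyTrace Ω k)).mul_left
    √(firstEigenvalue Ω)
  rw [real_inner_self_eq_norm_sq] at hsum
  refine hasSum_le_of_sum_le hsum fun F => ?_
  refine (Finset.sum_le_sum fun j _ => ?_).trans (h.sum_sqrt_mul_inner_sq_le hΛ ho hv F k)
  rw [hb, real_inner_comm, ← sq]
  exact mul_le_mul_of_nonneg_right (Real.sqrt_le_sqrt (hle j)) (sq_nonneg _)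

end Fractional

/-! ### Superposition operators -/

section Superposition

variable {α : Type*} [MeasurableSpace α] {μ : Measure α}

/-- `f` is continuous and at most linear, and `b` is a bounded measurable weight. -/
structure IsSuperposition (μ : Measure α) (b : α → ℝ) (f : ℝ → ℝ) (B c : ℝ) : Prop where
  continuous : Continuous f
  le : ∀ t, |f t| ≤ c * |t|
  measurable : AEStronglyMeasurable b μ
  bound : ∀ᵐ x ∂μ, |b x| ≤ B
  nonneg : 0 ≤ B
  pos : 0 < c

variable {b : α → ℝ} {f : ℝ → ℝ} {B c : ℝ}

lemma IsSuperposition.memLp (h : IsSuperposition μ b f B c) {u : α → ℝ} (hu : MemLp u 2 μ) :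
    MemLp (fun x => b x * f (u x)) 2 μ := by
  refine hu.of_le_mul (c := B * c) (h.measurable.mul (h.continuous.comp_aestronglyMeasurable hu.1)) ?_
  filter_upwards [h.bound] with x hx
  rw [norm_mul, mul_assoc]
  exact mul_le_mul hx (h.le _) (abs_nonneg _) h.nonneg

/-- The superposition operator `u ↦ b f(u)` on `L²`. -/
def IsSuperposition.op (h : IsSuperposition μ b f B c) (u : Lp ℝ 2 μ) : Lp ℝ 2 μ :=
  (h.memLp (Lp.memLp u)).toLp _

/-- The functional `u ↦ ∫ b F(u)` on `L²`. -/
def potential (b : α → ℝ) (f : ℝ → ℝ) (u : Lp ℝ 2 μ) : ℝ := ∫ x, b x * primitive f (u x) ∂μ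

lemma IsSuperposition.coeFn_op (h : IsSuperposition μ b f B c) (u : Lp ℝ 2 μ) :
    h.op u =ᵐ[μ] fun x => b x * f (u x) := MemLp.coeFn_toLp _

lemma IsSuperposition.abs_primitive_le (h : IsSuperposition μ b f B c) (t : ℝ) :
    |primitive f t| ≤ c / 2 * t ^ 2 := HalfLaplacian.abs_primitive_le t fun s _ => h.le s

lemma IsSuperposition.integrable (h : IsSuperposition μ b f B c) {u : α → ℝ} (hu : MemLp u 2 μ) :
    Integrable (fun x => b x * primitive f (u x)) μ := by
  refine (hu.integrable_sq.const_mul (B * (c / 2))).mono'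
    (h.measurable.mul ((continuous_primitive h.continuous).comp_aestronglyMeasurable hu.1)) ?_
  filter_upwards [h.bound] with x hx
  rw [norm_mul, mul_assoc]
  exact mul_le_mul hx (h.abs_primitive_le _) (abs_nonneg _) h.nonneg

lemma integrable_sq_Lp (u : Lp ℝ 2 μ) : Integrable (fun x => u x ^ 2) μ := (Lp.memLp u).integrable_sq

lemma norm_Lp_real_sq (u : Lp ℝ 2 μ) : ‖u‖ ^ 2 = ∫ x, u x ^ 2 ∂μ := by
  rw [norm_Lp_sq]
  simp only [Real.norm_eq_abs, sq_abs]

/-- A pointwise bound for `F` gives a bound for the potential. -/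
lemma IsSuperposition.potential_le (h : IsSuperposition μ b f B c) {u : Lp ℝ 2 μ} {g : α → ℝ}
    (hg : Integrable g μ) (hu : ∀ᵐ x ∂μ, |primitive f (u x)| ≤ g x) :
    potential b f u ≤ B * ∫ x, g x ∂μ := by
  rw [← integral_const_mul]
  refine integral_mono_ae (h.integrable (Lp.memLp u)) (hg.const_mul B) ?_
  filter_upwards [h.bound, hu] with x hx hux
  refine (le_abs_self _).trans ?_
  rw [abs_mul]
  exact mul_le_mul hx hux (abs_nonneg _) h.nonneg

lemma potential_zero : potential b f (0 : Lp ℝ 2 μ) = 0 := by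
  refine integral_eq_zero_of_ae ?_
  filter_upwards [Lp.coeFn_zero ℝ 2 μ] with x hx
  rw [hx]
  simp

lemma IsSuperposition.norm_op_le (h : IsSuperposition μ b f B c) (u : Lp ℝ 2 μ) :
    ‖h.op u‖ ≤ B * c * ‖u‖ := by
  refine Lp.norm_le_mul_norm_of_ae_le_mul ?_
  filter_upwards [h.coeFn_op u, h.bound] with x hx hbx
  rw [hx, norm_mul, mul_assoc]
  exact mul_le_mul hbx (h.le _) (abs_nonneg _) h.nonneg

lemma potential_growth [IsFiniteMeasure μ] (h : IsSuperposition μ b f B c)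
    (hfinf : Tendsto (fun t => f t / t) (Bornology.cobounded ℝ) (𝓝 0)) {ε : ℝ} (hε : 0 < ε) :
    ∃ C : ℝ, ∀ u : Lp ℝ 2 μ, potential b f u ≤ ε * ‖u‖ ^ 2 + C := by
  have hB : 0 < B + 1 := by linarith [h.nonneg]
  obtain ⟨C, hC0, hC⟩ := abs_primitive_le_add h.continuous hfinf (div_pos hε hB)
  refine ⟨B * (C * μ.real univ), fun u => ?_⟩
  have hi := (integrable_sq_Lp u).const_mul (ε / (B + 1))
  refine (h.potential_le (g := fun x => ε / (B + 1) * u x ^ 2 + C) (hi.add (integrable_const C))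
    (ae_of_all _ fun x => hC _)).trans ?_
  have : ∫ x, (ε / (B + 1) * u x ^ 2 + C) ∂μ = ε / (B + 1) * ‖u‖ ^ 2 + C * μ.real univ := by
    rw [integral_add hi (integrable_const C), integral_const_mul, norm_Lp_real_sq, integral_const,
      smul_eq_mul, mul_comm C]
  rw [this, mul_add, ← mul_assoc]
  refine add_le_add_left (mul_le_mul_of_nonneg_right ?_ (sq_nonneg _)) _
  rw [mul_div_assoc', div_le_iff₀ hB]
  nlinarith [h.nonneg]

/-- The constant function in `L²`. -/
def constLp (μ : Measure α) [IsFiniteMeasure μ] : Lp ℝ 2 μ := (memLp_const (1 : ℝ)).toLp fun _ => (1 : ℝ)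

lemma coeFn_constLp [IsFiniteMeasure μ] : constLp μ =ᵐ[μ] fun _ => (1 : ℝ) := MemLp.coeFn_toLp _

/-- Bookkeeping shared by the two lemmas below: A bounds the norm of the linear part of the modulus,
and the other factor bounds the increment. Each part receives half of ε; the shifts B + 1 and C + 1
keep the denominators positive. -/
lemma modulus_arith {A B C ε : ℝ} (hB : 0 ≤ B) (hC0 : 0 ≤ C) (hA : 0 < A) (hε : 0 < ε) :
    B * (ε / (2 * (B + 1) * A) * A + C * (ε / (2 * (B + 1) * (C + 1)))) ≤ ε := by
  have e1 : ε / (2 * (B + 1) * A) * A = ε / (2 * (B + 1)) := by field_simp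
  have e2 : C * (ε / (2 * (B + 1) * (C + 1))) ≤ ε / (2 * (B + 1)) := by
    rw [mul_div_assoc', div_le_div_iff₀ (by positivity) (by positivity)]
    nlinarith [mul_pos hε (show 0 < 2 * (B + 1) by positivity)]
  calc _ ≤ B * (ε / (2 * (B + 1)) + ε / (2 * (B + 1))) := by gcongr; exact e1.le
    _ = B * ε / (B + 1) := by field_simp; ring
    _ ≤ ε := by rw [div_le_iff₀ (by positivity)]; nlinarith

lemma uniform_continuity_op [IsFiniteMeasure μ] (h : IsSuperposition μ b f B c)
    (hfinf : Tendsto (fun t => f t / t) (Bornology.cobounded ℝ) (𝓝 0)) (R : ℝ) {ε : ℝ}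
    (hε : 0 < ε) : ∃ δ > 0, ∀ u, ‖u‖ ≤ R → ∀ z, ‖z - u‖ ≤ δ → ‖h.op z - h.op u‖ ≤ ε := by
  have hB := h.nonneg
  rcases lt_or_ge R 0 with hR | hR
  · exact ⟨1, one_pos, fun u hu => absurd ((norm_nonneg u).trans hu) (not_le.2 hR)⟩
  -- Since increments are kept below 1, this bounds the norm of 1 + |z| + |u| for ‖u‖ ≤ R.
  set A : ℝ := ‖constLp μ‖ + 2 * R + 1
  have hA : 0 < A := by positivity
  obtain ⟨C, hC0, hC⟩ := exists_modulus h.continuous hfinf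
    (show 0 < ε / (2 * (B + 1) * A) by positivity)
  refine ⟨min 1 (ε / (2 * (B + 1) * (C + 1))), by positivity, fun u hu z hz => ?_⟩
  set w : Lp ℝ 2 μ := (ε / (2 * (B + 1) * A)) • (constLp μ + |z| + |u|) + C • |z - u|
  have h1 : ‖h.op z - h.op u‖ ≤ B * ‖w‖ := by
    refine Lp.norm_le_mul_norm_of_ae_le_mul ?_
    filter_upwards [h.coeFn_op u, h.coeFn_op z, h.bound, Lp.coeFn_sub (h.op z) (h.op u),
      Lp.coeFn_sub z u, Lp.coeFn_abs z, Lp.coeFn_abs u, Lp.coeFn_abs (z - u), coeFn_constLp (μ := μ),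
      Lp.coeFn_add ((ε / (2 * (B + 1) * A)) • (constLp μ + |z| + |u|)) (C • |z - u|),
      Lp.coeFn_smul (ε / (2 * (B + 1) * A)) (constLp μ + |z| + |u|), Lp.coeFn_smul C |z - u|,
      Lp.coeFn_add (constLp μ + |z|) |u|, Lp.coeFn_add (constLp μ) |z|]
      with x e1 e2 e3 e4 e5 e6 e7 e8 e9 e10 e11 e12 e13 e14
    rw [e4, e10, Pi.sub_apply, e1, e2, Pi.add_apply, e11, e12, Pi.smul_apply, e13, Pi.smul_apply,
      Pi.add_apply, e14, Pi.add_apply, e6, e7, e8, e9, e5, Pi.sub_apply, ← mul_sub, norm_mul,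
      smul_eq_mul, smul_eq_mul]
    exact mul_le_mul e3 ((hC _ _).trans (le_abs_self _)) (norm_nonneg _) hB
  have hz1 : ‖z‖ ≤ R + 1 := by
    calc ‖z‖ = ‖(z - u) + u‖ := by rw [sub_add_cancel]
      _ ≤ 1 + R := (norm_add_le _ _).trans (add_le_add (hz.trans (min_le_left _ _)) hu)
      _ = R + 1 := add_comm _ _
  have h2 : ‖w‖ ≤ ε / (2 * (B + 1) * A) * A + C * (ε / (2 * (B + 1) * (C + 1))) := by
    refine (norm_add_le _ _).trans (add_le_add ?_ ?_)
    · rw [norm_smul, Real.norm_of_nonneg (by positivity)]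
      gcongr
      refine (norm_add_le _ _).trans ?_
      have := norm_add_le (constLp μ) |z|
      rw [norm_abs_eq_norm] at this ⊢
      simp only [A]
      linarith
    · rw [norm_smul, Real.norm_of_nonneg hC0, norm_abs_eq_norm]
      gcongr
      exact hz.trans (min_le_right _ _)
  have h3 := modulus_arith hB hC0 hA hε
  exact h1.trans ((mul_le_mul_of_nonneg_left h2 hB).trans h3)

/-- At each point the mean value inequality for F bounds the remainder by the modulus of f times
|k|. The modulus is an L² function w of small norm, so the integrated remainder is at most B ⟪w,
|k|⟫, which is o(‖k‖). -/
lemma hasFDerivAt_potential [IsFiniteMeasure μ] (h : IsSuperposition μ b f B c)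
    (hfinf : Tendsto (fun t => f t / t) (Bornology.cobounded ℝ) (𝓝 0)) (u : Lp ℝ 2 μ) :
    HasFDerivAt (potential b f) (innerSL ℝ (h.op u)) u := by
  have hB := h.nonneg
  rw [hasFDerivAt_iff_isLittleO_nhds_zero, Asymptotics.isLittleO_iff]
  intro ε hε
  set A : ℝ := ‖constLp μ‖ + 2 * ‖u‖ + 1
  have hA : 0 < A := by positivity
  obtain ⟨C, hC0, hC⟩ := exists_modulus h.continuous hfinf
    (show 0 < ε / (2 * (B + 1) * A) by positivity)
  filter_upwards [Metric.closedBall_mem_nhds (0 : Lp ℝ 2 μ)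
    (show 0 < min 1 (ε / (2 * (B + 1) * (C + 1))) by positivity)] with k hk
  rw [mem_closedBall_zero_iff] at hk
  set w : Lp ℝ 2 μ := (ε / (2 * (B + 1) * A)) • (constLp μ + (2 : ℝ) • |u| + |k|) + C • |k|
  have h1 : |potential b f (u + k) - potential b f u - innerSL ℝ (h.op u) k|
      ≤ B * ⟪w, |k|⟫ := by
    have i1 := h.integrable (Lp.memLp (u + k))
    have i2 := h.integrable (Lp.memLp u)
    have i3 := integrable_mul_of_memLp_two (Lp.memLp (h.op u)) (Lp.memLp k)
    have i4 := integrable_mul_of_memLp_two (Lp.memLp w) (Lp.memLp |k|)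
    have i5 : Integrable (fun x => b x * primitive f ((u + k : Lp ℝ 2 μ) x)
      - b x * primitive f (u x)) μ := i1.sub i2
    rw [innerSL_apply_apply, inner_Lp_eq, inner_Lp_eq, potential, potential, ← integral_sub i1 i2,
      ← integral_sub i5 i3, ← integral_const_mul]
    refine (abs_integral_le_integral_abs).trans (integral_mono_ae (i5.sub i3).abs
      (i4.const_mul B) ?_)
    filter_upwards [h.coeFn_op u, h.bound, Lp.coeFn_add u k, Lp.coeFn_abs k, Lp.coeFn_abs u,
      coeFn_constLp (μ := μ),
      Lp.coeFn_add ((ε / (2 * (B + 1) * A)) • (constLp μ + (2 : ℝ) • |u| + |k|)) (C • |k|),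
      Lp.coeFn_smul (ε / (2 * (B + 1) * A)) (constLp μ + (2 : ℝ) • |u| + |k|), Lp.coeFn_smul C |k|,
      Lp.coeFn_add (constLp μ + (2 : ℝ) • |u|) |k|, Lp.coeFn_add (constLp μ) ((2 : ℝ) • |u|),
      Lp.coeFn_smul (2 : ℝ) |u|]
      with x e1 e2 e3 e4 e5 e6 e7 e8 e9 e10 e11 e12
    have e13 := abs_primitive_sub_le h.continuous (a := u x) (b := u x + k x) (A := f (u x))
      (C := ε / (2 * (B + 1) * A) * (1 + 2 * |u x| + |k x|) + C * |k x|) fun t ht => by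
        rw [add_sub_cancel_left] at ht
        refine (hC _ _).trans ?_
        have : |t| ≤ |u x| + |k x| := by
          calc |t| = |u x + (t - u x)| := by rw [add_sub_cancel]
            _ ≤ _ := (abs_add_le _ _).trans (by gcongr)
        have : 1 + |t| + |u x| ≤ 1 + 2 * |u x| + |k x| := by linarith
        gcongr
    rw [add_sub_cancel_left] at e13
    rw [e1, e3, e4, e7, Pi.add_apply, Pi.add_apply, e8, e9, Pi.smul_apply, Pi.smul_apply, e10, Pi.add_apply, e11,
      Pi.add_apply, e12, Pi.smul_apply, e4, e5, e6, smul_eq_mul, smul_eq_mul, smul_eq_mul]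
    rw [show b x * primitive f (u x + k x) - b x * primitive f (u x) - b x * f (u x) * k x
      = b x * (primitive f (u x + k x) - primitive f (u x) - f (u x) * k x) by ring, abs_mul]
    exact mul_le_mul e2 e13 (abs_nonneg _) hB
  have h2 : ‖w‖ ≤ ε / (2 * (B + 1) * A) * A + C * (ε / (2 * (B + 1) * (C + 1))) := by
    refine (norm_add_le _ _).trans (add_le_add ?_ ?_)
    · rw [norm_smul, Real.norm_of_nonneg (by positivity)]
      gcongr
      refine (norm_add_le _ _).trans ?_
      have := norm_add_le (constLp μ) ((2 : ℝ) • |u|)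
      rw [norm_smul, norm_abs_eq_norm, Real.norm_of_nonneg zero_le_two] at this
      rw [norm_abs_eq_norm]
      have := hk.trans (min_le_left _ _)
      simp only [A]
      linarith
    · rw [norm_smul, Real.norm_of_nonneg hC0, norm_abs_eq_norm]
      gcongr
      exact hk.trans (min_le_right _ _)
  have h3 := modulus_arith hB hC0 hA hε
  refine h1.trans ?_
  calc B * ⟪w, |k|⟫ ≤ B * (‖w‖ * ‖k‖) := by
        gcongr
        have := real_inner_le_norm w |k|
        rwa [norm_abs_eq_norm] at this
    _ ≤ B * ((ε / (2 * (B + 1) * A) * A + C * (ε / (2 * (B + 1) * (C + 1)))) * ‖k‖) := by gcongr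
    _ ≤ ε * ‖k‖ := by rw [← mul_assoc]; gcongr

/-- The potential is small near zero along operators which are close to operators with
bounded values. -/
lemma potential_comp_le {H : Type*} [NormedAddCommGroup H] [NormedSpace ℝ H]
    (h : IsSuperposition μ b f B c) (hf0 : Tendsto (fun t => f t / t) (𝓝[≠] 0) (𝓝 0))
    {T : H →L[ℝ] Lp ℝ 2 μ} (hT : ∀ ε > 0, ∃ P : H →L[ℝ] Lp ℝ 2 μ, ‖T - P‖ ≤ ε ∧ ∃ M, 0 ≤ M ∧
      ∀ k : H, ∀ᵐ x ∂μ, |P k x| ≤ M * ‖k‖) :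
    ∃ r > 0, ∀ k, ‖k‖ ≤ r → potential b f (T k) ≤ 1 / 4 * ‖k‖ ^ 2 := by
  have hB := h.nonneg
  have hc := h.pos
  -- On L² alone the potential need not be o(‖u‖²): multiples of indicators of small sets are small
  -- in norm but not in values. Closeness of T to an operator with bounded values is what excludes
  -- this. The constants η and s each contribute 1/8 to the final 1/4.
  set η : ℝ := 1 / (8 * (B + 1) * (‖T‖ ^ 2 + 1))
  have hη : 0 < η := by positivity
  set s : ℝ := 1 / (16 * (B + 1) * c)
  have hs : 0 < s := by positivity
  obtain ⟨δ, hδ, hfδ⟩ := abs_le_mul_abs_near_zero h.continuous hf0 hη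
  obtain ⟨P, hP, M, hM0, hM⟩ := hT √s (Real.sqrt_pos.2 hs)
  refine ⟨δ / (2 * (M + 1)), by positivity, fun k hk => ?_⟩
  have hi := (integrable_sq_Lp (T k)).const_mul η
  have hi2 := (integrable_sq_Lp (T k - P k)).const_mul (2 * c)
  have h1 : potential b f (T k) ≤ B * ∫ x, (η * T k x ^ 2 + 2 * c * (T k - P k) x ^ 2) ∂μ := by
    refine h.potential_le (hi.add hi2) ?_
    filter_upwards [hM k, Lp.coeFn_sub (T k) (P k)] with x hx hsub
    rw [hsub, Pi.sub_apply]
    rcases le_or_gt |T k x| δ with ht | ht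
    · have e1 := HalfLaplacian.abs_primitive_le (f := f) (c := η) (T k x)
        fun t h' => hfδ t (h'.trans ht)
      have : 0 ≤ η * T k x ^ 2 := by positivity
      have : 0 ≤ 2 * c * (T k x - P k x) ^ 2 := by positivity
      linarith
    -- Where T k exceeds δ, the value of P k is at most half of it, so |T k| ≤ 2|T k - P k| and F is
    -- controlled by the approximation error.
    · have e1 : |P k x| ≤ δ / 2 := by
        refine hx.trans ((mul_le_mul_of_nonneg_left hk hM0).trans ?_)
        rw [mul_div_assoc', div_le_div_iff₀ (by positivity) two_pos]
        nlinarith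
      have e2 : |T k x| ≤ 2 * |T k x - P k x| := by
        have := abs_sub_abs_le_abs_sub (T k x) (P k x)
        linarith
      have e3 : T k x ^ 2 ≤ 4 * (T k x - P k x) ^ 2 := by
        rw [← sq_abs (T k x), ← sq_abs (T k x - P k x)]
        nlinarith [abs_nonneg (T k x)]
      have := h.abs_primitive_le (T k x)
      have : 0 ≤ η * T k x ^ 2 := by positivity
      nlinarith
  rw [integral_add hi hi2, integral_const_mul, integral_const_mul, ← norm_Lp_real_sq,
    ← norm_Lp_real_sq] at h1
  have h2 : ‖T k‖ ^ 2 ≤ ‖T‖ ^ 2 * ‖k‖ ^ 2 := by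
    rw [← mul_pow]; exact pow_le_pow_left₀ (norm_nonneg _) (T.le_opNorm k) 2
  have h3 : ‖T k - P k‖ ^ 2 ≤ s * ‖k‖ ^ 2 := by
    have := (T - P).le_of_opNorm_le hP k
    rw [← Real.sq_sqrt hs.le, ← mul_pow]
    exact pow_le_pow_left₀ (norm_nonneg _) this 2
  refine h1.trans ?_
  calc B * (η * ‖T k‖ ^ 2 + 2 * c * ‖T k - P k‖ ^ 2)
      ≤ (B + 1) * (η * ((‖T‖ ^ 2 + 1) * ‖k‖ ^ 2) + 2 * c * (s * ‖k‖ ^ 2)) := by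
        gcongr
        · linarith
        · nlinarith [sq_nonneg ‖k‖]
    _ = 1 / 4 * ‖k‖ ^ 2 := by
        simp only [η, s]
        field_simp
        ring

end Superposition

/-! ### Boundedness of weak solutions -/

section Ramp

/-- A smooth convex approximation of the positive part. -/
def ramp : ℝ → ℝ := primitive Real.smoothTransition

lemma hasDerivAt_ramp (s : ℝ) : HasDerivAt ramp (Real.smoothTransition s) s :=
  hasDerivAt_primitive Real.smoothTransition.continuous s

lemma contDiff_ramp : ContDiff ℝ ∞ ramp := by
  rw [contDiff_infty_iff_deriv, funext fun s => (hasDerivAt_ramp s).deriv]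
  exact ⟨fun s => (hasDerivAt_ramp s).differentiableAt, Real.smoothTransition.contDiff⟩

lemma ramp_eq_zero {s : ℝ} (hs : s ≤ 0) : ramp s = 0 := by
  rw [ramp, primitive, intervalIntegral.integral_congr (g := fun _ => 0), intervalIntegral.integral_zero]
  intro z hz
  rw [uIcc_of_ge hs] at hz
  exact Real.smoothTransition.zero_of_nonpos hz.2

lemma monotone_ramp : Monotone ramp :=
  monotone_of_deriv_nonneg (fun s => (hasDerivAt_ramp s).differentiableAt) fun s => by
    rw [(hasDerivAt_ramp s).deriv]; exact Real.smoothTransition.nonneg s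

lemma ramp_nonneg (s : ℝ) : 0 ≤ ramp s := by
  rcases le_total s 0 with h | h
  · exact (ramp_eq_zero h).ge
  · exact (ramp_eq_zero le_rfl).ge.trans (monotone_ramp h)

lemma abs_ramp_sub_le (s t : ℝ) : |ramp t - ramp s| ≤ |t - s| := by
  have := abs_primitive_sub_le Real.smoothTransition.continuous (a := s) (b := t) (A := 0) (C := 1)
    fun z _ => by
      rw [sub_zero, abs_of_nonneg (Real.smoothTransition.nonneg z)]
      exact Real.smoothTransition.le_one z
  simpa [ramp] using this

/-- The slope is 1 from s = 1 on, so the ramp is at least s - 1, which exceeds s/2 once s ≥ 2. -/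
lemma half_le_ramp {s : ℝ} (hs : 2 ≤ s) : s / 2 ≤ ramp s := by
  have h1 : ramp s = ramp 1 + ∫ z in (1 : ℝ)..s, Real.smoothTransition z :=
    (intervalIntegral.integral_add_adjacent_intervals
      (Real.smoothTransition.continuous.intervalIntegrable _ _)
      (Real.smoothTransition.continuous.intervalIntegrable _ _)).symm
  have h2 : ∫ z in (1 : ℝ)..s, Real.smoothTransition z = s - 1 := by
    rw [intervalIntegral.integral_congr (g := fun _ => 1), intervalIntegral.integral_const]
    · simp
    · intro z hz
      rw [uIcc_of_le (by linarith)] at hz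
      exact Real.smoothTransition.one_of_one_le hz.1
  linarith [ramp_nonneg 1]

end Ramp

/-! ### A superharmonic barrier and comparison with it -/

section Barrier

variable {n : ℕ} {Ω : Set (Euc n)}

/-- The trace of the barrier function. -/
def barrierTrace (e : Euc n) (b : ℝ) (x : Euc n) : ℝ := 2 + Real.cos (b * ⟪e, x⟫)

/-- The vertical profile of the barrier function. -/
def barrierDecay (b y : ℝ) : ℝ := Real.exp (-(b / 3) * y)

/-- A positive superharmonic function on the half-cylinder, with decay in the vertical variable. -/
def barrier (e : Euc n) (b : ℝ) (p : Euc n × ℝ) : ℝ := barrierDecay b p.2 * barrierTrace e b p.1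

variable {e : Euc n} {b : ℝ}

lemma one_le_barrierTrace (x : Euc n) : 1 ≤ barrierTrace e b x := by
  have := Real.neg_one_le_cos (b * ⟪e, x⟫)
  rw [barrierTrace]; linarith

lemma barrierTrace_le (x : Euc n) : barrierTrace e b x ≤ 3 := by
  have := Real.cos_le_one (b * ⟪e, x⟫)
  rw [barrierTrace]; linarith

lemma contDiff_barrierTrace : ContDiff ℝ ∞ (barrierTrace e b) :=
  contDiff_const.add (Real.contDiff_cos.comp (contDiff_const.mul (contDiff_const.inner ℝ contDiff_id)))

lemma contDiff_barrierDecay : ContDiff ℝ ∞ (barrierDecay b) :=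
  Real.contDiff_exp.comp (contDiff_const.mul contDiff_id)

lemma contDiff_barrier : ContDiff ℝ ∞ (barrier e b) :=
  (contDiff_barrierDecay.comp contDiff_snd).mul (contDiff_barrierTrace.comp contDiff_fst)

lemma barrier_pos (p : Euc n × ℝ) : 0 < barrier e b p :=
  mul_pos (Real.exp_pos _) (one_pos.trans_le (one_le_barrierTrace _))

lemma barrier_zero (x : Euc n) : barrier e b (x, 0) = barrierTrace e b x := by
  simp [barrier, barrierDecay]

lemma hasDerivAt_barrierDecay (y : ℝ) :
    HasDerivAt (barrierDecay b) (-(b / 3) * barrierDecay b y) y := by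
  have := ((hasDerivAt_id y).const_mul (-(b / 3))).exp
  refine this.congr_deriv ?_
  simp [barrierDecay, mul_comm]

lemma gradient_barrierTrace (x : Euc n) :
    gradient (barrierTrace e b) x = (-(b * Real.sin (b * ⟪e, x⟫))) • e := by
  have h1 : HasFDerivAt (fun x : Euc n => b * ⟪e, x⟫) (b • innerSL ℝ e) x :=
    (innerSL ℝ e).hasFDerivAt.const_mul b
  have h2 : HasFDerivAt (barrierTrace e b) (-Real.sin (b * ⟪e, x⟫) • b • innerSL ℝ e) x :=
    h1.cos.const_add 2
  refine ext_inner_right ℝ fun v => ?_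
  rw [inner_gradient, h2.fderiv, inner_smul_left]
  simp
  ring

lemma gradX_barrier (p : Euc n × ℝ) : gradX (barrier e b) p
    = barrierDecay b p.2 • (-(b * Real.sin (b * ⟪e, p.1⟫))) • e := by
  rw [← gradient_barrierTrace]
  exact congrFun (gradX_prod (contDiff_barrierTrace.differentiable (by simp)) (barrierDecay b)) p

lemma derivY_barrier (p : Euc n × ℝ) :
    derivY (barrier e b) p = -(b / 3) * barrier e b p := by
  have := congrFun (derivY_prod (barrierTrace e b) (η := barrierDecay b)
    (contDiff_barrierDecay.differentiable (by simp))) p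
  refine this.trans ?_
  rw [(hasDerivAt_barrierDecay _).deriv, barrier]
  ring

lemma integral_gradX_barrier {v : Euc n × ℝ → ℝ} (he : ‖e‖ = 1)
    (hv : IsTest (Ω ×ˢ (univ : Set ℝ)) v) :
    ∫ p, ⟪gradX (barrier e b) p, gradX v p⟫ ∂(cylMeasure Ω)
      = ∫ p, b ^ 2 * Real.cos (b * ⟪e, p.1⟫) * barrierDecay b p.2 * v p ∂(cylMeasure Ω) := by
  have hc := hv.continuous
  have hc1 := hv.continuous_gradX
  have hc2 : Continuous (barrierDecay b) := contDiff_barrierDecay.continuous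
  have hcs1 : HasCompactSupport fun p => ⟪gradX (barrier e b) p, gradX v p⟫ :=
    hv.hasCompactSupport_gradX.mono fun p hp h' => hp (by simp only [h', inner_zero_right])
  have hcs2 : HasCompactSupport fun p : Euc n × ℝ =>
      b ^ 2 * Real.cos (b * ⟪e, p.1⟫) * barrierDecay b p.2 * v p :=
    hv.2.1.mono fun p hp h' => hp (by simp only [h', mul_zero])
  rw [integral_cyl_symm (by simp only [gradX_barrier]; fun_prop) hcs1,
    integral_cyl_symm (by fun_prop) hcs2]
  refine integral_congr_ae (ae_of_all _ fun y => ?_)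
  have hs := hv.slice y
  have h1 : ∀ x, HasFDerivAt (fun x : Euc n => -(barrierDecay b y * b) * Real.sin (b * ⟪e, x⟫))
      ((-(barrierDecay b y * b)) • Real.cos (b * ⟪e, x⟫) • b • innerSL ℝ e) x := fun x => by
    have h1 : HasFDerivAt (fun x : Euc n => b * ⟪e, x⟫) (b • innerSL ℝ e) x :=
      (innerSL ℝ e).hasFDerivAt.const_mul b
    exact h1.sin.const_mul _
  have h2 : ContDiff ℝ 1 fun x : Euc n => -(barrierDecay b y * b) * Real.sin (b * ⟪e, x⟫) :=
    contDiff_const.mul (Real.contDiff_sin.comp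
      (contDiff_const.mul (contDiff_const.inner ℝ contDiff_id)))
  have h3 := integral_mul_fderiv_of_hasCompactSupport (μ := volume) h2 hs.mul_smooth_contDiff hs.2.1 e
  simp only
  rw [integral_base_eq (fun x hx => by
      rw [hv.gradX_eq_zero (by simp [hx]), inner_zero_right]),
    integral_base_eq (fun x hx => by rw [hv.eq_zero (by simp [hx]), mul_zero])]
  refine Eq.trans (integral_congr_ae (ae_of_all _ fun x => ?_)) (h3.trans ?_)
  · simp only
    rw [gradX_barrier, ← inner_gradient, gradient_slice, smul_smul, inner_smul_left,
      real_inner_comm (gradX v (x, y)) e]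
    simp
    left
    ring
  · rw [← integral_neg]
    refine integral_congr_ae (ae_of_all _ fun x => ?_)
    simp only [(h1 x).fderiv]
    simp [he]
    left
    ring

/-- Vertical integration by parts leaves a boundary term at y = 0, because v has a trace there. This
term is the positive flux of the barrier that later outweighs the right-hand side of the equation.
-/
lemma integral_derivY_barrier {v : Euc n × ℝ → ℝ} (hv : IsTest (Ω ×ˢ (univ : Set ℝ)) v) :
    ∫ p, derivY (barrier e b) p * derivY v p ∂(cylMeasure Ω)
      = b / 3 * ∫ x, barrierTrace e b x * v (x, 0) ∂(baseMeasure Ω)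
        - ∫ p, (b / 3) ^ 2 * barrier e b p * v p ∂(cylMeasure Ω) := by
  have hc := hv.continuous
  have hc1 := hv.continuous_derivY
  have hc2 : Continuous (barrierDecay b) := contDiff_barrierDecay.continuous
  have hc3 : Continuous (barrier e b) := contDiff_barrier.continuous
  have hc4 : Continuous (barrierTrace e b) := contDiff_barrierTrace.continuous
  have hcs1 : HasCompactSupport fun p => derivY (barrier e b) p * derivY v p :=
    hv.hasCompactSupport_derivY.mono fun p hp h' => hp (by simp only [h', mul_zero])
  have hcs2 : HasCompactSupport fun p : Euc n × ℝ => (b / 3) ^ 2 * barrier e b p * v p :=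
    hv.2.1.mono fun p hp h' => hp (by simp only [h', mul_zero])
  have hct2 : Continuous fun p : Euc n × ℝ => (b / 3) ^ 2 * barrier e b p * v p := by fun_prop
  have hi2 : Integrable (fun x => ∫ y in Ioi (0 : ℝ), (b / 3) ^ 2 * barrier e b (x, y) * v (x, y))
      (baseMeasure Ω) := by
    have := integrable_cyl (Ω := Ω) hct2 hcs2
    rw [cylMeasure_eq] at this
    exact this.integral_prod_left
  have hi1 : Integrable (fun x => barrierTrace e b x * v (x, 0)) (baseMeasure Ω) :=
    Continuous.integrable_of_hasCompactSupport (by fun_prop)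
      ((hasCompactSupport_slice_left hv.2.1 0).mono fun p hp h' => hp (by simp only [h', mul_zero]))
  rw [integral_cyl (by simp only [derivY_barrier]; fun_prop) hcs1, integral_cyl hct2 hcs2,
    ← integral_const_mul, ← integral_sub (hi1.const_mul _) hi2]
  refine integral_congr_ae (ae_of_all _ fun x => ?_)
  have hd : ∀ y, HasDerivAt (fun y => barrierDecay b y * v (x, y))
      (-(b / 3) * barrierDecay b y * v (x, y) + barrierDecay b y * derivY v (x, y)) y := fun y =>
    (hasDerivAt_barrierDecay y).mul (hasDerivAt_derivY hv.differentiable x y)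
  have hs : ContDiff ℝ 1 fun y => barrierDecay b y * v (x, y) :=
    (contDiff_barrierDecay.mul (hv.1.comp (contDiff_const.prodMk contDiff_id))).of_le (by simp)
  have hsc : HasCompactSupport fun y => v (x, y) := hasCompactSupport_slice_right hv.2.1 x
  have hsc' : HasCompactSupport fun y => derivY v (x, y) :=
    hasCompactSupport_slice_right hv.hasCompactSupport_derivY x
  have h1 := HasCompactSupport.integral_Ioi_deriv_eq hs
    (hsc.mono fun p hp h' => hp (by simp only [h', mul_zero])) 0
  have j1 : Integrable (fun y => -(b / 3) * barrierDecay b y * v (x, y))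
      (volume.restrict (Ioi (0 : ℝ))) := Continuous.integrable_of_hasCompactSupport (by fun_prop)
    (hsc.mono fun p hp h' => hp (by simp only [h', mul_zero]))
  have j2 : Integrable (fun y => barrierDecay b y * derivY v (x, y))
      (volume.restrict (Ioi (0 : ℝ))) := Continuous.integrable_of_hasCompactSupport (by fun_prop)
    (hsc'.mono fun p hp h' => hp (by simp only [h', mul_zero]))
  simp only [(hd _).deriv] at h1
  rw [integral_add j1 j2] at h1
  have e1 : ∫ y in Ioi (0 : ℝ), derivY (barrier e b) (x, y) * derivY v (x, y)
      = -(b / 3) * barrierTrace e b x * ∫ y in Ioi (0 : ℝ), barrierDecay b y * derivY v (x, y) := by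
    rw [← integral_const_mul]
    refine integral_congr_ae (ae_of_all _ fun y => ?_)
    simp only [derivY_barrier, barrier]
    ring
  have e2 : ∫ y in Ioi (0 : ℝ), (b / 3) ^ 2 * barrier e b (x, y) * v (x, y)
      = -(b / 3) * barrierTrace e b x * ∫ y in Ioi (0 : ℝ), -(b / 3) * barrierDecay b y * v (x, y) := by
    rw [← integral_const_mul]
    refine integral_congr_ae (ae_of_all _ fun y => ?_)
    simp only [barrier]
    ring
  have e3 : barrierDecay b 0 = 1 := by simp [barrierDecay]
  simp only [e3, one_mul] at h1
  simp only [e1, e2]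
  linear_combination -(b / 3) * barrierTrace e b x * h1

/-- The barrier is a supersolution. -/
lemma le_integral_barrier {v : Euc n × ℝ → ℝ} (hΩm : MeasurableSet Ω) (he : ‖e‖ = 1) {R : ℝ}
    (hR : ∀ x ∈ Ω, ‖x‖ ≤ R) (hb : 0 ≤ b) (hbR : b * R ≤ 1) (hv : IsTest (Ω ×ˢ (univ : Set ℝ)) v)
    (hv0 : ∀ p, 0 ≤ v p) :
    b / 3 * ∫ x, barrierTrace e b x * v (x, 0) ∂(baseMeasure Ω)
      ≤ ∫ p, ⟪gradX (barrier e b) p, gradX v p⟫ ∂(cylMeasure Ω)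
        + ∫ p, derivY (barrier e b) p * derivY v p ∂(cylMeasure Ω) := by
  rw [integral_gradX_barrier he hv, integral_derivY_barrier hv]
  have hc := hv.continuous
  have hc2 : Continuous (barrierDecay b) := contDiff_barrierDecay.continuous
  have hc3 : Continuous (barrier e b) := contDiff_barrier.continuous
  have h1 : ∫ p, (b / 3) ^ 2 * barrier e b p * v p ∂(cylMeasure Ω)
      ≤ ∫ p, b ^ 2 * Real.cos (b * ⟪e, p.1⟫) * barrierDecay b p.2 * v p ∂(cylMeasure Ω) := by
    refine integral_mono_ae
      (integrable_cyl (by fun_prop) (hv.2.1.mono fun p hp h' => hp (by simp only [h', mul_zero])))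
      (integrable_cyl (by fun_prop) (hv.2.1.mono fun p hp h' => hp (by simp only [h', mul_zero]))) ?_
    refine (ae_restrict_iff' (hΩm.prod measurableSet_Ioi)).2 (ae_of_all _ fun p hp => ?_)
    simp only [barrier, barrierTrace]
    have h2 : |b * ⟪e, p.1⟫| ≤ 1 := by
      rw [abs_mul, abs_of_nonneg hb]
      refine le_trans ?_ hbR
      gcongr
      refine (abs_real_inner_le_norm _ _).trans ?_
      rw [he, one_mul]
      exact hR _ hp.1
    have h3 : 1 / 2 ≤ Real.cos (b * ⟪e, p.1⟫) := by
      have := Real.one_sub_sq_div_two_le_cos (x := b * ⟪e, p.1⟫)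
      have := (sq_le_one_iff_abs_le_one _).2 h2
      linarith
    refine mul_le_mul_of_nonneg_right ?_ (hv0 p)
    have h4 : 0 < barrierDecay b p.2 := Real.exp_pos _
    -- This pointwise superharmonicity amounts to cos ≥ 1/4, and cos ≥ 1/2 is available since the
    -- argument is at most 1 in absolute value. It is the reason for the slow decay rate b/3.
    have h5 : (b / 3) ^ 2 * (2 + Real.cos (b * ⟪e, p.1⟫)) ≤ b ^ 2 * Real.cos (b * ⟪e, p.1⟫) := by
      nlinarith [sq_nonneg b]
    nlinarith
  linarith

/-- The test function `ramp (φ - M Z)`, where `Z` is the barrier. -/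
def rampTest (e : Euc n) (b M : ℝ) (φ : Euc n × ℝ → ℝ) (p : Euc n × ℝ) : ℝ :=
  ramp (φ p - M * barrier e b p)

/-- Where φ vanishes the argument of the ramp is -M Z ≤ 0, so truncating above a positive barrier
does not enlarge the support. -/
lemma IsTest.rampTest {φ : Euc n × ℝ → ℝ} {U : Set (Euc n × ℝ)} (hφ : IsTest U φ) {M : ℝ}
    (hM : 0 ≤ M) : IsTest U (rampTest e b M φ) :=
  hφ.of_tsupport_subset (contDiff_ramp.comp (hφ.1.sub (contDiff_const.mul contDiff_barrier)))
    fun p hp => ramp_eq_zero (by rw [hp]; nlinarith [barrier_pos (e := e) (b := b) p])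

lemma gradX_rampTest {φ : Euc n × ℝ → ℝ} (hφ : Differentiable ℝ φ) (M : ℝ) (p : Euc n × ℝ) :
    gradX (rampTest e b M φ) p = Real.smoothTransition (φ p - M * barrier e b p) •
      (gradX φ p - M • gradX (barrier e b) p) := by
  have hZ : Differentiable ℝ (barrier e b) := contDiff_barrier.differentiable (by simp)
  have h1 : HasFDerivAt (fun x => rampTest e b M φ (x, p.2)) _ p.1 :=
    (hasDerivAt_ramp _).comp_hasFDerivAt p.1
      ((fderiv_slice_left hφ p).sub ((fderiv_slice_left hZ p).const_mul M))
  refine ext_inner_right ℝ fun v => ?_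
  rw [gradX, inner_gradient, h1.fderiv, inner_smul_left, inner_sub_left, inner_smul_left,
    inner_gradX hφ, inner_gradX hZ]
  simp

lemma derivY_rampTest {φ : Euc n × ℝ → ℝ} (hφ : Differentiable ℝ φ) (M : ℝ) (p : Euc n × ℝ) :
    derivY (rampTest e b M φ) p = Real.smoothTransition (φ p - M * barrier e b p) *
      (derivY φ p - M * derivY (barrier e b) p) := by
  have hZ : Differentiable ℝ (barrier e b) := contDiff_barrier.differentiable (by simp)
  exact ((hasDerivAt_ramp _).comp p.2 ((hasDerivAt_derivY hφ p.1 p.2).sub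
    ((hasDerivAt_derivY hZ p.1 p.2).const_mul M))).deriv

lemma inner_cylEmb (φ ψ : cylTest Ω) : ⟪cylEmb Ω φ, cylEmb Ω ψ⟫
    = ∫ p, ⟪gradX φ.1 p, gradX ψ.1 p⟫ ∂(cylMeasure Ω)
      + ∫ p, derivY φ.1 p * derivY ψ.1 p ∂(cylMeasure Ω) := by
  rw [Submodule.coe_inner, WithLp.prod_inner_apply]
  refine congrArg₂ (· + ·) ((L2.inner_def _ _).trans (integral_congr_ae ?_))
    ((inner_Lp_eq _ _).trans (integral_congr_ae ?_))
  · filter_upwards [(IsTest.memLp_gradX φ.2).coeFn_toLp, (IsTest.memLp_gradX ψ.2).coeFn_toLp]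
      with p h1 h2
    exact congrArg₂ _ h1 h2
  · filter_upwards [(IsTest.memLp_derivY φ.2).coeFn_toLp, (IsTest.memLp_derivY ψ.2).coeFn_toLp]
      with p h1 h2
    exact congrArg₂ _ h1 h2

/-- The comparison of a test function with the barrier. -/
lemma norm_rampTest_sq_add_le (hΩm : MeasurableSet Ω) (he : ‖e‖ = 1) {R : ℝ}
    (hR : ∀ x ∈ Ω, ‖x‖ ≤ R) (hb : 0 ≤ b) (hbR : b * R ≤ 1) {M : ℝ} (hM : 0 ≤ M) (φ : cylTest Ω) :
    ‖cylEmb Ω ⟨rampTest e b M φ.1, IsTest.rampTest φ.2 hM⟩‖ ^ 2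
      + M * (b / 3) * ∫ x, barrierTrace e b x * rampTest e b M φ.1 (x, 0) ∂(baseMeasure Ω)
      ≤ ⟪cylEmb Ω φ, cylEmb Ω ⟨rampTest e b M φ.1, IsTest.rampTest φ.2 hM⟩⟫ := by
  have hφ : IsTest (Ω ×ˢ (univ : Set ℝ)) φ.1 := φ.2
  have hv : IsTest (Ω ×ˢ (univ : Set ℝ)) (rampTest e b M φ.1) := hφ.rampTest hM
  set v := rampTest e b M φ.1
  have h1 := mul_le_mul_of_nonneg_left
    (le_integral_barrier hΩm he hR hb hbR hv fun p => ramp_nonneg _) hM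
  rw [norm_cylEmb_sq, inner_cylEmb]
  simp only
  have c1 := hφ.continuous_gradX
  have c2 := hφ.continuous_derivY
  have c3 := hv.continuous_gradX
  have c4 := hv.continuous_derivY
  have c5 : Continuous (gradX (barrier e b)) := by
    have : Continuous (barrierDecay b) := contDiff_barrierDecay.continuous
    simp only [funext gradX_barrier]
    fun_prop
  have c6 : Continuous (derivY (barrier e b)) := by
    have : Continuous (barrier e b) := contDiff_barrier.continuous
    simp only [funext derivY_barrier]
    fun_prop
  have i1 : Integrable (fun p => ‖gradX v p‖ ^ 2) (cylMeasure Ω) :=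
    integrable_cyl (by fun_prop) (hasCompactSupport_norm_sq hv.hasCompactSupport_gradX)
  have i2 : Integrable (fun p => derivY v p ^ 2) (cylMeasure Ω) :=
    integrable_cyl (by fun_prop) (by simpa using hasCompactSupport_norm_sq hv.hasCompactSupport_derivY)
  have i3 : Integrable (fun p => M * ⟪gradX (barrier e b) p, gradX v p⟫) (cylMeasure Ω) :=
    integrable_cyl (by fun_prop)
      (hv.hasCompactSupport_gradX.mono fun p hp h' => hp (by simp only [h', inner_zero_right, mul_zero]))
  have i4 : Integrable (fun p => M * (derivY (barrier e b) p * derivY v p)) (cylMeasure Ω) :=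
    integrable_cyl (by fun_prop)
      (hv.hasCompactSupport_derivY.mono fun p hp h' => hp (by simp only [h', mul_zero]))
  have i5 : Integrable (fun p => ⟪gradX φ.1 p, gradX v p⟫) (cylMeasure Ω) :=
    integrable_cyl (by fun_prop)
      (hv.hasCompactSupport_gradX.mono fun p hp h' => hp (by simp only [h', inner_zero_right]))
  have i6 : Integrable (fun p => derivY φ.1 p * derivY v p) (cylMeasure Ω) :=
    integrable_cyl (by fun_prop)
      (hv.hasCompactSupport_derivY.mono fun p hp h' => hp (by simp only [h', mul_zero]))
  have st0 := fun p => Real.smoothTransition.nonneg (φ.1 p - M * barrier e b p)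
  have st1 := fun p => Real.smoothTransition.le_one (φ.1 p - M * barrier e b p)
  have k1 : ∫ p, ‖gradX v p‖ ^ 2 ∂(cylMeasure Ω)
      + ∫ p, M * ⟪gradX (barrier e b) p, gradX v p⟫ ∂(cylMeasure Ω)
      ≤ ∫ p, ⟪gradX φ.1 p, gradX v p⟫ ∂(cylMeasure Ω) := by
    rw [← integral_add i1 i3]
    refine integral_mono (i1.add i3) i5 fun p => ?_
    simp only
    -- The truncation has gradient s A with 0 ≤ s ≤ 1, so |s A|² ≤ s |A|² = ⟪A, s A⟫.
    set s := Real.smoothTransition (φ.1 p - M * barrier e b p)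
    set A := gradX φ.1 p - M • gradX (barrier e b) p
    have e0 : gradX v p = s • A := gradX_rampTest hφ.differentiable M p
    have e1 : ⟪gradX φ.1 p, gradX v p⟫
        = ⟪A, gradX v p⟫ + M * ⟪gradX (barrier e b) p, gradX v p⟫ := by
      rw [inner_sub_left, real_inner_smul_left]; ring
    rw [e1]
    gcongr
    rw [e0, real_inner_smul_right, real_inner_self_eq_norm_sq, norm_smul, mul_pow,
      Real.norm_eq_abs, sq_abs]
    refine mul_le_mul_of_nonneg_right ?_ (sq_nonneg _)
    nlinarith [st0 p, st1 p]
  have k2 : ∫ p, derivY v p ^ 2 ∂(cylMeasure Ω)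
      + ∫ p, M * (derivY (barrier e b) p * derivY v p) ∂(cylMeasure Ω)
      ≤ ∫ p, derivY φ.1 p * derivY v p ∂(cylMeasure Ω) := by
    rw [← integral_add i2 i4]
    refine integral_mono (i2.add i4) i6 fun p => ?_
    simp only
    rw [← sub_nonneg, derivY_rampTest hφ.differentiable]
    have : 0 ≤ (Real.smoothTransition (φ.1 p - M * barrier e b p)
        * (1 - Real.smoothTransition (φ.1 p - M * barrier e b p)))
        * (derivY φ.1 p - M * derivY (barrier e b) p) ^ 2 :=
      mul_nonneg (mul_nonneg (st0 p) (by linarith [st1 p])) (sq_nonneg _)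
    nlinarith
  rw [integral_const_mul] at k1 k2
  linarith

end Barrier

/-! ### Essential boundedness of solutions -/

section Bounded

variable {n : ℕ} {Ω : Set (Euc n)} {e : Euc n} {b : ℝ}

/-- `barrierTrace` in `L²(Ω)`. -/
lemma memLp_barrierTrace (hΩ : Bornology.IsBounded Ω) :
    MemLp (barrierTrace e b) 2 (baseMeasure Ω) := by
  have := isFiniteMeasure_baseMeasure hΩ
  refine MemLp.of_bound contDiff_barrierTrace.continuous.aestronglyMeasurable 3
    (ae_of_all _ fun x => ?_)
  rw [Real.norm_of_nonneg (zero_le_one.trans (one_le_barrierTrace x))]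
  exact barrierTrace_le x

lemma memLp_ramp {α : Type*} [MeasurableSpace α] {μ : Measure α} {g : α → ℝ} (hg : MemLp g 2 μ) :
    MemLp (fun x => ramp (g x)) 2 μ := by
  refine hg.of_le (contDiff_ramp.continuous.comp_aestronglyMeasurable hg.1) (ae_of_all _ fun x => ?_)
  have := abs_ramp_sub_le 0 (g x)
  rwa [ramp_eq_zero le_rfl, sub_zero, sub_zero] at this

/-- The truncations l_j of approximations a_j of k are not known to converge in energy, only their
images under T are. Since ⟪k, l⟫ depends on T l alone, replacing a_j by k costs at most ‖a_j - k‖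
‖l_j‖, and the inequality itself bounds ‖l_j‖. -/
lemma limit_energy_inequality {H L : Type*} [NormedAddCommGroup H] [InnerProductSpace ℝ H]
    [NormedAddCommGroup L] [InnerProductSpace ℝ L] {T : H →L[ℝ] L} {s c : ℝ} {k : H} {G Z W : L}
    {a l : ℕ → H} (hk : ∀ l, ⟪k, l⟫ = ⟪G, T l⟫) (hs : ∀ l, s * ‖T l‖ ^ 2 ≤ ‖l‖ ^ 2)
    (ha : Tendsto a atTop (𝓝 k)) (hlim : Tendsto (fun j => T (l j)) atTop (𝓝 W))
    (hpos : ∀ j, 0 ≤ c * ⟪Z, T (l j)⟫)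
    (hmain : ∀ j, ‖l j‖ ^ 2 + c * ⟪Z, T (l j)⟫ ≤ ⟪a j, l j⟫) :
    s * ‖W‖ ^ 2 ≤ ⟪G - c • Z, W⟫ := by
  set δ : ℕ → ℝ := fun j => ‖a j - k‖
  have hδ : Tendsto δ atTop (𝓝 0) := tendsto_iff_norm_sub_tendsto_zero.1 ha
  have hδ0 : ∀ j, 0 ≤ δ j := fun j => norm_nonneg _
  have h1 : ∀ j, ‖l j‖ ^ 2 + c * ⟪Z, T (l j)⟫ ≤ ⟪G, T (l j)⟫ + δ j * ‖l j‖ := by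
    intro j
    have h2 : ⟪a j, l j⟫ = ⟪k, l j⟫ + ⟪a j - k, l j⟫ := by rw [inner_sub_left]; ring
    refine (hmain j).trans (h2.le.trans ?_)
    rw [hk]
    gcongr
    exact real_inner_le_norm _ _
  have hbd : ∀ j, ‖l j‖ ≤ ‖G‖ * ‖T‖ + δ j := by
    intro j
    have h3 : ⟪G, T (l j)⟫ ≤ ‖G‖ * (‖T‖ * ‖l j‖) :=
      (real_inner_le_norm _ _).trans (by gcongr; exact T.le_opNorm _)
    rcases (norm_nonneg (l j)).eq_or_lt with h4 | h4
    · rw [← h4]; have := hδ0 j; positivity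
    · refine le_of_mul_le_mul_right ?_ h4
      rw [← sq, add_mul, mul_assoc]
      linarith [h1 j, hpos j]
  have hineq : ∀ j, s * ‖T (l j)‖ ^ 2
      ≤ ⟪G - c • Z, T (l j)⟫ + δ j * (‖G‖ * ‖T‖ + δ j) := by
    intro j
    have h3 := mul_le_mul_of_nonneg_left (hbd j) (hδ0 j)
    rw [inner_sub_left, real_inner_smul_left]
    linarith [h1 j, hs (l j)]
  have hfin : s * ‖W‖ ^ 2 ≤ ⟪G - c • Z, W⟫ + 0 * (‖G‖ * ‖T‖ + 0) :=
    le_of_tendsto_of_tendsto' ((hlim.norm.pow 2).const_mul _)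
      ((tendsto_const_nhds.inner hlim).add (hδ.mul (tendsto_const_nhds.add hδ))) hineq
  simpa using hfin

/-- The equation is tested with smooth truncations of test functions approximating k. The ramp is
1-Lipschitz, so their traces converge to the truncation of the trace; the energy on the left is
bounded below by the spectral inequality for traces. -/
lemma IsAdmissible.ramp_inequality (h : IsAdmissible Ω) (hΩ : IsOpen Ω) (hne : Ω.Nonempty)
    (he : ‖e‖ = 1) {R : ℝ} (hR : ∀ x ∈ Ω, ‖x‖ ≤ R) (hb : 0 ≤ b) (hbR : b * R ≤ 1) {M : ℝ}
    (hM : 0 ≤ M) {k : energySpace Ω} {G : Lp ℝ 2 (baseMeasure Ω)}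
    (hk : ∀ l, ⟪k, l⟫ = ⟪G, energyTrace Ω l⟫) :
    √(firstEigenvalue Ω) * ∫ x, ramp (energyTrace Ω k x - M * barrierTrace e b x) ^ 2
        ∂(baseMeasure Ω)
      ≤ ∫ x, (G x - M * (b / 3) * barrierTrace e b x)
        * ramp (energyTrace Ω k x - M * barrierTrace e b x) ∂(baseMeasure Ω) := by
  have hζ := memLp_barrierTrace (e := e) (b := b) h.bounded
  set ζ := barrierTrace e b
  set T := energyTrace Ω
  set ev := firstEigenvalue Ω
  have hs : MemLp (fun x => T k x - M * ζ x) 2 (baseMeasure Ω) := (Lp.memLp _).sub (hζ.const_mul M)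
  set W : Lp ℝ 2 (baseMeasure Ω) := (memLp_ramp hs).toLp _
  have hW : W =ᵐ[baseMeasure Ω] fun x => ramp (T k x - M * ζ x) := MemLp.coeFn_toLp _
  set Z : Lp ℝ 2 (baseMeasure Ω) := hζ.toLp _
  have hZ : Z =ᵐ[baseMeasure Ω] ζ := MemLp.coeFn_toLp _
  obtain ⟨φ, hφ⟩ := exists_seq_tendsto_of_denseRange denseRange_cylEmb k
  set v : ℕ → cylTest Ω := fun j => ⟨rampTest e b M (φ j).1, IsTest.rampTest (φ j).2 hM⟩
  set l : ℕ → energySpace Ω := fun j => cylEmb Ω (v j)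
  have hTl : ∀ j, T (l j) = cylTrace Ω (v j) := fun j => h.energyTrace_cylEmb _
  have hTv : ∀ j, cylTrace Ω (v j) =ᵐ[baseMeasure Ω] fun x => ramp ((φ j).1 (x, 0) - M * ζ x) := by
    intro j
    have : cylTrace Ω (v j) =ᵐ[baseMeasure Ω] fun x => (v j).1 (x, 0) :=
      (IsTest.memLp_trace (v j).2).coeFn_toLp
    filter_upwards [this] with x hx
    rw [hx]
    change ramp _ = _
    rw [barrier_zero]
  have hlim : Tendsto (fun j => T (l j)) atTop (𝓝 W) := by
    rw [tendsto_iff_norm_sub_tendsto_zero]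
    have h1 : Tendsto (fun j => ‖T (cylEmb Ω (φ j)) - T k‖) atTop (𝓝 0) :=
      tendsto_iff_norm_sub_tendsto_zero.1 ((T.continuous.tendsto k).comp hφ)
    refine squeeze_zero (fun _ => norm_nonneg _) (fun j => ?_) h1
    refine Lp.norm_le_norm_of_ae_le ?_
    have e1 : T (cylEmb Ω (φ j)) =ᵐ[baseMeasure Ω] fun x => (φ j).1 (x, 0) := by
      rw [show T (cylEmb Ω (φ j)) = cylTrace Ω (φ j) from h.energyTrace_cylEmb _]
      exact (IsTest.memLp_trace (φ j).2).coeFn_toLp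
    filter_upwards [Lp.coeFn_sub (T (l j)) W, Lp.coeFn_sub (T (cylEmb Ω (φ j))) (T k), e1, hTv j, hW]
      with x h2 h3 h4 h5 h6
    rw [h2, h3, Pi.sub_apply, Pi.sub_apply, h4, hTl, h5, h6, Real.norm_eq_abs, Real.norm_eq_abs]
    refine (abs_ramp_sub_le _ _).trans_eq ?_
    congr 1
    ring
  have hpos : ∀ j, 0 ≤ M * (b / 3) * ∫ x, ζ x * rampTest e b M (φ j).1 (x, 0) ∂(baseMeasure Ω) := by
    intro j
    refine mul_nonneg (by positivity) (integral_nonneg fun x => mul_nonneg ?_ (ramp_nonneg _))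
    exact zero_le_one.trans (one_le_barrierTrace x)
  have hZv : ∀ j, ∫ x, ζ x * rampTest e b M (φ j).1 (x, 0) ∂(baseMeasure Ω) = ⟪Z, T (l j)⟫ := by
    intro j
    rw [inner_Lp_eq]
    refine integral_congr_ae ?_
    have : cylTrace Ω (v j) =ᵐ[baseMeasure Ω] fun x => (v j).1 (x, 0) :=
      (IsTest.memLp_trace (v j).2).coeFn_toLp
    filter_upwards [hZ, this] with x h1 h2
    rw [h1, hTl, h2]
  have hfin := limit_energy_inequality (c := M * (b / 3)) (Z := Z) hk
    (h.sqrt_firstEigenvalue_mul_le hΩ hne) hφ hlim (fun j => by rw [← hZv]; exact hpos j)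
    fun j => by
      rw [← hZv]
      exact norm_rampTest_sq_add_le hΩ.measurableSet he hR hb hbR hM (φ j)
  rw [norm_Lp_real_sq, inner_Lp_eq] at hfin
  refine le_of_eq_of_le ?_ (hfin.trans_eq ?_)
  · congr 1
    refine integral_congr_ae ?_
    filter_upwards [hW] with x hx
    rw [hx]
  · refine integral_congr_ae ?_
    filter_upwards [hW, hZ, Lp.coeFn_sub G ((M * (b / 3)) • Z), Lp.coeFn_smul (M * (b / 3)) Z]
      with x h1 h2 h3 h4
    rw [h1, h3, Pi.sub_apply, h4, Pi.smul_apply, h2, smul_eq_mul]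

/-- One-sided bound for weak solutions with a right-hand side of small slope at infinity. -/
lemma IsAdmissible.exists_upper_bound (h : IsAdmissible Ω) (hΩ : IsOpen Ω) (hne : Ω.Nonempty) :
    ∃ ε > 0, ∀ (k : energySpace Ω) (G : Lp ℝ 2 (baseMeasure Ω)) (M : ℝ),
      (∀ l, ⟪k, l⟫ = ⟪G, energyTrace Ω l⟫) →
      (∀ᵐ x ∂(baseMeasure Ω), M ≤ |energyTrace Ω k x| → |G x| ≤ ε * |energyTrace Ω k x|) →
      ∃ C, ∀ᵐ x ∂(baseMeasure Ω), energyTrace Ω k x ≤ C := by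
  obtain ⟨R, hR0, hR⟩ := h.exists_radius
  obtain ⟨e, he⟩ : ∃ e : Euc n, ‖e‖ = 1 := ⟨EuclideanSpace.single ⟨0, h.pos⟩ 1, by simp⟩
  set b := 1 / R
  have hb : 0 < b := by positivity
  have hbR : b * R ≤ 1 := (one_div_mul_cancel hR0.ne').le
  have hev : 0 < firstEigenvalue Ω := by
    obtain ⟨_, _, -, -, -, -, hpos, -⟩ := h.exists_dirichlet_basis hΩ hne
    exact hpos
  have hsq : 0 < √(firstEigenvalue Ω) := Real.sqrt_pos.2 hev
  -- The bound b/6 lets the barrier's flux dominate the right-hand side; √λ₁/4 lets the remainder 2ε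
  -- ∫ W² be absorbed by the left side.
  set ε := min (b / 6) (√(firstEigenvalue Ω) / 4)
  have hε : 0 < ε := by positivity
  have hε1 : 2 * ε ≤ b / 3 := by have := min_le_left (b / 6) (√(firstEigenvalue Ω) / 4); linarith
  have hε2 : 4 * ε ≤ √(firstEigenvalue Ω) := by
    have := min_le_right (b / 6) (√(firstEigenvalue Ω) / 4); linarith
  refine ⟨ε, hε, fun k G M₀ hk hG => ?_⟩
  -- Above M₀ the slope bound on G holds. M ≥ 2 serves the region where the solution exceeds M times
  -- the barrier by less than 2.
  set M := max M₀ 2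
  have hM2 : 2 ≤ M := le_max_right _ _
  have h1 := h.ramp_inequality hΩ hne he hR hb.le hbR (zero_le_two.trans hM2) hk
  set W := fun x => ramp (energyTrace Ω k x - M * barrierTrace e b x)
  have hζ := memLp_barrierTrace (e := e) (b := b) h.bounded
  have hWm : MemLp W 2 (baseMeasure Ω) :=
    memLp_ramp ((Lp.memLp (energyTrace Ω k)).sub (hζ.const_mul M))
  have hpt : ∀ᵐ x ∂(baseMeasure Ω), (G x - M * (b / 3) * barrierTrace e b x) * W x
      ≤ 2 * ε * W x ^ 2 := by
    filter_upwards [hG] with x hx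
    have hW0 : 0 ≤ W x := ramp_nonneg _
    rcases le_or_gt (energyTrace Ω k x - M * barrierTrace e b x) 0 with hs | hs
    · have : W x = 0 := ramp_eq_zero hs
      rw [this]; simp
    have hζ1 := one_le_barrierTrace (e := e) (b := b) x
    have hu : M * barrierTrace e b x < energyTrace Ω k x := by linarith
    have hMζ : M ≤ M * barrierTrace e b x := le_mul_of_one_le_right (by linarith) hζ1
    have huM : M₀ ≤ |energyTrace Ω k x| :=
      ((le_max_left _ _).trans (hMζ.trans hu.le)).trans (le_abs_self _)
    have h2 := (le_abs_self _).trans (hx huM)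
    rw [abs_of_pos (by linarith)] at h2
    rw [sq, ← mul_assoc]
    refine mul_le_mul_of_nonneg_right ?_ hW0
    have h3 : 2 * ε * (M * barrierTrace e b x) ≤ b / 3 * (M * barrierTrace e b x) :=
      mul_le_mul_of_nonneg_right hε1 (by linarith)
    rcases le_or_gt 2 (energyTrace Ω k x - M * barrierTrace e b x) with hs2 | hs2
    · have h4 : _ ≤ W x := half_le_ramp hs2
      nlinarith
    · have : 0 ≤ 2 * ε * W x := by positivity
      nlinarith
  have h2 : √(firstEigenvalue Ω) * ∫ x, W x ^ 2 ∂(baseMeasure Ω)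
      ≤ 2 * ε * ∫ x, W x ^ 2 ∂(baseMeasure Ω) := by
    refine h1.trans ?_
    rw [← integral_const_mul]
    exact integral_mono_ae (integrable_mul_of_memLp_two
      ((Lp.memLp G).sub (hζ.const_mul (M * (b / 3)))) hWm) (hWm.integrable_sq.const_mul _) hpt
  have h3 : ∫ x, W x ^ 2 ∂(baseMeasure Ω) = 0 := by
    have : 0 ≤ ∫ x, W x ^ 2 ∂(baseMeasure Ω) := integral_nonneg fun x => sq_nonneg _
    nlinarith
  rw [integral_eq_zero_iff_of_nonneg (fun x => sq_nonneg _) hWm.integrable_sq] at h3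
  -- The ramp of the excess vanishes, so the excess is below 2, and the barrier is at most 3 on the
  -- bottom.
  refine ⟨M * 3 + 2, ?_⟩
  filter_upwards [h3] with x hx
  have hx0 : W x = 0 := by simpa using hx
  by_contra! hc
  have h4 := barrierTrace_le (e := e) (b := b) x
  have h5 : 2 ≤ energyTrace Ω k x - M * barrierTrace e b x := by nlinarith
  have h6 : _ ≤ W x := half_le_ramp h5
  linarith

/-- Weak solutions with a right-hand side of small slope at infinity are bounded. -/
theorem IsAdmissible.exists_memLp_top (h : IsAdmissible Ω) (hΩ : IsOpen Ω) (hne : Ω.Nonempty) :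
    ∃ ε > 0, ∀ (k : energySpace Ω) (G : Lp ℝ 2 (baseMeasure Ω)) (M : ℝ),
      (∀ l, ⟪k, l⟫ = ⟪G, energyTrace Ω l⟫) →
      (∀ᵐ x ∂(baseMeasure Ω), M ≤ |energyTrace Ω k x| → |G x| ≤ ε * |energyTrace Ω k x|) →
      MemLp (energyTrace Ω k) ∞ (baseMeasure Ω) := by
  obtain ⟨ε, hε, H⟩ := h.exists_upper_bound hΩ hne
  refine ⟨ε, hε, fun k G M hk hG => ?_⟩
  obtain ⟨C₁, hC₁⟩ := H k G M hk hG
  obtain ⟨C₂, hC₂⟩ := H (-k) (-G) M (fun l => by rw [inner_neg_left, inner_neg_left, hk]) (by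
    rw [map_neg]
    filter_upwards [hG, Lp.coeFn_neg G, Lp.coeFn_neg (energyTrace Ω k)] with x h1 h2 h3
    rw [h2, h3, Pi.neg_apply, Pi.neg_apply, abs_neg, abs_neg]
    exact h1)
  refine memLp_top_of_bound (Lp.aestronglyMeasurable _) (max C₁ C₂) ?_
  rw [map_neg] at hC₂
  filter_upwards [hC₁, hC₂, Lp.coeFn_neg (energyTrace Ω k)] with x h1 h2 h3
  rw [h3, Pi.neg_apply] at h2
  exact abs_le.2 ⟨by linarith [le_max_right C₁ C₂], h1.trans (le_max_left _ _)⟩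

end Bounded

/-! ### The truncated cone -/

section Cone

/-- A smooth approximation of the indicator function of `(a, b)`, supported in `[a, b)`. -/
def bump (a b : ℝ) (k : ℕ) (r : ℝ) : ℝ :=
  Real.smoothTransition ((k + 1) * (r - a)) * Real.smoothTransition ((k + 1) * (b - r) - 1)

variable {a b : ℝ}

lemma contDiff_bump (k : ℕ) : ContDiff ℝ ∞ (bump a b k) :=
  (Real.smoothTransition.contDiff.comp (by fun_prop)).mul
    (Real.smoothTransition.contDiff.comp (by fun_prop))

lemma bump_nonneg (k : ℕ) (r : ℝ) : 0 ≤ bump a b k r :=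
  mul_nonneg (Real.smoothTransition.nonneg _) (Real.smoothTransition.nonneg _)

lemma bump_le_one (k : ℕ) (r : ℝ) : bump a b k r ≤ 1 :=
  mul_le_one₀ (Real.smoothTransition.le_one _) (Real.smoothTransition.nonneg _)
    (Real.smoothTransition.le_one _)

lemma bump_eq_zero_left (k : ℕ) {r : ℝ} (hr : r ≤ a) : bump a b k r = 0 := by
  rw [bump, Real.smoothTransition.zero_of_nonpos, zero_mul]
  exact mul_nonpos_of_nonneg_of_nonpos (by positivity) (by linarith)

/-- The shift by -1 in the second factor of `bump` stops it strictly before b; this margin gives the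
smooth cones compact support inside the open ball. -/
lemma bump_eq_zero_right (k : ℕ) {r : ℝ} (hr : b - 1 / (k + 1) ≤ r) : bump a b k r = 0 := by
  rw [bump, Real.smoothTransition.zero_of_nonpos (x := (k + 1) * (b - r) - 1), mul_zero]
  have h0 : (0 : ℝ) < k + 1 := by positivity
  have : b - r ≤ 1 / (k + 1) := by linarith
  rw [le_div_iff₀ h0] at this
  linarith

lemma tendsto_bump (r : ℝ) :
    Tendsto (fun k => bump a b k r) atTop (𝓝 ((Ioo a b).indicator (fun _ => 1) r)) := by
  by_cases hr : r ∈ Ioo a b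
  · rw [indicator_of_mem hr]
    refine tendsto_const_nhds.congr' ?_
    have h1 : Tendsto (fun k : ℕ => ((k : ℝ) + 1) * (r - a)) atTop atTop :=
      (tendsto_natCast_atTop_atTop.atTop_add tendsto_const_nhds).atTop_mul_const (by linarith [hr.1])
    have h2 : Tendsto (fun k : ℕ => ((k : ℝ) + 1) * (b - r)) atTop atTop :=
      (tendsto_natCast_atTop_atTop.atTop_add tendsto_const_nhds).atTop_mul_const (by linarith [hr.2])
    filter_upwards [h1.eventually_ge_atTop 1, h2.eventually_ge_atTop 2] with k hk1 hk2
    rw [bump, Real.smoothTransition.one_of_one_le hk1,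
      Real.smoothTransition.one_of_one_le (by linarith), one_mul]
  · rw [indicator_of_notMem hr]
    refine tendsto_const_nhds.congr fun k => ?_
    rcases le_or_gt r a with h | h
    · exact (bump_eq_zero_left k h).symm
    · refine (bump_eq_zero_right k ?_).symm
      have : b ≤ r := not_lt.1 fun h' => hr ⟨h, h'⟩
      have : (0 : ℝ) < 1 / (k + 1) := by positivity
      linarith

/-- A smooth approximation of the profile of the truncated cone of slope one. -/
def profile (a b : ℝ) (k : ℕ) (r : ℝ) : ℝ := -∫ s in b..r, bump a b k s

lemma hasDerivAt_profile (k : ℕ) (r : ℝ) : HasDerivAt (profile a b k) (-bump a b k r) r :=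
  (intervalIntegral.integral_hasDerivAt_right ((contDiff_bump k).continuous.intervalIntegrable _ _)
    ((contDiff_bump k).continuous.stronglyMeasurableAtFilter _ _)
    (contDiff_bump k).continuous.continuousAt).neg

lemma contDiff_profile (k : ℕ) : ContDiff ℝ ∞ (profile a b k) := by
  rw [contDiff_infty_iff_deriv, funext fun s => (hasDerivAt_profile (a := a) (b := b) k s).deriv]
  exact ⟨fun s => (hasDerivAt_profile k s).differentiableAt, (contDiff_bump k).neg⟩

lemma profile_eq_zero (k : ℕ) {r : ℝ} (hr : b - 1 / (k + 1) ≤ r) : profile a b k r = 0 := by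
  have h0 : (0 : ℝ) < 1 / (k + 1) := by positivity
  rw [profile, intervalIntegral.integral_congr (g := fun _ => 0), intervalIntegral.integral_zero,
    neg_zero]
  intro s hs
  refine bump_eq_zero_right k (le_trans ?_ hs.1)
  exact le_min (by linarith) hr

lemma profile_eq_const (k : ℕ) {r : ℝ} (hr : r ≤ a) : profile a b k r = profile a b k a := by
  have hi : ∀ c d, IntervalIntegrable (bump a b k) volume c d := fun c d =>
    (contDiff_bump k).continuous.intervalIntegrable _ _
  have h1 := intervalIntegral.integral_add_adjacent_intervals (hi b r) (hi r a)
  have h2 : ∫ s in r..a, bump a b k s = 0 := by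
    rw [intervalIntegral.integral_congr (g := fun _ => 0), intervalIntegral.integral_zero]
    intro s hs
    rw [uIcc_of_le hr] at hs
    exact bump_eq_zero_left k hs.2
  rw [profile, profile, ← h1, h2, add_zero]

lemma tendsto_profile (r : ℝ) : Tendsto (fun k => profile a b k r) atTop
    (𝓝 (-∫ s in b..r, (Ioo a b).indicator (fun _ => 1) s)) := by
  refine (intervalIntegral.tendsto_integral_filter_of_dominated_convergence (fun _ => 1)
    (Eventually.of_forall fun k => (contDiff_bump k).continuous.aestronglyMeasurable)
    (Eventually.of_forall fun k => ae_of_all _ fun s _ => ?_) (by simp)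
    (ae_of_all _ fun s _ => tendsto_bump s)).neg
  rw [Real.norm_of_nonneg (bump_nonneg k s)]
  exact bump_le_one k s

lemma integral_indicator_of_le_left (hab : a ≤ b) {r : ℝ} (hr : r ≤ a) :
    -∫ s in b..r, (Ioo a b).indicator (fun _ => (1 : ℝ)) s = b - a := by
  rw [← intervalIntegral.integral_symm, intervalIntegral.integral_of_le (hr.trans hab),
    setIntegral_indicator measurableSet_Ioo, inter_eq_right.2
      (show Ioo a b ⊆ Ioc r b from fun s hs => ⟨hr.trans_lt hs.1, hs.2.le⟩)]
  simp [hab]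

lemma integral_indicator_of_mem {r : ℝ} (har : a ≤ r) (hrb : r ≤ b) :
    -∫ s in b..r, (Ioo a b).indicator (fun _ => (1 : ℝ)) s = b - r := by
  rw [← intervalIntegral.integral_symm, intervalIntegral.integral_of_le hrb,
    setIntegral_indicator measurableSet_Ioo]
  have : Ioc r b ∩ Ioo a b = Ioo r b := by
    ext s
    simp only [mem_inter_iff, mem_Ioc, mem_Ioo]
    constructor
    · rintro ⟨⟨h1, -⟩, -, h2⟩; exact ⟨h1, h2⟩
    · rintro ⟨h1, h2⟩; exact ⟨⟨h1, h2.le⟩, by linarith, h2⟩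
  rw [this]
  simp [hrb]

lemma integral_indicator_of_ge {r : ℝ} (hr : b ≤ r) :
    -∫ s in b..r, (Ioo a b).indicator (fun _ => (1 : ℝ)) s = 0 := by
  rw [intervalIntegral.integral_of_le hr, setIntegral_indicator measurableSet_Ioo]
  have : Ioc b r ∩ Ioo a b = ∅ := by
    ext s
    simp only [mem_inter_iff, mem_Ioc, mem_Ioo, mem_empty_iff_false, iff_false]
    rintro ⟨⟨h1, -⟩, -, h2⟩
    linarith
  rw [this]
  simp

variable {n : ℕ} {Ω : Set (Euc n)} {x₀ : Euc n}

/-- A smooth radial approximation of the truncated cone of slope one. -/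
def smoothCone (x₀ : Euc n) (a b : ℝ) (k : ℕ) (x : Euc n) : ℝ := profile a b k ‖x - x₀‖

lemma smoothCone_eventuallyEq (k : ℕ) {x : Euc n} (hx : ‖x - x₀‖ < a) :
    smoothCone x₀ a b k =ᶠ[𝓝 x] fun _ => profile a b k a := by
  have : Metric.ball x₀ a ∈ 𝓝 x := Metric.isOpen_ball.mem_nhds (by rwa [mem_ball_iff_norm])
  filter_upwards [this] with z hz
  rw [mem_ball_iff_norm] at hz
  exact profile_eq_const k hz.le

/-- Near x₀, where the norm is not differentiable, the profile is constant; this is why the inner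
radius must be positive. -/
lemma contDiff_smoothCone (ha : 0 < a) (k : ℕ) : ContDiff ℝ ∞ (smoothCone x₀ a b k) := by
  refine contDiff_iff_contDiffAt.2 fun x => ?_
  rcases lt_or_ge ‖x - x₀‖ a with hx | hx
  · exact contDiffAt_const.congr_of_eventuallyEq (smoothCone_eventuallyEq k hx)
  · have hx0 : x - x₀ ≠ 0 := norm_pos_iff.1 (ha.trans_le hx)
    exact (contDiff_profile k).contDiffAt.comp x
      ((contDiffAt_id.sub contDiffAt_const).norm ℝ hx0)

lemma gradient_smoothCone (ha : 0 < a) (k : ℕ) (x : Euc n) : gradient (smoothCone x₀ a b k) x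
    = (-bump a b k ‖x - x₀‖) • ‖x - x₀‖⁻¹ • (x - x₀) := by
  rcases lt_or_ge ‖x - x₀‖ a with hx | hx
  · rw [bump_eq_zero_left k hx.le, gradient_eq_symm, (smoothCone_eventuallyEq k hx).fderiv_eq]
    simp
  · have hx0 : 0 < ‖x - x₀‖ := ha.trans_le hx
    have h1 : HasFDerivAt (fun z : Euc n => ‖z - x₀‖ ^ 2) (2 • innerSL ℝ (x - x₀)) x :=
      (((hasFDerivAt_id x).sub_const x₀).norm_sq).congr_fderiv (by ext; simp)
    have h2 : HasFDerivAt (fun z : Euc n => ‖z - x₀‖) (‖x - x₀‖⁻¹ • innerSL ℝ (x - x₀)) x := by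
      have h3 := h1.sqrt (by positivity)
      simp only [Real.sqrt_sq (norm_nonneg _)] at h3
      refine h3.congr_fderiv ?_
      ext v
      simp
      field_simp
    have h4 : HasFDerivAt (smoothCone x₀ a b k) _ x := (hasDerivAt_profile k _).comp_hasFDerivAt x h2
    refine ext_inner_right ℝ fun v => ?_
    rw [inner_gradient, h4.fderiv, real_inner_smul_left, real_inner_smul_left]
    simp [inner_sub_left]

lemma isTest_smoothCone (ha : 0 < a) (hΩ : Metric.ball x₀ b ⊆ Ω) (k : ℕ) :
    IsTest Ω (smoothCone x₀ a b k) := by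
  have h0 : (0 : ℝ) < 1 / (k + 1) := by positivity
  have hs : tsupport (smoothCone x₀ a b k) ⊆ Metric.closedBall x₀ (b - 1 / (k + 1)) := by
    refine closure_minimal (fun x hx => ?_) Metric.isClosed_closedBall
    rw [mem_closedBall_iff_norm]
    by_contra! hc
    exact hx (profile_eq_zero k hc.le)
  refine ⟨contDiff_smoothCone ha k, ?_, hs.trans
    ((Metric.closedBall_subset_ball (by linarith)).trans hΩ)⟩
  exact (isCompact_closedBall x₀ _).of_isClosed_subset (isClosed_tsupport _) hs

/-- The gradient of the truncated cone of slope one. -/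
def coneGrad (x₀ : Euc n) (a b : ℝ) (x : Euc n) : Euc n :=
  (-(Ioo a b).indicator (fun _ => (1 : ℝ)) ‖x - x₀‖) • ‖x - x₀‖⁻¹ • (x - x₀)

lemma measurable_coneGrad : Measurable (coneGrad x₀ a b) := by
  have h1 : Measurable ((Ioo a b).indicator (fun _ => (1 : ℝ))) :=
    measurable_const.indicator measurableSet_Ioo
  have h2 : Measurable fun x : Euc n => (Ioo a b).indicator (fun _ => (1 : ℝ)) ‖x - x₀‖ :=
    h1.comp (by fun_prop)
  unfold coneGrad
  fun_prop

lemma norm_coneGrad_sq (ha : 0 < a) (x : Euc n) :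
    ‖coneGrad x₀ a b x‖ ^ 2 = (Metric.ball x₀ b \ Metric.closedBall x₀ a).indicator (fun _ => 1) x := by
  rw [coneGrad, norm_smul, norm_neg]
  have hmem : ‖x - x₀‖ ∈ Ioo a b ↔ x ∈ Metric.ball x₀ b \ Metric.closedBall x₀ a := by
    rw [Set.mem_sdiff, mem_ball_iff_norm, mem_closedBall_iff_norm, not_le, mem_Ioo, and_comm]
  by_cases hx : ‖x - x₀‖ ∈ Ioo a b
  · rw [indicator_of_mem hx, indicator_of_mem (hmem.1 hx), norm_smul, norm_inv, norm_norm,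
      inv_mul_cancel₀ (ha.trans hx.1).ne']
    simp
  · rw [indicator_of_notMem hx, indicator_of_notMem (fun h => hx (hmem.2 h))]
    simp

lemma norm_coneGrad_le (ha : 0 < a) (x : Euc n) : ‖coneGrad x₀ a b x‖ ≤ 1 := by
  rw [← sq_le_one_iff₀ (norm_nonneg _), norm_coneGrad_sq ha]
  exact indicator_le_self' (f := fun _ => (1 : ℝ)) (fun _ _ => zero_le_one) x

/-- The truncated cone of slope one. -/
def cone (x₀ : Euc n) (a b : ℝ) (x : Euc n) : ℝ :=
  -∫ s in b..‖x - x₀‖, (Ioo a b).indicator (fun _ => (1 : ℝ)) s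

lemma tendsto_smoothCone (x : Euc n) :
    Tendsto (fun k => smoothCone x₀ a b k x) atTop (𝓝 (cone x₀ a b x)) := tendsto_profile _

lemma cone_nonneg (hab : a ≤ b) (x : Euc n) : 0 ≤ cone x₀ a b x := by
  rcases le_total ‖x - x₀‖ a with h | h
  · rw [cone, integral_indicator_of_le_left hab h]; linarith
  rcases le_total ‖x - x₀‖ b with h' | h'
  · rw [cone, integral_indicator_of_mem h h']; linarith
  · rw [cone, integral_indicator_of_ge h']

lemma cone_le (hab : a ≤ b) (x : Euc n) : cone x₀ a b x ≤ b - a := by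
  rcases le_total ‖x - x₀‖ a with h | h
  · rw [cone, integral_indicator_of_le_left hab h]
  rcases le_total ‖x - x₀‖ b with h' | h'
  · rw [cone, integral_indicator_of_mem h h']; linarith
  · rw [cone, integral_indicator_of_ge h']; linarith

lemma abs_profile_le (k : ℕ) (r : ℝ) : |profile a b k r| ≤ |b - r| := by
  have := intervalIntegral.norm_integral_le_of_norm_le_const (a := b) (b := r) (C := 1)
    (f := bump a b k) fun s _ => by
      rw [Real.norm_of_nonneg (bump_nonneg k s)]; exact bump_le_one k s
  rw [profile, abs_neg, abs_sub_comm]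
  simpa using this

lemma abs_smoothCone_le (hab : a ≤ b) (k : ℕ) (x : Euc n) : |smoothCone x₀ a b k x| ≤ b - a := by
  rw [smoothCone]
  rcases le_total ‖x - x₀‖ a with h | h
  · rw [profile_eq_const k h]
    exact (abs_profile_le k a).trans_eq (abs_of_nonneg (by linarith))
  rcases le_total ‖x - x₀‖ b with h' | h'
  · refine (abs_profile_le k _).trans ?_
    rw [abs_of_nonneg (by linarith)]
    linarith
  · have h0 : (0 : ℝ) < 1 / (k + 1) := by positivity
    rw [profile_eq_zero k (by linarith), abs_zero]
    linarith

/-- Smooth cones and their gradients are uniformly bounded on a set of finite measure and converge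
pointwise, so dominated convergence yields both L² limits. -/
lemma isH01_cone (hb : Bornology.IsBounded Ω) (ha : 0 < a) (hab : a ≤ b)
    (hΩ : Metric.ball x₀ b ⊆ Ω) : IsH01 Ω (cone x₀ a b) (coneGrad x₀ a b) := by
  have := isFiniteMeasure_baseMeasure hb
  have hmeas : StronglyMeasurable (cone x₀ a b) :=
    stronglyMeasurable_of_tendsto atTop
      (fun k => (contDiff_smoothCone ha k).continuous.stronglyMeasurable)
      (tendsto_pi_nhds.2 fun x => tendsto_smoothCone x)
  have m1 : MemLp (cone x₀ a b) 2 (baseMeasure Ω) :=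
    MemLp.of_bound hmeas.aestronglyMeasurable (b - a) (ae_of_all _ fun x => by
      rw [Real.norm_of_nonneg (cone_nonneg hab x)]; exact cone_le hab x)
  have m2 : MemLp (coneGrad x₀ a b) 2 (baseMeasure Ω) :=
    MemLp.of_bound measurable_coneGrad.aestronglyMeasurable 1 (ae_of_all _ (norm_coneGrad_le ha))
  have ht := fun k => isTest_smoothCone (Ω := Ω) (x₀ := x₀) ha hΩ k
  have h1 : Tendsto (fun k => eLpNorm (fun x => smoothCone x₀ a b k x - cone x₀ a b x) 2
      (baseMeasure Ω)) atTop (𝓝 0) := by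
    refine tendsto_eLpNorm_of_dominated (g := fun _ => (b - a) + (b - a))
      (fun k => (ht k).memLp.1) m1.1 (memLp_const _)
      (fun k => ae_of_all _ fun x => ?_) (ae_of_all _ fun x => tendsto_smoothCone x)
    refine (norm_sub_le _ _).trans (add_le_add (abs_smoothCone_le hab k x) ?_)
    rw [Real.norm_of_nonneg (cone_nonneg hab x)]
    exact cone_le hab x
  have h2 : Tendsto (fun k => eLpNorm (fun x => gradient (smoothCone x₀ a b k) x
      - coneGrad x₀ a b x) 2 (baseMeasure Ω)) atTop (𝓝 0) := by
    refine tendsto_eLpNorm_of_dominated (g := fun _ => 1 + 1) (fun k => (ht k).memLp_gradient.1) m2.1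
      (memLp_const _) (fun k => ae_of_all _ fun x => ?_) (ae_of_all _ fun x => ?_)
    · refine (norm_sub_le _ _).trans (add_le_add ?_ (norm_coneGrad_le ha x))
      rw [gradient_smoothCone ha, norm_smul, norm_neg, Real.norm_of_nonneg (bump_nonneg _ _),
        norm_smul, norm_inv, norm_norm]
      exact mul_le_one₀ (bump_le_one _ _) (by positivity) inv_mul_le_one
    · simp only [gradient_smoothCone ha]
      exact (tendsto_bump _).neg.smul_const _
  exact ⟨m1, m2, isWeakGradient_of_tendsto m1 m2 ht h1 h2, _, ht, h1, h2⟩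

lemma IsH01.const_mul {u : Euc n → ℝ} {g : Euc n → Euc n} (h : IsH01 Ω u g) (c : ℝ) :
    IsH01 Ω (fun x => c * u x) (fun x => c • g x) := by
  obtain ⟨φ, hφ, h1, h2⟩ := h.approx
  have m1 : MemLp (fun x => c * u x) 2 (baseMeasure Ω) := h.memLp.const_mul c
  have m2 : MemLp (fun x => c • g x) 2 (baseMeasure Ω) := h.memLp_grad.const_smul c
  have k1 : Tendsto (fun k => eLpNorm (fun x => (c • φ k) x - c * u x) 2 (baseMeasure Ω))
      atTop (𝓝 0) := by
    have := ENNReal.Tendsto.const_mul (a := ‖c‖ₑ) h1 (Or.inr (by simp))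
    rw [mul_zero] at this
    refine this.congr fun k => ?_
    rw [← eLpNorm_const_smul]
    congr 1
    ext x
    simp [mul_sub]
  have k2 : Tendsto (fun k => eLpNorm (fun x => gradient (c • φ k) x - c • g x) 2 (baseMeasure Ω))
      atTop (𝓝 0) := by
    have := ENNReal.Tendsto.const_mul (a := ‖c‖ₑ) h2 (Or.inr (by simp))
    rw [mul_zero] at this
    refine this.congr fun k => ?_
    rw [← eLpNorm_const_smul, gradient_smul c (hφ k).differentiable]
    congr 1
    ext1 x
    simp [smul_sub]
  exact ⟨m1, m2, isWeakGradient_of_tendsto m1 m2 (fun k => (hφ k).smul c) k1 k2, _,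
    fun k => (hφ k).smul c, k1, k2⟩

lemma truncCone_eq {τ σ t : ℝ} (hτ : 0 < τ) (hσ : σ ∈ Ioo (0 : ℝ) 1) :
    truncCone x₀ τ σ t = fun x => t / ((1 - σ) * τ) * cone x₀ (σ * τ) τ x := by
  have hστ : σ * τ ≤ τ := mul_le_of_le_one_left hτ.le hσ.2.le
  have hpos : (1 - σ) * τ ≠ 0 := (mul_pos (by linarith [hσ.2]) hτ).ne'
  ext1 x
  simp only [truncCone, mem_ball_iff_norm, cone]
  split_ifs with h1 h2
  · rw [integral_indicator_of_le_left hστ h1.le, show τ - σ * τ = (1 - σ) * τ by ring,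
      div_mul_cancel₀ _ hpos]
  · rw [integral_indicator_of_mem (not_lt.1 h1) h2.le]
  · rw [integral_indicator_of_ge (not_lt.1 h2), mul_zero]

end Cone

/-! ### The energy of the truncated cone -/

section ConeEnergy

variable {n : ℕ} {Ω : Set (Euc n)} {x₀ : Euc n}

lemma unitBallVolume_pos (n : ℕ) : 0 < unitBallVolume n :=
  div_pos (Real.rpow_pos_of_pos Real.pi_pos _) (Real.Gamma_pos_of_pos (by positivity))

lemma volume_ball_toReal (hn : 0 < n) (x : Euc n) {r : ℝ} (hr : 0 ≤ r) :
    (volume (Metric.ball x r)).toReal = unitBallVolume n * r ^ n := by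
  have : Nonempty (Fin n) := Fin.pos_iff_nonempty.1 hn
  have h : √Real.pi ^ n / Real.Gamma ((n : ℝ) / 2 + 1) = unitBallVolume n := by
    rw [unitBallVolume, Real.sqrt_eq_rpow, ← Real.rpow_natCast, ← Real.rpow_mul Real.pi_pos.le,
      add_comm]
    congr 2
    ring
  rw [EuclideanSpace.volume_ball, Fintype.card_fin, h, ENNReal.toReal_mul, ENNReal.toReal_pow,
    ENNReal.toReal_ofReal hr, ENNReal.toReal_ofReal (unitBallVolume_pos n).le, mul_comm]

lemma volume_closedBall_toReal (hn : 0 < n) (x : Euc n) {r : ℝ} (hr : 0 ≤ r) :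
    (volume (Metric.closedBall x r)).toReal = unitBallVolume n * r ^ n := by
  have : Nontrivial (Euc n) := by
    have : Nonempty (Fin n) := Fin.pos_iff_nonempty.1 hn
    infer_instance
  rw [Measure.addHaar_closedBall_eq_addHaar_ball, volume_ball_toReal hn x hr]

lemma integral_indicator_baseMeasure {S : Set (Euc n)} (hS : MeasurableSet S) (hSΩ : S ⊆ Ω)
    (c : ℝ) : ∫ x, S.indicator (fun _ => c) x ∂(baseMeasure Ω) = (volume S).toReal * c := by
  rw [integral_indicator_const c hS, baseMeasure, Measure.real, Measure.restrict_apply hS,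
    inter_eq_left.2 hSΩ, smul_eq_mul]

lemma integral_norm_coneGrad_sq (hn : 0 < n) {a b : ℝ} (ha : 0 < a) (hab : a < b)
    (hΩ : Metric.ball x₀ b ⊆ Ω) :
    ∫ x, ‖coneGrad x₀ a b x‖ ^ 2 ∂(baseMeasure Ω) = unitBallVolume n * (b ^ n - a ^ n) := by
  have hsub : Metric.closedBall x₀ a ⊆ Metric.ball x₀ b := Metric.closedBall_subset_ball hab
  simp only [norm_coneGrad_sq ha]
  rw [integral_indicator_baseMeasure (Metric.isOpen_ball.measurableSet.diff
      Metric.isClosed_closedBall.measurableSet) (sdiff_subset.trans hΩ),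
    measure_sdiff hsub Metric.isClosed_closedBall.measurableSet.nullMeasurableSet
      measure_closedBall_lt_top.ne,
    ENNReal.toReal_sub_of_le (measure_mono hsub) measure_ball_lt_top.ne,
    volume_ball_toReal hn _ (ha.trans hab).le, volume_closedBall_toReal hn _ ha.le]
  ring

variable {τ σ t : ℝ}

/-- The gradient of the truncated cone of height `t`. -/
def truncConeGrad (x₀ : Euc n) (τ σ t : ℝ) (x : Euc n) : Euc n :=
  (t / ((1 - σ) * τ)) • coneGrad x₀ (σ * τ) τ x

lemma isH01_truncCone (hb : Bornology.IsBounded Ω) (hτ : 0 < τ) (hσ : σ ∈ Ioo (0 : ℝ) 1)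
    (hΩ : Metric.ball x₀ τ ⊆ Ω) :
    IsH01 Ω (truncCone x₀ τ σ t) (truncConeGrad x₀ τ σ t) := by
  rw [truncCone_eq hτ hσ]
  exact (isH01_cone hb (mul_pos hσ.1 hτ) (mul_le_of_le_one_left hτ.le hσ.2.le) hΩ).const_mul _

lemma abs_truncCone_le (hτ : 0 < τ) (hσ : σ ∈ Ioo (0 : ℝ) 1) (x : Euc n) :
    |truncCone x₀ τ σ t x| ≤ |t| := by
  have hστ : σ * τ ≤ τ := mul_le_of_le_one_left hτ.le hσ.2.le
  have hpos : 0 < (1 - σ) * τ := mul_pos (by linarith [hσ.2]) hτ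
  rw [truncCone_eq hτ hσ, abs_mul, abs_div, abs_of_pos hpos, abs_of_nonneg (cone_nonneg hστ x),
    div_mul_eq_mul_div, div_le_iff₀ hpos]
  gcongr
  exact (cone_le hστ x).trans_eq (by ring)

/-- The gradient has constant length |t|/((1 - σ)τ) on the annulus and vanishes elsewhere, so the
horizontal energy is exact. Only the vertical one is estimated, by |ω| ≤ |t| on all of Ω, whence
|Ω|/4. -/
lemma phi_truncCone_le (hn : 2 ≤ n) (hb : Bornology.IsBounded Ω) (hτ : 0 < τ)
    (hσ : σ ∈ Ioo (0 : ℝ) 1) (hΩ : Metric.ball x₀ τ ⊆ Ω) :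
    Phi (isH01_truncCone (t := t) hb hτ hσ hΩ).extSpace ≤ t ^ 2 / 2 *
      (unitBallVolume n * τ ^ (n - 2) * (1 - σ ^ n) / (1 - σ) ^ 2 + (volume Ω).toReal / 4) := by
  have := isFiniteMeasure_baseMeasure hb
  have h1σ : 1 - σ ≠ 0 := by linarith [hσ.2]
  have hgrad : ∫ x, ‖truncConeGrad x₀ τ σ t x‖ ^ 2 ∂(baseMeasure Ω)
      = t ^ 2 * (unitBallVolume n * τ ^ (n - 2) * (1 - σ ^ n) / (1 - σ) ^ 2) := by
    simp only [truncConeGrad, norm_smul, mul_pow, Real.norm_eq_abs, sq_abs]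
    rw [integral_const_mul, integral_norm_coneGrad_sq (by lia) (mul_pos hσ.1 hτ)
      (mul_lt_of_lt_one_left hτ hσ.2) hΩ]
    -- The truncated subtraction in τ^(n - 2) becomes a genuine exponent, so that τ^n/τ² simplifies.
    obtain ⟨m, rfl⟩ := Nat.exists_eq_add_of_le' hn
    rw [Nat.add_sub_cancel]
    field_simp
    ring
  have hval : ∫ x, truncCone x₀ τ σ t x ^ 2 ∂(baseMeasure Ω) ≤ t ^ 2 * (volume Ω).toReal := by
    calc ∫ x, truncCone x₀ τ σ t x ^ 2 ∂(baseMeasure Ω) ≤ ∫ _, t ^ 2 ∂(baseMeasure Ω) :=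
          integral_mono (isH01_truncCone hb hτ hσ hΩ).memLp.integrable_sq (integrable_const _)
            fun x => sq_le_sq.2 (abs_truncCone_le hτ hσ x)
      _ = t ^ 2 * (volume Ω).toReal := by
          rw [integral_const, baseMeasure, Measure.real, Measure.restrict_apply_univ, smul_eq_mul,
            mul_comm]
  rw [IsH01.phi_extSpace, hgrad]
  linarith

end ConeEnergy

/-! ### The weight and the nonlinear functional -/

section Weight

variable {n : ℕ} {Ω : Set (Euc n)} {β : Euc n → ℝ} {f : ℝ → ℝ}

lemma ae_abs_le_supNorm (hβ : MemLp β ∞ (baseMeasure Ω)) :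
    ∀ᵐ x ∂(baseMeasure Ω), |β x| ≤ supNorm Ω β := by
  filter_upwards [enorm_ae_le_eLpNormEssSup β (baseMeasure Ω)] with x hx
  rw [← eLpNorm_exponent_top] at hx
  have := ENNReal.toReal_mono hβ.2.ne hx
  rwa [toReal_enorm] at this

lemma ae_essInf_le_weight (hβ : MemLp β ∞ (baseMeasure Ω)) :
    ∀ᵐ x ∂(baseMeasure Ω), essInf β (baseMeasure Ω) ≤ β x :=
  ae_essInf_le ⟨-supNorm Ω β, eventually_map.2 <| by
    filter_upwards [ae_abs_le_supNorm hβ] with x hx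
    exact (abs_le.1 hx).1⟩

lemma essInf_le_supNorm (hΩo : IsOpen Ω) (hne : Ω.Nonempty) (hβ : MemLp β ∞ (baseMeasure Ω)) :
    essInf β (baseMeasure Ω) ≤ supNorm Ω β := by
  have : NeZero (baseMeasure Ω) :=
    ⟨fun h => (hΩo.measure_pos volume hne).ne' (Measure.restrict_eq_zero.1 h)⟩
  obtain ⟨x, h1, h2⟩ := ((ae_essInf_le_weight hβ).and (ae_abs_le_supNorm hβ)).exists
  exact h1.trans ((le_abs_self _).trans h2)

lemma isSuperposition_weight (hβ : MemLp β ∞ (baseMeasure Ω)) (hf : Continuous f)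
    (hle : ∀ t, |f t| ≤ slopeConst f * |t|) (hpos : 0 < slopeConst f) {lam : ℝ} (hlam : 0 ≤ lam) :
    IsSuperposition (baseMeasure Ω) (fun x => lam * β x) f (lam * supNorm Ω β) (slopeConst f) where
  continuous := hf
  le := hle
  measurable := hβ.1.const_mul lam
  bound := by
    filter_upwards [ae_abs_le_supNorm hβ] with x hx
    rw [abs_mul, abs_of_nonneg hlam]
    gcongr
  nonneg := mul_nonneg hlam ENNReal.toReal_nonneg
  pos := hpos

lemma abs_primitive_le_maxPrimitive (hf : Continuous f) {s t : ℝ} (hst : |s| ≤ |t|) :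
    |primitive f s| ≤ maxPrimitive f t :=
  le_csSup (isCompact_Icc.image (continuous_primitive hf).abs).bddAbove ⟨s, abs_le.1 hst, rfl⟩

lemma maxPrimitive_nonneg (hf : Continuous f) (t : ℝ) : 0 ≤ maxPrimitive f t :=
  (abs_nonneg _).trans (abs_primitive_le_maxPrimitive hf le_rfl)

lemma primitive_pos_of_gain_pos (hf : Continuous f) (hβpos : 0 < essInf β (baseMeasure Ω))
    {t σ : ℝ} (hσ : σ ∈ Ioo (0 : ℝ) 1) (hD : 0 < gain Ω β f t σ) : 0 < primitive f t := by
  have h1 : 0 ≤ (1 - σ ^ n) * maxPrimitive f t * supNorm Ω β :=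
    mul_nonneg (mul_nonneg (sub_nonneg.2 (pow_le_one₀ hσ.1.le hσ.2.le)) (maxPrimitive_nonneg hf t))
      ENNReal.toReal_nonneg
  have h2 : 0 < primitive f t * (σ ^ n * essInf β (baseMeasure Ω)) := by
    rw [gain] at hD
    linarith
  exact pos_of_mul_pos_left h2 (mul_pos (pow_pos hσ.1 n) hβpos).le

/-- At σ = 1 the gain is F(t) times the essential infimum of β, and it is continuous in σ. -/
lemma exists_gain_pos (hβpos : 0 < essInf β (baseMeasure Ω)) {t : ℝ} (ht : 0 < primitive f t) :
    ∃ σ ∈ Ioo (0 : ℝ) 1, 0 < gain Ω β f t σ := by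
  have hc : Continuous (gain Ω β f t) := by unfold gain; fun_prop
  have h1 : 0 < gain Ω β f t 1 := by
    simp only [gain, one_pow, sub_self, zero_mul, sub_zero, mul_one]
    exact mul_pos ht hβpos
  have h2 : ∀ᶠ σ in 𝓝[<] (1 : ℝ), 0 < gain Ω β f t σ :=
    (hc.tendsto 1).mono_left nhdsWithin_le_nhds |>.eventually_const_lt h1
  obtain ⟨σ, h3, h4⟩ := (h2.and (Ioo_mem_nhdsLT zero_lt_one)).exists
  exact ⟨σ, h4, h3⟩

/-- On the inner ball the integrand is at least F(t) ess inf β, as F(t) > 0; on the annulus it is at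
least -max|F| ‖β‖_∞; elsewhere F(0) = 0. The two volumes are the weights σ^n and 1 - σ^n in `gain`.
-/
lemma gain_mul_le_psi (hn : 0 < n) (hf : Continuous f) (hle : ∀ t, |f t| ≤ slopeConst f * |t|)
    (hpos : 0 < slopeConst f) (hb : Bornology.IsBounded Ω) (hβ : MemLp β ∞ (baseMeasure Ω))
    (hβpos : 0 < essInf β (baseMeasure Ω)) {x₀ : Euc n} {τ σ t : ℝ} (hτ : 0 < τ)
    (hσ : σ ∈ Ioo (0 : ℝ) 1) (hΩ : Metric.ball x₀ τ ⊆ Ω) (hD : 0 < gain Ω β f t σ) :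
    unitBallVolume n * τ ^ n * gain Ω β f t σ
      ≤ ∫ x, β x * primitive f (truncCone x₀ τ σ t x) ∂(baseMeasure Ω) := by
  have := isFiniteMeasure_baseMeasure hb
  have hFt := primitive_pos_of_gain_pos hf hβpos hσ hD
  have hsub : Metric.ball x₀ (σ * τ) ⊆ Metric.ball x₀ τ :=
    Metric.ball_subset_ball (mul_le_of_le_one_left hτ.le hσ.2.le)
  set S := Metric.ball x₀ (σ * τ)
  set A := Metric.ball x₀ τ \ S
  have hS : MeasurableSet S := Metric.isOpen_ball.measurableSet
  have hA : MeasurableSet A := Metric.isOpen_ball.measurableSet.diff hS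
  set m := primitive f t * essInf β (baseMeasure Ω)
  set M := maxPrimitive f t * supNorm Ω β
  have hi : Integrable (fun x => β x * primitive f (truncCone x₀ τ σ t x)) (baseMeasure Ω) := by
    simpa using (isSuperposition_weight hβ hf hle hpos zero_le_one).integrable
      (isH01_truncCone hb hτ hσ hΩ).memLp
  have hiS : Integrable (S.indicator fun _ => m) (baseMeasure Ω) := (integrable_const _).indicator hS
  have hiA : Integrable (A.indicator fun _ => M) (baseMeasure Ω) := (integrable_const _).indicator hA
  have hvA : (volume A).toReal = unitBallVolume n * τ ^ n - unitBallVolume n * (σ * τ) ^ n := by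
    rw [measure_sdiff hsub hS.nullMeasurableSet measure_ball_lt_top.ne,
      ENNReal.toReal_sub_of_le (measure_mono hsub) measure_ball_lt_top.ne,
      volume_ball_toReal hn _ hτ.le, volume_ball_toReal hn _ (mul_pos hσ.1 hτ).le]
  calc unitBallVolume n * τ ^ n * gain Ω β f t σ
      = ∫ x, (S.indicator (fun _ => m) x - A.indicator (fun _ => M) x) ∂(baseMeasure Ω) := by
        rw [integral_sub hiS hiA, integral_indicator_baseMeasure hS (hsub.trans hΩ),
          integral_indicator_baseMeasure hA (sdiff_subset.trans hΩ), hvA,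
          volume_ball_toReal hn _ (mul_pos hσ.1 hτ).le, gain, mul_pow]
        ring
    _ ≤ _ := by
        refine integral_mono_ae (hiS.sub hiA) hi ?_
        filter_upwards [ae_abs_le_supNorm hβ, ae_essInf_le_weight hβ] with x h1 h2
        by_cases hxS : x ∈ S
        · have hxA : x ∉ A := fun h => h.2 hxS
          rw [indicator_of_mem hxS, indicator_of_notMem hxA, truncCone, if_pos hxS, sub_zero,
            mul_comm (β x)]
          exact mul_le_mul_of_nonneg_left h2 hFt.le
        by_cases hxB : x ∈ Metric.ball x₀ τ
        · rw [indicator_of_notMem hxS, indicator_of_mem (show x ∈ A from ⟨hxB, hxS⟩), zero_sub]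
          refine neg_le_of_abs_le ?_
          rw [abs_mul, mul_comm]
          exact mul_le_mul (abs_primitive_le_maxPrimitive hf (abs_truncCone_le hτ hσ x)) h1
            (abs_nonneg _) (maxPrimitive_nonneg hf t)
        · rw [indicator_of_notMem hxS, indicator_of_notMem (fun h => hxB h.1), truncCone,
            if_neg hxS, if_neg hxB, primitive_zero]
          simp

end Weight

/-! ### Two weak solutions -/

section Solutions

lemma inner_eq_of_eq_adjoint {H L : Type*} [NormedAddCommGroup H] [InnerProductSpace ℝ H]
    [CompleteSpace H] [NormedAddCommGroup L] [InnerProductSpace ℝ L] [CompleteSpace L]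
    {T : H →L[ℝ] L} {z : H} {v : L} (hz : z = T.adjoint v) (l : H) : ⟪z, l⟫ = ⟪v, T l⟫ := by
  rw [hz, ContinuousLinearMap.adjoint_inner_left]

/-- Nonzero critical points at different levels have different images. -/
lemma image_ne_of_critical {H L : Type*} [NormedAddCommGroup H] [InnerProductSpace ℝ H]
    [CompleteSpace H] [NormedAddCommGroup L] [InnerProductSpace ℝ L] [CompleteSpace L]
    {T : H →L[ℝ] L} {G : L → ℝ} {g : L → L} (hG0 : G 0 = 0) (hg0 : g 0 = 0) {z₁ z₂ : H}
    (h1 : z₁ = T.adjoint (g (T z₁))) (h2 : z₂ = T.adjoint (g (T z₂)))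
    (h3 : 1 / 2 * ‖z₁‖ ^ 2 < G (T z₁)) (h4 : G (T z₂) < 1 / 2 * ‖z₂‖ ^ 2) :
    T z₁ ≠ 0 ∧ T z₂ ≠ 0 ∧ T z₁ ≠ T z₂ := by
  refine ⟨fun h => ?_, fun h => ?_, fun h => ?_⟩
  · rw [h, hG0] at h3
    exact (by positivity : 0 ≤ 1 / 2 * ‖z₁‖ ^ 2).not_gt h3
  · rw [h, hg0, map_zero] at h2
    rw [h, hG0, h2] at h4
    simp at h4
  -- A critical point is recovered from its image by z = T* g(T z), so equal images would force
  -- equal energies.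
  · have hz : z₁ = z₂ := by rw [h1, h2, h]
    rw [hz] at h3
    exact lt_asymm h3 h4

variable {n : ℕ} {Ω : Set (Euc n)} {β : Euc n → ℝ} {f : ℝ → ℝ} {lam : ℝ}

lemma IsAdmissible.isWeakSolution (h : IsAdmissible Ω) (hΩ : IsOpen Ω) (hne : Ω.Nonempty)
    {B c : ℝ} (hs : IsSuperposition (baseMeasure Ω) (fun x => lam * β x) f B c) {k : energySpace Ω}
    (hk : ∀ l, ⟪k, l⟫ = ⟪hs.op (energyTrace Ω k), energyTrace Ω l⟫) :
    IsWeakSolution Ω β f lam (energyTrace Ω k) := by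
  refine ⟨h.memH0Half hΩ hne k, h.extSpace k, ae_eq_refl _, fun v => ?_⟩
  obtain ⟨l, hl1, hl2, hl3⟩ := h.exists_energy v
  rw [form_eq_inner (w := h.extSpace k) (k := k) (ae_eq_refl _) (ae_eq_refl _) hl1 hl2, hk l,
    inner_Lp_eq, ← integral_const_mul]
  refine integral_congr_ae ?_
  filter_upwards [hs.coeFn_op (energyTrace Ω k), hl3] with x hx hxl
  rw [hx, hxl]
  simp only [IsAdmissible.extSpace]
  ring

/-- Sublinearity of f at infinity makes the right-hand side smaller than any prescribed multiple of
the solution where the solution is large, as the boundedness theorem requires. -/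
lemma IsAdmissible.memLp_top_of_inner (h : IsAdmissible Ω) (hΩ : IsOpen Ω) (hne : Ω.Nonempty)
    (hfinf : Tendsto (fun t => f t / t) (Bornology.cobounded ℝ) (𝓝 0))
    {b : Euc n → ℝ} {B c : ℝ} (hs : IsSuperposition (baseMeasure Ω) b f B c)
    {k : energySpace Ω} (hk : ∀ l, ⟪k, l⟫ = ⟪hs.op (energyTrace Ω k), energyTrace Ω l⟫) :
    MemLp (energyTrace Ω k) ∞ (baseMeasure Ω) := by
  obtain ⟨ε, hε, H⟩ := h.exists_memLp_top hΩ hne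
  have hB : 0 < B + 1 := by linarith [hs.nonneg]
  obtain ⟨M, -, hM⟩ := abs_le_mul_abs_near_infty hfinf (div_pos hε hB)
  refine H k _ M hk ?_
  filter_upwards [hs.coeFn_op (energyTrace Ω k), hs.bound] with x hx hb hMx
  rw [hx, abs_mul]
  calc |b x| * |f (energyTrace Ω k x)| ≤ (B + 1) * (ε / (B + 1) * |energyTrace Ω k x|) :=
        mul_le_mul (by linarith) (hM _ hMx) (abs_nonneg _) hB.le
    _ = ε * |energyTrace Ω k x| := by field_simp

lemma IsAdmissible.exists_two_isWeakSolution (h : IsAdmissible Ω) (hΩ : IsOpen Ω)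
    (hne : Ω.Nonempty) (hf0 : Tendsto (fun t => f t / t) (𝓝[≠] 0) (𝓝 0))
    (hfinf : Tendsto (fun t => f t / t) (Bornology.cobounded ℝ) (𝓝 0)) {B c : ℝ}
    (hs : IsSuperposition (baseMeasure Ω) (fun x => lam * β x) f B c) {w : ExtSpace Ω}
    (hw : Phi w < lam * Psi β f w) :
    ∃ u₁ u₂ : Euc n → ℝ, IsWeakSolution Ω β f lam u₁ ∧ IsWeakSolution Ω β f lam u₂ ∧
      MemLp u₁ ∞ (baseMeasure Ω) ∧ MemLp u₂ ∞ (baseMeasure Ω) ∧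
      ¬ (u₁ =ᵐ[baseMeasure Ω] 0) ∧ ¬ (u₂ =ᵐ[baseMeasure Ω] 0) ∧
      ¬ (u₁ =ᵐ[baseMeasure Ω] u₂) := by
  have := isFiniteMeasure_baseMeasure h.bounded
  have hc := hs.pos
  have hB := hs.nonneg
  have hneg : ∃ k, 1 / 2 * ‖k‖ ^ 2 < potential (fun x => lam * β x) f (energyTrace Ω k) := by
    obtain ⟨k, h1, h2, h3⟩ := h.exists_energy w
    refine ⟨k, ?_⟩
    rw [← real_inner_self_eq_norm_sq, ← form_eq_inner h1 h2 h1 h2]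
    refine hw.trans_eq ?_
    rw [Psi, ← integral_const_mul]
    refine integral_congr_ae ?_
    filter_upwards [h3] with x hx
    rw [hx, mul_assoc]
  have hop0 : hs.op 0 = 0 := by
    simpa using hs.norm_op_le 0
  obtain ⟨z₁, z₂, h1, h2, h3, h4⟩ := exists_two_critical_points
    (h.isCompactOperator_energyTrace hΩ.measurableSet)
    (fun v => hasFDerivAt_potential hs hfinf v)
    (fun R ε hε => uniform_continuity_op hs hfinf R hε)
    (fun R => ⟨B * c * R, fun u hu => (hs.norm_op_le u).trans (by gcongr)⟩)
    (fun ε hε => potential_growth hs hfinf hε) potential_zero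
    (potential_comp_le hs hf0 fun ε hε => h.exists_averageOp hΩ.measurableSet hε |>.imp
      fun P hP => hP.2) hneg
  obtain ⟨n1, n2, n3⟩ := image_ne_of_critical potential_zero hop0 h1 h2 h3 h4
  have i1 := inner_eq_of_eq_adjoint h1
  have i2 := inner_eq_of_eq_adjoint h2
  exact ⟨_, _, h.isWeakSolution hΩ hne hs i1, h.isWeakSolution hΩ hne hs i2,
    h.memLp_top_of_inner hΩ hne hfinf hs i1, h.memLp_top_of_inner hΩ hne hfinf hs i2,
    fun h0 => n1 ((Lp.eq_zero_iff_ae_eq_zero).2 h0), fun h0 => n2 ((Lp.eq_zero_iff_ae_eq_zero).2 h0),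
    fun h0 => n3 (Lp.ext h0)⟩

end Solutions

/-! ### The lower bound for the threshold -/

section LowerBound

variable {n : ℕ} {Ω : Set (Euc n)} {β : Euc n → ℝ} {f : ℝ → ℝ}

/-- Combine |F(t)| ≤ c_f t²/2 with √λ₁ ‖Tr w‖² ≤ ‖∇w‖²; the factors ½ match that of `Phi`. Division
by Ψ(w) gives the lower bound for every quotient. -/
lemma IsAdmissible.sqrt_mul_psi_le (h : IsAdmissible Ω) (hΩ : IsOpen Ω) (hne : Ω.Nonempty)
    (hβ : MemLp β ∞ (baseMeasure Ω)) (hf : Continuous f)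
    (hle : ∀ t, |f t| ≤ slopeConst f * |t|) (hpos : 0 < slopeConst f) (w : ExtSpace Ω) :
    √(firstEigenvalue Ω) * Psi β f w ≤ slopeConst f * supNorm Ω β * Phi w := by
  have hs := isSuperposition_weight hβ hf hle hpos zero_le_one
  have hN : 0 ≤ supNorm Ω β := ENNReal.toReal_nonneg
  obtain ⟨k, h1, h2, h3⟩ := h.exists_energy w
  have hΨ : Psi β f w = potential (fun x => 1 * β x) f (energyTrace Ω k) := by
    refine integral_congr_ae ?_
    filter_upwards [h3] with x hx
    rw [hx, one_mul]
  have h4 : Psi β f w ≤ supNorm Ω β * (slopeConst f / 2 * ‖energyTrace Ω k‖ ^ 2) := by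
    rw [hΨ, norm_Lp_real_sq, ← integral_const_mul, ← one_mul (supNorm Ω β)]
    exact hs.potential_le ((integrable_sq_Lp _).const_mul _)
      (ae_of_all _ fun x => hs.abs_primitive_le _)
  have h5 := h.sqrt_firstEigenvalue_mul_le hΩ hne k
  rw [Phi, form_eq_inner h1 h2 h1 h2, real_inner_self_eq_norm_sq]
  calc √(firstEigenvalue Ω) * Psi β f w
      ≤ √(firstEigenvalue Ω) * (supNorm Ω β * (slopeConst f / 2 * ‖energyTrace Ω k‖ ^ 2)) := by
        gcongr
    _ = slopeConst f * supNorm Ω β * (1 / 2) * (√(firstEigenvalue Ω) * ‖energyTrace Ω k‖ ^ 2) := by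
        ring
    _ ≤ slopeConst f * supNorm Ω β * (1 / 2) * ‖k‖ ^ 2 := by gcongr
    _ = _ := by ring

lemma IsAdmissible.div_le_of_mem_quotients (h : IsAdmissible Ω) (hΩ : IsOpen Ω) (hne : Ω.Nonempty)
    (hβ : MemLp β ∞ (baseMeasure Ω)) (hf : Continuous f)
    (hle : ∀ t, |f t| ≤ slopeConst f * |t|) (hpos : 0 < slopeConst f) (hN : 0 < supNorm Ω β) {q : ℝ}
    (hq : q ∈ quotients Ω β f) :
    √(firstEigenvalue Ω) / (slopeConst f * supNorm Ω β) ≤ q := by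
  obtain ⟨w, hw, rfl⟩ := hq
  rw [div_le_div_iff₀ (mul_pos hpos hN) hw, mul_comm (Phi w)]
  exact h.sqrt_mul_psi_le hΩ hne hβ hf hle hpos w

end LowerBound

end HalfLaplacian

end

/-! ### The theorem -/

theorem mainTheorem3 (n : ℕ) (hn : 2 ≤ n) (Ω : Set (Euc n)) (hΩo : IsOpen Ω)
    (hΩne : Ω.Nonempty) (hΩb : Bornology.IsBounded Ω) (hΩL : HasLipschitzBoundary Ω)
    (β : Euc n → ℝ) (hβ : MemLp β ∞ (baseMeasure Ω)) (hβpos : 0 < essInf β (baseMeasure Ω))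
    (f : ℝ → ℝ) (hf : Continuous f)
    (hf0 : Tendsto (fun t => f t / t) (𝓝[≠] 0) (𝓝 0))
    (hfinf : Tendsto (fun t => f t / t) (Bornology.cobounded ℝ) (𝓝 0))
    (hF : ∃ t : ℝ, 0 < primitive f t) :
    -- the constants are well defined and positive
    IsLeast (dirichletEigenvalues Ω) (firstEigenvalue Ω) ∧ 0 < firstEigenvalue Ω ∧
    IsGreatest (slopes f) (slopeConst f) ∧ 0 < slopeConst f ∧
    IsGLB (quotients Ω β f) (lambdaStar Ω β f) ∧
    -- the lower bound
    √(firstEigenvalue Ω) / (slopeConst f * supNorm Ω β) ≤ lambdaStar Ω β f ∧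
    -- the upper bound and its consequence
    ∀ (x₀ : Euc n) (τ : ℝ), 0 < τ → Metric.ball x₀ τ ⊆ Ω →
      (∃ t₀ σ₀ : ℝ, σ₀ ∈ Ioo (0 : ℝ) 1 ∧ 0 < gain Ω β f t₀ σ₀) ∧
      ∀ t₀ σ₀ : ℝ, σ₀ ∈ Ioo (0 : ℝ) 1 → 0 < gain Ω β f t₀ σ₀ →
        (∃ w : ExtSpace Ω,
          w.toFun = (fun p => Real.exp (-p.2 / 2) * truncCone x₀ τ σ₀ t₀ p.1) ∧
          w.tr = truncCone x₀ τ σ₀ t₀ ∧ 0 < Psi β f w ∧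
          lambdaStar Ω β f ≤ Phi w / Psi β f w ∧
          Phi w / Psi β f w ≤ lambdaZero Ω β f τ t₀ σ₀) ∧
        lambdaStar Ω β f ≤ lambdaZero Ω β f τ t₀ σ₀ ∧
        ∀ lam : ℝ, lambdaZero Ω β f τ t₀ σ₀ < lam →
          ∃ u₁ u₂ : Euc n → ℝ,
            IsWeakSolution Ω β f lam u₁ ∧ IsWeakSolution Ω β f lam u₂ ∧
            MemLp u₁ ∞ (baseMeasure Ω) ∧ MemLp u₂ ∞ (baseMeasure Ω) ∧
            ¬ (u₁ =ᵐ[baseMeasure Ω] 0) ∧ ¬ (u₂ =ᵐ[baseMeasure Ω] 0) ∧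
            ¬ (u₁ =ᵐ[baseMeasure Ω] u₂) := by
  have h : IsAdmissible Ω := ⟨by lia, hΩb⟩
  obtain ⟨-, -, -, -, -, hleast, hpos₁, -⟩ := h.exists_dirichlet_basis hΩo hΩne
  obtain ⟨hgreatest, hcf⟩ := isGreatest_slopeConst hf hf0 hfinf hF
  have hle := abs_le_slopeConst_mul hf hf0 hgreatest
  have hN : 0 < supNorm Ω β := hβpos.trans_le (essInf_le_supNorm hΩo hΩne hβ)
  have hlower : √(firstEigenvalue Ω) / (slopeConst f * supNorm Ω β)
      ∈ lowerBounds (quotients Ω β f) :=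
    fun q hq => h.div_le_of_mem_quotients hΩo hΩne hβ hf hle hcf hN hq
  have hcone : ∀ (x₀ : Euc n) (τ : ℝ), 0 < τ → Metric.ball x₀ τ ⊆ Ω →
      ∀ t₀ σ₀ : ℝ, σ₀ ∈ Ioo (0 : ℝ) 1 → 0 < gain Ω β f t₀ σ₀ → ∃ w : ExtSpace Ω,
        w.toFun = (fun p => Real.exp (-p.2 / 2) * truncCone x₀ τ σ₀ t₀ p.1) ∧
        w.tr = truncCone x₀ τ σ₀ t₀ ∧ 0 < Psi β f w ∧
        Phi w / Psi β f w ≤ lambdaZero Ω β f τ t₀ σ₀ := by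
    intro x₀ τ hτ hball t σ hσ hD
    have hden : 0 < unitBallVolume n * τ ^ n * gain Ω β f t σ :=
      mul_pos (mul_pos (unitBallVolume_pos n) (pow_pos hτ n)) hD
    have hψ := gain_mul_le_psi h.pos hf hle hcf hΩb hβ hβpos hτ hσ hball hD
    have hφ := phi_truncCone_le (t := t) hn hΩb hτ hσ hball
    refine ⟨(isH01_truncCone hΩb hτ hσ hball).extSpace, rfl, rfl, hden.trans_le hψ, ?_⟩
    have h0 : 0 ≤ t ^ 2 / 2 * (unitBallVolume n * τ ^ (n - 2) * (1 - σ ^ n) / (1 - σ) ^ 2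
        + (volume Ω).toReal / 4) := by
      have h1 : 0 ≤ 1 - σ ^ n := sub_nonneg.2 (pow_le_one₀ hσ.1.le hσ.2.le)
      have h2 := unitBallVolume_pos n
      positivity
    refine (div_le_div₀ h0 hφ hden hψ).trans_eq ?_
    rw [lambdaZero, div_mul_eq_mul_div, div_div]
    simp only [mul_assoc]
  have hgain : ∃ t₀ σ₀ : ℝ, σ₀ ∈ Ioo (0 : ℝ) 1 ∧ 0 < gain Ω β f t₀ σ₀ :=
    hF.imp fun t ht => exists_gain_pos hβpos ht
  -- For an empty set `sInf` would be the default value 0; a cone on any ball in Ω makes λ* a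
  -- genuine infimum.
  have hne : (quotients Ω β f).Nonempty := by
    obtain ⟨x₀, hx₀⟩ := hΩne
    obtain ⟨τ, hτ, hball⟩ := Metric.isOpen_iff.1 hΩo x₀ hx₀
    obtain ⟨t₀, σ₀, hσ, hD⟩ := hgain
    obtain ⟨w, -, -, hw, -⟩ := hcone x₀ τ hτ hball t₀ σ₀ hσ hD
    exact ⟨_, w, hw, rfl⟩
  have hglb : IsGLB (quotients Ω β f) (lambdaStar Ω β f) := isGLB_csInf hne ⟨_, hlower⟩
  have hstar := hglb.2 hlower
  refine ⟨hleast, hpos₁, hgreatest, hcf, hglb, hstar, fun x₀ τ hτ hball => ⟨hgain, ?_⟩⟩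
  intro t₀ σ₀ hσ hD
  obtain ⟨w, hw1, hw2, hw3, hw4⟩ := hcone x₀ τ hτ hball t₀ σ₀ hσ hD
  have hw5 : lambdaStar Ω β f ≤ Phi w / Psi β f w := hglb.1 ⟨w, hw3, rfl⟩
  refine ⟨⟨w, hw1, hw2, hw3, hw5, hw4⟩, hw5.trans hw4, fun lam hlam => ?_⟩
  -- Nonnegativity of λ*, hence of λ, is needed for the bound λ‖β‖_∞ on the weight λβ.
  have h0 : 0 ≤ lambdaStar Ω β f := (div_nonneg (Real.sqrt_nonneg _) (by positivity)).trans hstar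
  -- Since Φ(w)/Ψ(w) ≤ λ₀ < λ, the cone extension w itself is the point of negative energy.
  exact h.exists_two_isWeakSolution hΩo hΩne hf0 hfinf
    (isSuperposition_weight hβ hf hle hcf (h0.trans (hw5.trans (hw4.trans hlam.le))))
    ((div_lt_iff₀ hw3).1 (hw4.trans_lt hlam))
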